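/- Let $\Gamma\subset\mathbb{C}$ be a smooth, bounded contour system without self-intersections, that is, a finite union of pairwise disjoint, arbitrarily oriented, $C^\infty$-smooth simple closed curves (with nowhere vanishing tangent). For a function $f:\Gamma\to\mathbb{C}^{2\times 2}$ let $$Cf(z)=\frac{1}{2\pi i}\int_\Gamma\frac{f(\zeta)}{\zeta-z}\,d\zeta\qquad(z\notin\Gamma)$$ be its Cauchy transform. There is exactly one bounded linear operator $C_-$ on $L^2(\Gamma,\mathbb{C}^{2\times 2})$ (with respect to arc length) such that, for every Hölder continuous $f$ and almost every $\eta\in\Gamma$, $C_-f(\eta)$ is the nontangential limit of $Cf(z)$ as $z\to\eta$ from the right of the oriented contour $\Gamma$. Let $G:\Gamma\to GL(2,\mathbb{C})$ be the restriction to $\Gamma$ of an analytic matrix function on a neighbourhood of $\Gamma$, and define the bounded operators $$T_G=1-(G-I)\,C_-,\qquad T_{G^{-1}}=1-(G^{-1}-I)\,C_-$$ on $L^2(\Gamma,\mathbb{C}^{2\times 2})$, where $G^{\pm1}-I$ acts by pointwise matrix multiplication from the left. Then $T_{G^{-1}}$ is a Fredholm regulator of $T_G$: one has $$T_{G^{-1}}T_G=1+K,$$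 where $K$ is a compact operator on $L^2(\Gamma,\mathbb{C}^{2\times 2})$ that is a regular (non-singular) integral operator, i.e. there is a kernel $k:\Gamma\times\Gamma\to\mathbb{C}^{2\times 2}$, Hölder continuous on all of $\Gamma\times\Gamma$, such that for every $u\in L^2(\Gamma,\mathbb{C}^{2\times 2})$ $$Ku(\zeta)=\int_\Gamma k(\zeta,\eta)\,u(\eta)\,d\eta\qquad\text{for almost every }\zeta\in\Gamma.$$ -/

import Mathlib

open MeasureTheory Filter Topology
open scoped ContDiff ENNReal NNReal

attribute [local instance] Matrix.frobeniusNormedAddCommGroup Matrix.frobeniusNormedSpace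

/-- The space `ℂ^{2×2}`; it carries the Frobenius (Hilbert–Schmidt) norm. -/
abbrev Mat2 : Type := Matrix (Fin 2) (Fin 2) ℂ

/-- A smooth, bounded contour system without self-intersections: finitely many pairwise disjoint
smooth simple closed curves in the plane, the `j`-th one being given by a regular `C^∞`
parametrization of period `1`, which also fixes its orientation. -/
structure ContourSystem where
  /-- the number of closed curves -/
  n : ℕ
  /-- the parametrizations -/
  γ : Fin n → ℝ → ℂ
  smooth : ∀ j, ContDiff ℝ ∞ (γ j)
  periodic : ∀ j, Function.Periodic (γ j) 1
  regular : ∀ j t, deriv (γ j) t ≠ 0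
  simple : ∀ j, Set.InjOn (γ j) (Set.Ico 0 1)
  disjoint : Pairwise fun j k => Disjoint (Set.range (γ j)) (Set.range (γ k))

namespace ContourSystem

/-- The point set `Γ ⊆ ℂ`. -/
def carrier (Γ : ContourSystem) : Set ℂ := ⋃ j, Set.range (Γ.γ j)

/-- The arc length measure of `Γ`, as a measure on `ℂ`. -/
noncomputable def arcLength (Γ : ContourSystem) : Measure ℂ :=
  ∑ j, Measure.map (Γ.γ j)
    ((volume.restrict (Set.Ico (0 : ℝ) 1)).withDensity fun t => ‖deriv (Γ.γ j) t‖ₑ)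

/-- The oriented contour integral `∫_Γ F(ζ) dζ`. -/
noncomputable def integral (Γ : ContourSystem) (F : ℂ → Mat2) : Mat2 :=
  ∑ j, ∫ t in (0 : ℝ)..1, deriv (Γ.γ j) t • F (Γ.γ j t)

/-- The space `L²(Γ, ℂ^{2×2})`. -/
abbrev L2 (Γ : ContourSystem) : Type := Lp Mat2 2 Γ.arcLength

/-- The Cauchy transform `C f (z) = (2πi)⁻¹ ∫_Γ f(ζ) / (ζ - z) dζ`, for `z ∉ Γ`. -/
noncomputable def cauchy (Γ : ContourSystem) (f : ℂ → Mat2) (z : ℂ) : Mat2 :=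
  (2 * (Real.pi : ℂ) * Complex.I)⁻¹ • Γ.integral fun ζ => (ζ - z)⁻¹ • f ζ

/-- The open sector with vertex `η = γ_j(t)`, of aperture governed by `c ∈ (0, 1)`, that is
symmetric about the normal to the contour at `η` and points to the right of the contour. -/
def rightSector (Γ : ContourSystem) (j : Fin Γ.n) (t c : ℝ) : Set ℂ :=
  {z | ((z - Γ.γ j t) * (starRingEnd ℂ) (deriv (Γ.γ j) t)).im
      < -(c * (‖z - Γ.γ j t‖ * ‖deriv (Γ.γ j) t‖))}

/-- `F(z) → L` as `z → η = γ_j(t)` from the right of `Γ`, nontangentially. -/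
def HasRightLimit (Γ : ContourSystem) (F : ℂ → Mat2) (j : Fin Γ.n) (t : ℝ) (L : Mat2) : Prop :=
  ∀ c : ℝ, 0 < c → Tendsto F (𝓝[Γ.rightSector j t c] (Γ.γ j t)) (𝓝 L)

/-- `f` is Hölder continuous on the set `s` (with some exponent in `(0, 1]`). -/
def IsHolderOn {X : Type*} [PseudoEMetricSpace X] (f : X → Mat2) (s : Set X) : Prop :=
  ∃ A r : ℝ≥0, 0 < r ∧ r ≤ 1 ∧ HolderOnWith A r f s

/-- `C` is the operator `C_-` on `L²(Γ, ℂ^{2×2})`: the bounded operator that sends (the class of)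
each Hölder continuous density `f` on `Γ` to the limit of the Cauchy transform of `f` from the
right of `Γ`. -/
def IsCauchyMinus (Γ : ContourSystem) (C : Γ.L2 →L[ℂ] Γ.L2) : Prop :=
  ∀ f : ℂ → Mat2, IsHolderOn f Γ.carrier → ∀ u : Γ.L2, u =ᵐ[Γ.arcLength] f →
    ∀ᵐ η ∂Γ.arcLength, ∀ j t, Γ.γ j t = η → Γ.HasRightLimit (Γ.cauchy f) j t (C u η)

/-- The jump data `G : Γ → GL(2)` (only the values on `Γ` matter) continue analytically to a
neighbourhood of `Γ`. -/
def ContinuesAnalytically (Γ : ContourSystem) (G : ℂ → GL (Fin 2) ℂ) : Prop :=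
  ∃ (U : Set ℂ) (F : ℂ → Mat2), IsOpen U ∧ Γ.carrier ⊆ U ∧ AnalyticOnNhd ℂ F U ∧
    ∀ ζ ∈ Γ.carrier, F ζ = (G ζ : Mat2)

/-- `T = 1 - (G - I) C` on `L²(Γ, ℂ^{2×2})`, where `G` acts by pointwise left multiplication. -/
def IsSingularOperator (Γ : ContourSystem) (C : Γ.L2 →L[ℂ] Γ.L2) (G : ℂ → GL (Fin 2) ℂ)
    (T : Γ.L2 →L[ℂ] Γ.L2) : Prop :=
  ∀ u : Γ.L2, T u =ᵐ[Γ.arcLength] fun ζ => u ζ - ((G ζ : Mat2) - 1) * C u ζ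

/-- `K` is a regular integral operator: `K u (ζ) = ∫_Γ k(ζ, η) u(η) dη` with a (matrix-valued)
kernel `k` that is Hölder continuous on all of `Γ × Γ`, including the diagonal. -/
def IsRegularIntegralOperator (Γ : ContourSystem) (K : Γ.L2 →L[ℂ] Γ.L2) : Prop :=
  ∃ k : ℂ → ℂ → Mat2, IsHolderOn (fun p : ℂ × ℂ => k p.1 p.2) (Γ.carrier ×ˢ Γ.carrier) ∧
    ∀ u : Γ.L2, K u =ᵐ[Γ.arcLength] fun ζ => Γ.integral fun η => k ζ η * u η

end ContourSystem

/-! Pulling everything back to parameters of period 1 reduces the problem to one explicit operator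
on the circle plus errors with Hölder kernels.

On a single curve `γ`, the quotient `Q(s,t) = (γ s - γ t) / (circ s - circ t)` extends to a smooth,
nowhere vanishing function, because `γ` is simple and regular. The logarithmic derivative of `γ s -
γ t = (circ s - circ t) Q(s,t)` in `s` shows that the Cauchy kernel of `γ` is that of the unit
circle plus a smooth kernel (`IsClosedCurve.exists_cauchyKernel_eq`). Between distinct curves the
kernel is smooth anyway. The Plemelj formula (`hasRightLimit_cauchy`) then gives `C_- = A + D`. Here
`D` has a Hölder kernel, and on each curve `A f(t) = ∫ κ(u) (f(t + u) - f(t)) du` with `κ(u) = circ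
u / (circ u - 1)`. The right side of any curve corresponds to the exterior of the circle, whatever
the orientation, so no case distinction arises.

`A` is the Fourier multiplier with symbol `0` on modes `n ≥ 0` and `-1` on modes `n < 0`. By
Parseval it is bounded on `L²` and satisfies `A² = -A`. Its commutator with a smooth matrix function
`g` has the smooth kernel `circ s (g s - g t) / (circ s - circ t)`. A version of Privalov's theorem
with loss in the exponent shows that `A` composed on either side with a Hölder-kernel operator again
has a Hölder kernel. Hence `C_-² + C_-` and `[C_-, P]`, for multiplication by smooth `P`, are
Hölder-kernel operators.

What remains is algebra. With `P = G - I` and `Q = G⁻¹ - I` one has `QP = -P - Q`, so `(1 - QC)(1 -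
PC) = 1 + Q[C,P]C + QP(C² + C)` (`regulator_identity`). The remainder has a Hölder kernel, and such
operators are compact by Arzelà–Ascoli. `C_-` is unique because Hölder densities are dense in `L²`
and nontangential limits are unique. -/

/-! ### Periodic Hölder functions and kernels -/

section PeriodicHolder

variable {E : Type*} [NormedAddCommGroup E]

/-- `f` is `1`-periodic and Hölder continuous with constant `A` and exponent `r`. -/
structure PerHolder (A r : ℝ) (f : ℝ → E) : Prop where
  periodic : Function.Periodic f 1
  bound : ∀ t h, |h| ≤ 1 → ‖f (t + h) - f t‖ ≤ A * |h| ^ r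

namespace PerHolder

variable {A A' r r' : ℝ} {f g : ℝ → E}

lemma nonneg (hf : PerHolder A r f) : 0 ≤ A := by
  have := (norm_nonneg _).trans (hf.bound 0 1 (by simp))
  simpa using this

lemma rpow_anti {h : ℝ} (hh : |h| ≤ 1) (hr' : 0 < r') (hrr : r' ≤ r) : |h| ^ r ≤ |h| ^ r' := by
  rcases eq_or_ne h 0 with rfl | h0
  · rw [abs_zero, Real.zero_rpow hr'.ne', Real.zero_rpow (hr'.trans_le hrr).ne']
  · exact Real.rpow_le_rpow_of_exponent_ge (abs_pos.2 h0) hh hrr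

/-- Only increments `|h| ≤ 1` are tested in the definition, which is what allows the exponent to be
lowered without changing the constant. For periodic functions nothing is lost. -/
lemma mono (hf : PerHolder A r f) (hA : A ≤ A') (hr' : 0 < r') (hrr : r' ≤ r) :
    PerHolder A' r' f := by
  refine ⟨hf.periodic, fun t h hh => (hf.bound t h hh).trans ?_⟩
  have := rpow_anti hh hr' hrr
  have h0 := Real.rpow_nonneg (abs_nonneg h) r
  exact mul_le_mul hA this h0 (hf.nonneg.trans hA)

lemma continuous (hf : PerHolder A r f) (hr : 0 < r) : Continuous f := by
  rw [continuous_iff_continuousAt]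
  intro t
  have h1 : Tendsto (fun h : ℝ => A * |h| ^ r) (𝓝 0) (𝓝 0) := by
    have : Continuous fun h : ℝ => A * |h| ^ r :=
      continuous_const.mul (continuous_abs.rpow_const fun _ => Or.inr hr.le)
    have h2 := this.tendsto 0
    simpa [Real.zero_rpow hr.ne'] using h2
  have h2 : Tendsto (fun h : ℝ => f (t + h) - f t) (𝓝 0) (𝓝 0) := by
    refine squeeze_zero_norm' ?_ h1
    filter_upwards [Metric.closedBall_mem_nhds (0 : ℝ) one_pos] with h hh
    exact hf.bound t h (by simpa using hh)
  have h3 : Tendsto (fun s : ℝ => s - t) (𝓝 t) (𝓝 0) := by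
    have : Continuous fun s : ℝ => s - t := by fun_prop
    simpa using this.tendsto t
  have h4 := (h2.comp h3).add_const (f t)
  simpa [ContinuousAt, Function.comp_def] using h4

lemma norm_sub_le (hf : PerHolder A r f) (hr : 0 < r) (s t : ℝ) : ‖f s - f t‖ ≤ A := by
  have h1 : f s = f (t + Int.fract (s - t)) := by
    have : t + Int.fract (s - t) = s - (⌊s - t⌋ : ℝ) * 1 := by rw [Int.fract]; ring
    rw [this, hf.periodic.sub_int_mul_eq]
  have hb : |Int.fract (s - t)| ≤ 1 := by
    rw [abs_of_nonneg (Int.fract_nonneg _)]; exact (Int.fract_lt_one _).le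
  rw [h1]
  refine (hf.bound t _ hb).trans ?_
  exact mul_le_of_le_one_right hf.nonneg (Real.rpow_le_one (abs_nonneg _) hb hr.le)

lemma norm_le (hf : PerHolder A r f) (hr : 0 < r) (t : ℝ) : ‖f t‖ ≤ ‖f 0‖ + A := by
  have := hf.norm_sub_le hr t 0
  calc ‖f t‖ = ‖f 0 + (f t - f 0)‖ := by simp
    _ ≤ _ := (norm_add_le _ _).trans (by gcongr)

lemma add (hf : PerHolder A r f) (hg : PerHolder A' r g) :
    PerHolder (A + A') r (fun t => f t + g t) := by
  refine ⟨fun t => by simp only [hf.periodic t, hg.periodic t], fun t h hh => ?_⟩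
  calc ‖f (t + h) + g (t + h) - (f t + g t)‖
      = ‖(f (t + h) - f t) + (g (t + h) - g t)‖ := by congr 1; abel
    _ ≤ A * |h| ^ r + A' * |h| ^ r :=
      (norm_add_le _ _).trans (add_le_add (hf.bound t h hh) (hg.bound t h hh))
    _ = _ := by ring

lemma const (c : E) : PerHolder 0 r (fun _ => c) :=
  ⟨fun _ => rfl, fun t h hh => by simp⟩

lemma shift (hf : PerHolder A r f) (h : ℝ) : PerHolder A r fun t => f (t + h) :=
  ⟨fun t => by rw [add_right_comm, hf.periodic], fun t h' hh => by
    rw [add_right_comm]; exact hf.bound _ _ hh⟩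

end PerHolder

/-- `1`-periodic Hölder continuous functions. -/
def IsPerHolder (f : ℝ → E) : Prop := ∃ A r : ℝ, 0 < r ∧ r ≤ 1 ∧ PerHolder A r f

namespace IsPerHolder

variable {f g : ℝ → E}

lemma periodic (hf : IsPerHolder f) : Function.Periodic f 1 := by
  obtain ⟨A, r, -, -, h⟩ := hf
  exact h.periodic

lemma continuous (hf : IsPerHolder f) : Continuous f := by
  obtain ⟨A, r, hr, -, h⟩ := hf
  exact h.continuous hr

lemma exists_bound (hf : IsPerHolder f) : ∃ B, 0 ≤ B ∧ ∀ t, ‖f t‖ ≤ B := by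
  obtain ⟨A, r, hr, -, h⟩ := hf
  exact ⟨_, add_nonneg (norm_nonneg (f 0)) h.nonneg, h.norm_le hr⟩

lemma exists_common (hf : IsPerHolder f) {F : Type*} [NormedAddCommGroup F] {g : ℝ → F}
    (hg : IsPerHolder g) :
    ∃ A r : ℝ, 0 < r ∧ r ≤ 1 ∧ PerHolder A r f ∧ PerHolder A r g := by
  obtain ⟨A, r, hr, hr1, h⟩ := hf
  obtain ⟨A', r', hr', hr1', h'⟩ := hg
  exact ⟨max A A', min r r', lt_min hr hr', (min_le_left _ _).trans hr1,
    h.mono (le_max_left _ _) (lt_min hr hr') (min_le_left _ _),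
    h'.mono (le_max_right _ _) (lt_min hr hr') (min_le_right _ _)⟩

lemma add (hf : IsPerHolder f) (hg : IsPerHolder g) : IsPerHolder (fun t => f t + g t) := by
  obtain ⟨A, r, hr, hr1, h, h'⟩ := hf.exists_common hg
  exact ⟨_, r, hr, hr1, h.add h'⟩

lemma const (c : E) : IsPerHolder (fun _ => c) := ⟨0, 1, one_pos, le_rfl, PerHolder.const c⟩

end IsPerHolder

/-- A kernel that is `1`-periodic and Hölder continuous with constant `A` and exponent `r` in each
variable, uniformly in the other one. -/
structure PerHolder₂ (A r : ℝ) (k : ℝ → ℝ → E) : Prop where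
  left : ∀ s, PerHolder A r fun t => k t s
  right : ∀ t, PerHolder A r (k t)

namespace PerHolder₂

variable {A A' r r' : ℝ} {k l : ℝ → ℝ → E}

lemma nonneg (hk : PerHolder₂ A r k) : 0 ≤ A := (hk.right 0).nonneg

lemma mono (hk : PerHolder₂ A r k) (hA : A ≤ A') (hr' : 0 < r') (hrr : r' ≤ r) :
    PerHolder₂ A' r' k :=
  ⟨fun s => (hk.left s).mono hA hr' hrr, fun t => (hk.right t).mono hA hr' hrr⟩

lemma continuous (hk : PerHolder₂ A r k) (hr : 0 < r) :
    Continuous (Function.uncurry k) := by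
  rw [continuous_iff_continuousAt]
  rintro ⟨t, s⟩
  have hφ : Tendsto (fun h : ℝ => A * |h| ^ r) (𝓝 0) (𝓝 0) := by
    have : Continuous fun h : ℝ => A * |h| ^ r :=
      continuous_const.mul (continuous_abs.rpow_const fun _ => Or.inr hr.le)
    have h2 := this.tendsto 0
    simpa [Real.zero_rpow hr.ne'] using h2
  have h1 : Tendsto (fun p : ℝ × ℝ => p.1 - t) (𝓝 (t, s)) (𝓝 0) := by
    have : Continuous fun p : ℝ × ℝ => p.1 - t := by fun_prop
    simpa using this.tendsto (t, s)
  have h2 : Tendsto (fun p : ℝ × ℝ => k p.1 p.2 - k t p.2) (𝓝 (t, s)) (𝓝 0) := by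
    refine squeeze_zero_norm' ?_ (hφ.comp h1)
    filter_upwards [h1 (Metric.closedBall_mem_nhds (0 : ℝ) one_pos)] with p hp
    have := (hk.left p.2).bound t (p.1 - t) (by simpa using hp)
    simpa using this
  have h3 : Tendsto (fun p : ℝ × ℝ => k t p.2) (𝓝 (t, s)) (𝓝 (k t s)) :=
    (((hk.right t).continuous hr).comp continuous_snd).tendsto (t, s)
  have h4 := h2.add h3
  simpa [ContinuousAt, Function.uncurry_def] using h4

lemma norm_le (hk : PerHolder₂ A r k) (hr : 0 < r) (t s : ℝ) : ‖k t s‖ ≤ ‖k 0 0‖ + A + A := by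
  have h1 := (hk.right t).norm_le hr s
  have h2 := (hk.left 0).norm_le hr t
  linarith

lemma swap (hk : PerHolder₂ A r k) : PerHolder₂ A r (fun t s => k s t) := ⟨hk.right, hk.left⟩

lemma add (hk : PerHolder₂ A r k) (hl : PerHolder₂ A' r l) :
    PerHolder₂ (A + A') r (fun t s => k t s + l t s) :=
  ⟨fun s => (hk.left s).add (hl.left s), fun t => (hk.right t).add (hl.right t)⟩

end PerHolder₂

/-- Doubly `1`-periodic Hölder continuous kernels. -/
def IsPerHolder₂ (k : ℝ → ℝ → E) : Prop := ∃ A r : ℝ, 0 < r ∧ r ≤ 1 ∧ PerHolder₂ A r k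

namespace IsPerHolder₂

variable {k l : ℝ → ℝ → E}

lemma continuous (hk : IsPerHolder₂ k) : Continuous (Function.uncurry k) := by
  obtain ⟨A, r, hr, -, h⟩ := hk
  exact h.continuous hr

lemma left (hk : IsPerHolder₂ k) (s : ℝ) : IsPerHolder (fun t => k t s) := by
  obtain ⟨A, r, hr, hr1, h⟩ := hk
  exact ⟨A, r, hr, hr1, h.left s⟩

lemma right (hk : IsPerHolder₂ k) (t : ℝ) : IsPerHolder (k t) := by
  obtain ⟨A, r, hr, hr1, h⟩ := hk
  exact ⟨A, r, hr, hr1, h.right t⟩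

lemma exists_bound (hk : IsPerHolder₂ k) : ∃ B, 0 ≤ B ∧ ∀ t s, ‖k t s‖ ≤ B := by
  obtain ⟨A, r, hr, -, h⟩ := hk
  exact ⟨_, add_nonneg (add_nonneg (norm_nonneg (k 0 0)) h.nonneg) h.nonneg, h.norm_le hr⟩

lemma swap (hk : IsPerHolder₂ k) : IsPerHolder₂ (fun t s => k s t) := by
  obtain ⟨A, r, hr, hr1, h⟩ := hk
  exact ⟨A, r, hr, hr1, h.swap⟩

lemma exists_common (hk : IsPerHolder₂ k) {F : Type*} [NormedAddCommGroup F] {l : ℝ → ℝ → F}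
    (hl : IsPerHolder₂ l) :
    ∃ A r : ℝ, 0 < r ∧ r ≤ 1 ∧ PerHolder₂ A r k ∧ PerHolder₂ A r l := by
  obtain ⟨A, r, hr, hr1, h⟩ := hk
  obtain ⟨A', r', hr', hr1', h'⟩ := hl
  exact ⟨max A A', min r r', lt_min hr hr', (min_le_left _ _).trans hr1,
    h.mono (le_max_left _ _) (lt_min hr hr') (min_le_left _ _),
    h'.mono (le_max_right _ _) (lt_min hr hr') (min_le_right _ _)⟩

lemma add (hk : IsPerHolder₂ k) (hl : IsPerHolder₂ l) :
    IsPerHolder₂ (fun t s => k t s + l t s) := by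
  obtain ⟨A, r, hr, hr1, h, h'⟩ := hk.exists_common hl
  exact ⟨_, r, hr, hr1, h.add h'⟩

lemma zero : IsPerHolder₂ (fun _ _ => (0 : E)) :=
  ⟨0, 1, one_pos, le_rfl, fun _ => PerHolder.const _, fun _ => PerHolder.const _⟩

lemma sum {ι : Type*} (S : Finset ι) {k : ι → ℝ → ℝ → E} (hk : ∀ i ∈ S, IsPerHolder₂ (k i)) :
    IsPerHolder₂ (fun t s => ∑ i ∈ S, k i t s) := by
  classical
  induction S using Finset.induction_on with
  | empty => simpa using zero
  | insert a S ha ih =>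
    simp only [Finset.sum_insert ha]
    exact (hk a (by simp)).add (ih fun i hi => hk i (by simp [hi]))

end IsPerHolder₂

section Mul

variable {R : Type*} [NormedRing R]

lemma norm_mul_sub_mul_le (a b c d : R) : ‖a * b - c * d‖ ≤ ‖a‖ * ‖b - d‖ + ‖a - c‖ * ‖d‖ := by
  calc ‖a * b - c * d‖ = ‖a * (b - d) + (a - c) * d‖ := by congr 1; noncomm_ring
    _ ≤ _ := (norm_add_le _ _).trans (add_le_add (norm_mul_le _ _) (norm_mul_le _ _))

lemma PerHolder.mul {A B C D r : ℝ} {f g : ℝ → R} (hf : PerHolder A r f) (hg : PerHolder B r g)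
    (hfC : ∀ t, ‖f t‖ ≤ C) (hgD : ∀ t, ‖g t‖ ≤ D) :
    PerHolder (C * B + A * D) r (fun t => f t * g t) := by
  refine ⟨fun t => by simp only [hf.periodic t, hg.periodic t], fun t h hh => ?_⟩
  have hp := Real.rpow_nonneg (abs_nonneg h) r
  have h1 := hf.bound t h hh
  have h2 := hg.bound t h hh
  calc _ ≤ _ := norm_mul_sub_mul_le _ _ _ _
    _ ≤ C * (B * |h| ^ r) + A * |h| ^ r * D := by
      gcongr
      · exact (norm_nonneg _).trans (hfC t)
      · exact hfC _
      · exact mul_nonneg hf.nonneg hp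
      · exact hgD _
    _ = _ := by ring

lemma IsPerHolder.mul {f g : ℝ → R} (hf : IsPerHolder f) (hg : IsPerHolder g) :
    IsPerHolder (fun t => f t * g t) := by
  obtain ⟨C, -, hC⟩ := hf.exists_bound
  obtain ⟨D, -, hD⟩ := hg.exists_bound
  obtain ⟨A, r, hr, hr1, h, h'⟩ := hf.exists_common hg
  exact ⟨_, r, hr, hr1, h.mul h' hC hD⟩

lemma IsPerHolder₂.mul {k l : ℝ → ℝ → R} (hk : IsPerHolder₂ k) (hl : IsPerHolder₂ l) :
    IsPerHolder₂ (fun t s => k t s * l t s) := by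
  obtain ⟨C, -, hC⟩ := hk.exists_bound
  obtain ⟨D, -, hD⟩ := hl.exists_bound
  obtain ⟨A, r, hr, hr1, h, h'⟩ := hk.exists_common hl
  exact ⟨_, r, hr, hr1, fun s => (h.left s).mul (h'.left s) (fun t => hC t s) (fun t => hD t s),
    fun t => (h.right t).mul (h'.right t) (hC t) (hD t)⟩

end Mul

lemma IsPerHolder.of_left {g : ℝ → E} (hg : IsPerHolder g) : IsPerHolder₂ (fun t _ => g t) := by
  obtain ⟨A, r, hr, hr1, h⟩ := hg
  exact ⟨A, r, hr, hr1, fun _ => h,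
    fun _ => (PerHolder.const _).mono h.nonneg hr le_rfl⟩

lemma IsPerHolder.of_right {g : ℝ → E} (hg : IsPerHolder g) : IsPerHolder₂ (fun _ s => g s) :=
  hg.of_left.swap

end PeriodicHolder

/-! ### Regularized convolution with a Cauchy-type kernel: Privalov bound and transpose -/

section SingularConvolution

/-- The measure `|u|^(r-1) du` is finite near the origin. -/
lemma intervalIntegrable_abs_rpow {p : ℝ} (hp : -1 < p) (a b : ℝ) :
    IntervalIntegrable (fun u : ℝ => |u| ^ p) volume a b := by
  have key : ∀ c : ℝ, IntervalIntegrable (fun u : ℝ => |u| ^ p) volume 0 c := by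
    have pos : ∀ c : ℝ, 0 ≤ c → IntervalIntegrable (fun u : ℝ => |u| ^ p) volume 0 c := by
      intro c hc
      refine (intervalIntegral.intervalIntegrable_rpow' (a := 0) (b := c) hp).congr_ae ?_
      refine (ae_restrict_mem measurableSet_uIoc).mono fun u hu => ?_
      rw [Set.uIoc_of_le hc] at hu
      simp only [abs_of_pos hu.1]
    intro c
    rcases le_total 0 c with hc | hc
    · exact pos c hc
    · have := (IntervalIntegrable.iff_comp_neg (f := fun u : ℝ => |u| ^ p) (a := 0) (b := c)
        (by simp)).2 (by simpa using pos (-c) (by linarith))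
      exact this
  exact (key a).symm.trans (key b)

variable {E : Type*} [NormedAddCommGroup E] [NormedSpace ℂ E]

/-- A measurable convolution kernel with at most the singularity `1 / |u|`. -/
structure IsCauchyType (κ : ℝ → ℂ) : Prop where
  meas : Measurable κ
  bound : ∀ u, |u| ≤ 1 / 2 → ‖κ u‖ ≤ |u|⁻¹

lemma IsCauchyType.comp_neg {κ : ℝ → ℂ} (hκ : IsCauchyType κ) : IsCauchyType fun u => κ (-u) :=
  ⟨hκ.meas.comp measurable_neg, fun u hu => by simpa using hκ.bound (-u) (by simpa using hu)⟩

/-- The regularized convolution `∫ κ(u) (f(t + u) - f(t)) du` over a period. -/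
noncomputable def singConv (κ : ℝ → ℂ) (f : ℝ → E) (t : ℝ) : E :=
  ∫ u in (-1 / 2 : ℝ)..(1 / 2), κ u • (f (t + u) - f t)

lemma mem_half {u : ℝ} (hu : u ∈ Set.uIoc (-1 / 2 : ℝ) (1 / 2)) : |u| ≤ 1 / 2 := by
  rw [Set.uIoc_of_le (by norm_num)] at hu
  rw [abs_le]
  constructor <;> linarith [hu.1, hu.2]

namespace IsCauchyType

variable {κ : ℝ → ℂ} {A r : ℝ}

lemma norm_smul_le (hκ : IsCauchyType κ) (hA : 0 ≤ A) {x : E} {u : ℝ} (hu : |u| ≤ 1 / 2)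
    (hx : ‖x‖ ≤ A * |u| ^ r) : ‖κ u • x‖ ≤ A * |u| ^ (r - 1) := by
  have h2 := hκ.bound u hu
  rw [norm_smul]
  rcases eq_or_ne u 0 with rfl | h0
  -- Since `|0|⁻¹ = 0`, the bound on the kernel forces `κ 0 = 0`.
  · have h3 : ‖κ 0‖ = 0 := le_antisymm (by simpa using h2) (norm_nonneg _)
    rw [h3, zero_mul]
    positivity
  · have hpos := abs_pos.2 h0
    calc ‖κ u‖ * ‖x‖ ≤ |u|⁻¹ * (A * |u| ^ r) := by gcongr
      _ = A * |u| ^ (r - 1) := by rw [Real.rpow_sub_one hpos.ne']; field_simp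

lemma norm_integral_le (hκ : IsCauchyType κ) (hA : 0 ≤ A) (hr : 0 < r) {φ : ℝ → E}
    (hφ : ∀ u, |u| ≤ 1 / 2 → ‖φ u‖ ≤ A * |u| ^ r) :
    ‖∫ u in (-1 / 2 : ℝ)..(1 / 2), κ u • φ u‖ ≤
      A * ∫ u in (-1 / 2 : ℝ)..(1 / 2), |u| ^ (r - 1) := by
  rw [← intervalIntegral.integral_const_mul]
  refine intervalIntegral.norm_integral_le_of_norm_le (by norm_num) ?_
    ((intervalIntegrable_abs_rpow (by linarith) _ _).const_mul A)
  refine ae_of_all _ fun u hu => ?_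
  have hu' : |u| ≤ 1 / 2 := mem_half (by rwa [Set.uIoc_of_le (by norm_num)])
  exact hκ.norm_smul_le hA hu' (hφ u hu')

lemma intervalIntegrable_smul (hκ : IsCauchyType κ) (hA : 0 ≤ A) (hr : 0 < r) {φ : ℝ → E}
    (hc : Continuous φ) (hφ : ∀ u, |u| ≤ 1 / 2 → ‖φ u‖ ≤ A * |u| ^ r) :
    IntervalIntegrable (fun u => κ u • φ u) volume (-1 / 2) (1 / 2) := by
  refine ((intervalIntegrable_abs_rpow (p := r - 1) (by linarith) _ _).const_mul A).mono_fun
    (hκ.meas.aestronglyMeasurable.smul hc.aestronglyMeasurable) ?_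
  refine (ae_restrict_mem measurableSet_uIoc).mono fun u hu => ?_
  refine (hκ.norm_smul_le hA (mem_half hu) (hφ u (mem_half hu))).trans (le_abs_self _)

lemma intervalIntegrable_diff (hκ : IsCauchyType κ) (hr : 0 < r) {f : ℝ → E}
    (hf : PerHolder A r f) (t : ℝ) :
    IntervalIntegrable (fun u => κ u • (f (t + u) - f t)) volume (-1 / 2) (1 / 2) := by
  have hc := hf.continuous hr
  exact hκ.intervalIntegrable_smul hf.nonneg hr (by fun_prop)
    fun u hu => hf.bound t u (hu.trans (by norm_num))

end IsCauchyType

section Privalov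

variable {κ : ℝ → ℂ} {A r : ℝ} {f g : ℝ → E}

lemma singConv_shift (t h : ℝ) : singConv κ f (t + h) = singConv κ (fun t => f (t + h)) t := by
  simp only [singConv, add_right_comm]

/-- A quantitative form of Privalov's theorem, with loss in the exponent. -/
lemma norm_singConv_sub_le (hκ : IsCauchyType κ) (hr : 0 < r) (hf : PerHolder A r f)
    (hg : PerHolder A r g) {b : ℝ} (hb : 0 ≤ b) (hfg : ∀ t, ‖f t - g t‖ ≤ A * b ^ r) (t : ℝ) :
    ‖singConv κ f t - singConv κ g t‖ ≤
      2 * A * (∫ u in (-1 / 2 : ℝ)..(1 / 2), |u| ^ (r / 2 - 1)) * b ^ (r / 2) := by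
  have hA := hf.nonneg
  have hsub : singConv κ f t - singConv κ g t =
      ∫ u in (-1 / 2 : ℝ)..(1 / 2), κ u • ((f (t + u) - f t) - (g (t + u) - g t)) := by
    rw [singConv, singConv, ← intervalIntegral.integral_sub
      (hκ.intervalIntegrable_diff hr hf t) (hκ.intervalIntegrable_diff hr hg t)]
    simp only [smul_sub]
  rw [hsub]
  refine (hκ.norm_integral_le (A := 2 * A * b ^ (r / 2)) (by positivity) (half_pos hr) ?_).trans_eq
    (by ring)
  intro u hu
  -- The second difference is at most `2A|u|^r` and at most `2A b^r`, hence at most the geometric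
  -- mean of the two. Half of the exponent absorbs the singularity `1/|u|`, the other half survives
  -- as `b^(r/2)`.
  have h1 : ‖(f (t + u) - f t) - (g (t + u) - g t)‖ ≤ 2 * A * |u| ^ r := by
    refine (norm_sub_le _ _).trans ?_
    have := hf.bound t u (hu.trans (by norm_num))
    have := hg.bound t u (hu.trans (by norm_num))
    linarith
  have h2 : ‖(f (t + u) - f t) - (g (t + u) - g t)‖ ≤ 2 * A * b ^ r := by
    rw [sub_sub_sub_comm]
    refine (norm_sub_le _ _).trans ?_
    have := hfg (t + u)
    have := hfg t
    linarith
  have e1 : |u| ^ r = |u| ^ (r / 2) * |u| ^ (r / 2) := by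
    rw [← Real.rpow_add_of_nonneg (abs_nonneg u) (by positivity) (by positivity), add_halves]
  have e2 : b ^ r = b ^ (r / 2) * b ^ (r / 2) := by
    rw [← Real.rpow_add_of_nonneg hb (by positivity) (by positivity), add_halves]
  rw [e1] at h1
  rw [e2] at h2
  have p1 := Real.rpow_nonneg (abs_nonneg u) (r / 2)
  have p2 := Real.rpow_nonneg hb (r / 2)
  rcases le_total (|u| ^ (r / 2)) (b ^ (r / 2)) with h | h
  · calc _ ≤ _ := h1
      _ = 2 * A * (|u| ^ (r / 2)) * |u| ^ (r / 2) := by ring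
      _ ≤ _ := by gcongr
  · calc _ ≤ _ := h2
      _ = 2 * A * (b ^ (r / 2)) * b ^ (r / 2) := by ring
      _ ≤ _ := by gcongr

lemma singConv_periodic (hf : Function.Periodic f 1) : Function.Periodic (singConv κ f) 1 := by
  intro t
  rw [singConv_shift]
  congr 1
  exact funext hf

lemma PerHolder.singConv (hf : PerHolder A r f) (hκ : IsCauchyType κ) (hr : 0 < r) :
    PerHolder (2 * A * (∫ u in (-1 / 2 : ℝ)..(1 / 2), |u| ^ (r / 2 - 1))) (r / 2)
      (singConv κ f) :=
  ⟨singConv_periodic hf.periodic, fun t h hh => by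
    rw [singConv_shift]
    exact norm_singConv_sub_le hκ hr (hf.shift h) hf (abs_nonneg h) (fun t => hf.bound t h hh) t⟩

lemma IsPerHolder.singConv (hf : IsPerHolder f) (hκ : IsCauchyType κ) :
    IsPerHolder (singConv κ f) := by
  obtain ⟨A, r, hr, hr1, h⟩ := hf
  exact ⟨_, r / 2, half_pos hr, by linarith, h.singConv hκ hr⟩

/-- `norm_singConv_sub_le` compares two arbitrary functions that are uniformly close. It therefore
covers both variables: a shift of `t`, and a change of the parameter `s`. -/
lemma IsPerHolder₂.singConv_left {k : ℝ → ℝ → E} (hk : IsPerHolder₂ k) (hκ : IsCauchyType κ) :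
    IsPerHolder₂ (fun t s => _root_.singConv κ (fun t => k t s) t) := by
  obtain ⟨A, r, hr, hr1, h⟩ := hk
  refine ⟨_, r / 2, half_pos hr, by linarith, fun s => (h.left s).singConv hκ hr,
    fun t => ⟨fun s => by simp only [(h.right _).periodic s], fun s h' hh => ?_⟩⟩
  exact norm_singConv_sub_le hκ hr (h.left _) (h.left _) (abs_nonneg h')
    (fun t => (h.right t).bound s h' hh) t

lemma IsPerHolder₂.singConv_right {k : ℝ → ℝ → E} (hk : IsPerHolder₂ k) (hκ : IsCauchyType κ) :
    IsPerHolder₂ (fun t s => _root_.singConv κ (k t) s) :=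
  (hk.swap.singConv_left hκ).swap

lemma IsPerHolder.intervalIntegrable_singConv (hf : IsPerHolder f) (hκ : IsCauchyType κ) (t : ℝ) :
    IntervalIntegrable (fun u => κ u • (f (t + u) - f t)) volume (-1 / 2) (1 / 2) := by
  obtain ⟨A, r, hr, -, h⟩ := hf
  exact hκ.intervalIntegrable_diff hr h t

lemma singConv_add (hκ : IsCauchyType κ) (hf : IsPerHolder f) (hg : IsPerHolder g) (t : ℝ) :
    singConv κ (fun t => f t + g t) t = singConv κ f t + singConv κ g t := by
  rw [singConv, singConv, singConv, ← intervalIntegral.integral_add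
    (hf.intervalIntegrable_singConv hκ t) (hg.intervalIntegrable_singConv hκ t)]
  simp only [← smul_add, add_sub_add_comm]

lemma singConv_clm {F : Type*} [NormedAddCommGroup F] [NormedSpace ℂ F] [CompleteSpace E]
    [CompleteSpace F] (L : E →L[ℂ] F) (hκ : IsCauchyType κ) (hf : IsPerHolder f) (t : ℝ) :
    singConv κ (fun t => L (f t)) t = L (singConv κ f t) := by
  rw [singConv, singConv, ← L.intervalIntegral_comp_comm (hf.intervalIntegrable_singConv hκ t)]
  simp

end Privalov

section Transpose

variable {R : Type*} [NormedRing R] [NormedAlgebra ℂ R]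

/-- The integral of the singular convolution against a Hölder function, as a double integral. -/
lemma integrable_prod_singular {κ : ℝ → ℂ} (hκ : IsCauchyType κ) {A r : ℝ} (hA : 0 ≤ A)
    (hr : 0 < r) {E : Type*} [NormedAddCommGroup E] [NormedSpace ℂ E] {φ : ℝ → ℝ → E}
    {b : ℝ → ℝ} (hb : IntegrableOn b (Set.Ioc 0 1))
    (hc : AEStronglyMeasurable (Function.uncurry φ)
      ((volume.restrict (Set.Ioc 0 1)).prod (volume.restrict (Set.Ioc (-1 / 2) (1 / 2)))))
    (hφ : ∀ t u, |u| ≤ 1 / 2 → ‖φ t u‖ ≤ A * b t * |u| ^ r) (hb0 : ∀ t, 0 ≤ b t) :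
    Integrable (Function.uncurry fun t u => κ u • φ t u)
      ((volume.restrict (Set.Ioc 0 1)).prod (volume.restrict (Set.Ioc (-1 / 2) (1 / 2)))) := by
  have h1 := (intervalIntegrable_iff_integrableOn_Ioc_of_le (by norm_num)).1
    (intervalIntegrable_abs_rpow (p := r - 1) (by linarith) (-1 / 2) (1 / 2))
  have h2 : Integrable (fun p : ℝ × ℝ => A * (b p.1 * |p.2| ^ (r - 1)))
    ((volume.restrict (Set.Ioc 0 1)).prod (volume.restrict (Set.Ioc (-1 / 2) (1 / 2)))) :=
    (Integrable.mul_prod hb h1).const_mul A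
  refine h2.mono' ?_ ?_
  · exact (hκ.meas.comp measurable_snd).aestronglyMeasurable.smul hc
  · rw [Measure.prod_restrict]
    refine (ae_restrict_mem (measurableSet_Ioc.prod measurableSet_Ioc)).mono ?_
    rintro ⟨t, u⟩ ⟨-, hu⟩
    have hu' : |u| ≤ 1 / 2 := mem_half (by rwa [Set.uIoc_of_le (by norm_num)])
    have := hκ.norm_smul_le (mul_nonneg hA (hb0 t)) hu' (hφ t u hu')
    simpa [mul_assoc] using this

lemma intervalIntegral_swap {E : Type*} [NormedAddCommGroup E] [NormedSpace ℝ E]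
    {φ : ℝ → ℝ → E} {a b c d : ℝ} (hab : a ≤ b) (hcd : c ≤ d)
    (h : Integrable (Function.uncurry φ)
      ((volume.restrict (Set.Ioc a b)).prod (volume.restrict (Set.Ioc c d)))) :
    ∫ t in a..b, ∫ u in c..d, φ t u = ∫ u in c..d, ∫ t in a..b, φ t u := by
  simp only [intervalIntegral.integral_of_le hab, intervalIntegral.integral_of_le hcd]
  exact integral_integral_swap h

variable [CompleteSpace R]

lemma intervalIntegral_const_mul' (a : R) {f : ℝ → R} {x y : ℝ}
    (hf : IntervalIntegrable f volume x y) :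
    ∫ t in x..y, a * f t = a * ∫ t in x..y, f t :=
  (ContinuousLinearMap.mul ℂ R a).intervalIntegral_comp_comm hf

lemma intervalIntegral_mul_const' (a : R) {f : ℝ → R} {x y : ℝ}
    (hf : IntervalIntegrable f volume x y) :
    ∫ t in x..y, f t * a = (∫ t in x..y, f t) * a :=
  ((ContinuousLinearMap.mul ℂ R).flip a).intervalIntegral_comp_comm hf

/-- The transpose of the singular convolution with `κ` is the one with the reflected kernel. -/
lemma integral_mul_singConv {κ : ℝ → ℂ} (hκ : IsCauchyType κ) {f g : ℝ → R} (hf : IsPerHolder f)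
    (hg : IsPerHolder g) :
    ∫ t in (0 : ℝ)..1, g t * singConv κ f t =
      ∫ t in (0 : ℝ)..1, singConv (fun u => κ (-u)) g t * f t := by
  obtain ⟨B, hB, hfB⟩ := hf.exists_bound
  obtain ⟨D, hD, hgD⟩ := hg.exists_bound
  have hfc := hf.continuous
  have hgc := hg.continuous
  have hrefl : ∀ t, singConv (fun u => κ (-u)) g t =
      ∫ u in (-1 / 2 : ℝ)..(1 / 2), κ u • (g (t - u) - g t) := by
    intro t
    have := intervalIntegral.integral_comp_neg (a := -1 / 2) (b := 1 / 2)
      (fun u => κ u • (g (t - u) - g t))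
    simp only [sub_neg_eq_add] at this
    rw [singConv, this]
    norm_num
  have hL : ∀ t, g t * singConv κ f t =
      ∫ u in (-1 / 2 : ℝ)..(1 / 2), κ u • (g t * (f (t + u) - f t)) := by
    intro t
    rw [singConv, ← intervalIntegral_const_mul' _ (hf.intervalIntegrable_singConv hκ t)]
    simp only [mul_smul_comm]
  have hint : ∀ t, IntervalIntegrable (fun u => κ u • (g (t - u) - g t)) volume (-1 / 2)
      (1 / 2) := by
    intro t
    obtain ⟨A, r, hr, -, h⟩ := hg
    refine hκ.intervalIntegrable_smul h.nonneg hr (by fun_prop) fun u hu => ?_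
    simpa [sub_eq_add_neg] using h.bound t (-u) (by rw [abs_neg]; linarith)
  have hRt : ∀ t, singConv (fun u => κ (-u)) g t * f t =
      ∫ u in (-1 / 2 : ℝ)..(1 / 2), κ u • ((g (t - u) - g t) * f t) := by
    intro t
    rw [hrefl, ← intervalIntegral_mul_const' _ (hint t)]
    simp only [smul_mul_assoc]
  simp only [hL, hRt]
  obtain ⟨A, r, hr, -, hf', hg'⟩ := hf.exists_common hg
  rw [intervalIntegral_swap (φ := fun t u => κ u • (g t * (f (t + u) - f t)))
    (by norm_num) (by norm_num), intervalIntegral_swap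
    (φ := fun t u => κ u • ((g (t - u) - g t) * f t)) (by norm_num) (by norm_num)]
  · refine intervalIntegral.integral_congr fun u _ => ?_
    simp only [intervalIntegral.integral_smul]
    congr 1
    have ii : ∀ {φ : ℝ → R}, Continuous φ → IntervalIntegrable φ volume 0 1 :=
      fun h => h.intervalIntegrable _ _
    simp only [mul_sub, sub_mul]
    rw [intervalIntegral.integral_sub (ii (by fun_prop)) (ii (by fun_prop)),
      intervalIntegral.integral_sub (ii (by fun_prop)) (ii (by fun_prop))]
    congr 1
    -- For fixed `u` the terms `g f` coincide on both sides; the others, `g(t) f(t + u)` and `g(t -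
    -- u) f(t)`, differ by a translation over a full period.
    have hper : Function.Periodic (fun t => g (t - u) * f t) 1 := by
      intro t
      simp only [hf'.periodic t]
      rw [show t + 1 - u = t - u + 1 by ring, hg'.periodic]
    have h1 := hper.intervalIntegral_add_eq u 0
    rw [zero_add] at h1
    rw [← h1]
    have h2 := intervalIntegral.integral_comp_add_right (a := 0) (b := 1)
      (fun t => g (t - u) * f t) u
    simp only [add_sub_cancel_right, zero_add] at h2
    rw [h2, add_comm 1 u]
  · refine integrable_prod_singular hκ hg'.nonneg hr (b := fun _ => B) (by simp) ?_ ?_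
      fun _ => hB
    · exact Continuous.aestronglyMeasurable (by fun_prop)
    · intro t u hu
      have := hg'.bound t (-u) (by rw [abs_neg]; linarith)
      rw [abs_neg, ← sub_eq_add_neg] at this
      calc _ ≤ ‖g (t - u) - g t‖ * ‖f t‖ := norm_mul_le _ _
        _ ≤ (A * |u| ^ r) * B := mul_le_mul this (hfB t) (norm_nonneg _)
          (mul_nonneg hg'.nonneg (by positivity))
        _ = _ := by ring
  · refine integrable_prod_singular hκ hf'.nonneg hr (b := fun _ => D) (by simp) ?_ ?_
      fun _ => hD
    · exact Continuous.aestronglyMeasurable (by fun_prop)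
    · intro t u hu
      have := hf'.bound t u (by linarith)
      calc _ ≤ ‖g t‖ * ‖f (t + u) - f t‖ := norm_mul_le _ _
        _ ≤ D * (A * |u| ^ r) := mul_le_mul (hgD t) this (norm_nonneg _) hD
        _ = _ := by ring

end Transpose

end SingularConvolution

/-! ### The unit circle and the multiplier of its Cauchy kernel -/

section CircleParametrization

/-- The standard parametrization of the unit circle, of period `1`. -/
noncomputable def circ (t : ℝ) : ℂ := Complex.exp (2 * Real.pi * Complex.I * t)

lemma circ_ne_zero (t : ℝ) : circ t ≠ 0 := Complex.exp_ne_zero _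

lemma circ_zero : circ 0 = 1 := by simp [circ]

lemma circ_add (s t : ℝ) : circ (s + t) = circ s * circ t := by
  simp only [circ, Complex.ofReal_add, mul_add, Complex.exp_add]

lemma circ_neg (t : ℝ) : circ (-t) = (circ t)⁻¹ := by
  simp only [circ, Complex.ofReal_neg, mul_neg, Complex.exp_neg]

lemma circ_one : circ 1 = 1 := by simp [circ, Complex.exp_two_pi_mul_I]

lemma circ_periodic : Function.Periodic circ 1 := fun t => by rw [circ_add, circ_one, mul_one]

lemma norm_circ (t : ℝ) : ‖circ t‖ = 1 := by
  rw [circ, show 2 * (Real.pi : ℂ) * Complex.I * t = ((2 * Real.pi * t : ℝ) : ℂ) * Complex.I by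
    push_cast; ring, Complex.norm_exp_ofReal_mul_I]

lemma hasDerivAt_circ (t : ℝ) : HasDerivAt circ (2 * Real.pi * Complex.I * circ t) t := by
  have h1 : HasDerivAt (fun t : ℝ => 2 * Real.pi * Complex.I * (t : ℂ))
      (2 * Real.pi * Complex.I * 1) t := (Complex.ofRealCLM.hasDerivAt).const_mul _
  have := h1.cexp
  rw [mul_one, mul_comm (Complex.exp _)] at this
  exact this

lemma deriv_circ (t : ℝ) : deriv circ t = 2 * Real.pi * Complex.I * circ t :=
  (hasDerivAt_circ t).deriv

lemma deriv_circ_ne_zero (t : ℝ) : deriv circ t ≠ 0 := by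
  rw [deriv_circ]
  exact mul_ne_zero Complex.two_pi_I_ne_zero (circ_ne_zero t)

lemma contDiff_circ {n : WithTop ℕ∞} : ContDiff ℝ n circ :=
  (contDiff_const.mul Complex.ofRealCLM.contDiff).cexp

lemma circ_eq_one_iff (t : ℝ) : circ t = 1 ↔ ∃ n : ℤ, t = n := by
  rw [circ, Complex.exp_eq_one_iff]
  refine exists_congr fun n => ?_
  rw [mul_comm]
  constructor
  · intro h
    exact_mod_cast mul_right_cancel₀ Complex.two_pi_I_ne_zero h
  · rintro rfl; simp

lemma circ_eq_iff (s t : ℝ) : circ s = circ t ↔ ∃ n : ℤ, s = t + n := by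
  have : circ s = circ t ↔ circ (s - t) = 1 := by
    rw [sub_eq_add_neg, circ_add, circ_neg, ← div_eq_mul_inv, div_eq_one_iff_eq (circ_ne_zero t)]
  rw [this, circ_eq_one_iff]
  exact exists_congr fun n => sub_eq_iff_eq_add'

/-- The chord has length `2|sin πu|`, and Jordan's inequality bounds the sine from below. This makes
`circKernel` a kernel of Cauchy type. -/
lemma four_mul_abs_le (u : ℝ) (hu : |u| ≤ 1 / 2) : 4 * |u| ≤ ‖circ u - 1‖ := by
  have h1 : circ u = Complex.exp (Complex.I * ((2 * Real.pi * u : ℝ) : ℂ)) := by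
    rw [circ]; congr 1; push_cast; ring
  rw [h1, Complex.norm_exp_I_mul_ofReal_sub_one, Real.norm_eq_abs, abs_mul, abs_two,
    show 2 * Real.pi * u / 2 = Real.pi * u by ring]
  have h2 : |Real.pi * u| ≤ Real.pi / 2 := by
    rw [abs_mul, abs_of_pos Real.pi_pos]
    nlinarith [Real.pi_pos]
  have h3 := Real.mul_abs_le_abs_sin h2
  rw [abs_mul, abs_of_pos Real.pi_pos] at h3
  have h4 : 2 / Real.pi * (Real.pi * |u|) = 2 * |u| := by
    field_simp
  linarith

/-- The Cauchy kernel of the unit circle, in the variable `u = s - t`. -/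
noncomputable def circKernel (u : ℝ) : ℂ := circ u / (circ u - 1)

lemma isCauchyType_circKernel : IsCauchyType circKernel := by
  have hm : Measurable circ := (contDiff_circ (n := 0)).continuous.measurable
  refine ⟨hm.div (hm.sub_const 1), fun u hu => ?_⟩
  rw [circKernel, norm_div, norm_circ]
  have := four_mul_abs_le u hu
  rcases eq_or_ne u 0 with rfl | h0
  · simp [circ_zero]
  · have hp := abs_pos.2 h0
    rw [one_div]
    exact inv_anti₀ hp (by linarith)

lemma integral_circ_zpow (n : ℤ) :
    ∫ u in (-1 / 2 : ℝ)..(1 / 2), circ u ^ n = if n = 0 then 1 else 0 := by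
  split_ifs with h
  · subst h
    simp; norm_num
  · have hc : (2 * Real.pi * Complex.I * n : ℂ) ≠ 0 :=
      mul_ne_zero Complex.two_pi_I_ne_zero (by exact_mod_cast h)
    have h1 : ∀ u : ℝ, circ u ^ n = Complex.exp (2 * Real.pi * Complex.I * n * u) := by
      intro u
      rw [circ, ← Complex.exp_int_mul]; congr 1; ring
    simp only [h1]
    rw [integral_exp_mul_complex hc, div_eq_zero_iff]
    left
    rw [sub_eq_zero, Complex.exp_eq_exp_iff_exists_int]
    exact ⟨n, by push_cast; ring⟩

lemma continuous_circ_zpow (n : ℤ) : Continuous fun t => circ t ^ n :=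
  (contDiff_circ (n := 0)).continuous.zpow₀ n fun t => Or.inl (circ_ne_zero t)

/-- The Fourier multiplier of the singular convolution with the Cauchy kernel of the circle. -/
lemma integral_circKernel (n : ℤ) :
    ∫ u in (-1 / 2 : ℝ)..(1 / 2), circKernel u * (circ u ^ n - 1) = if 0 ≤ n then 0 else -1 := by
  have h0 : ∀ᵐ u : ℝ, u ∈ Set.uIoc (-1 / 2 : ℝ) (1 / 2) → circ u ≠ 1 := by
    have : ∀ᵐ u : ℝ, u ≠ 0 := by simp [ae_iff]
    filter_upwards [this] with u hu hu' h
    have h1 := four_mul_abs_le u (mem_half hu')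
    rw [h, sub_self, norm_zero] at h1
    linarith [abs_pos.2 hu]
  have ii : ∀ j : ℤ, IntervalIntegrable (fun u => circ u ^ j) volume (-1 / 2) (1 / 2) :=
    fun j => (continuous_circ_zpow j).intervalIntegrable _ _
  -- The factor `circ u ^ m - 1` cancels the pole of the kernel and leaves a trigonometric
  -- polynomial with the modes `1, …, m`, all of mean zero.
  have geo : ∀ (u : ℝ) (m : ℕ), circ u ≠ 1 →
      circ u / (circ u - 1) * (circ u ^ m - 1) = ∑ k ∈ Finset.range m, circ u ^ (k + 1) := by
    intro u m hu
    have h1 : circ u - 1 ≠ 0 := sub_ne_zero.2 hu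
    simp only [pow_succ, ← Finset.sum_mul]
    rw [geom_sum_eq hu]
    field_simp
  split_ifs with hn
  · lift n to ℕ using hn
    have : ∫ u in (-1 / 2 : ℝ)..(1 / 2), circKernel u * (circ u ^ (n : ℤ) - 1) =
        ∫ u in (-1 / 2 : ℝ)..(1 / 2), ∑ k ∈ Finset.range n, circ u ^ ((k + 1 : ℕ) : ℤ) := by
      refine intervalIntegral.integral_congr_ae ?_
      filter_upwards [h0] with u hu hu'
      simp only [zpow_natCast]
      exact geo u n (hu hu')
    rw [this, intervalIntegral.integral_finsetSum fun k _ => ii _]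
    refine Finset.sum_eq_zero fun k _ => ?_
    rw [integral_circ_zpow, if_neg (by positivity)]
  -- For `n = -(m + 1)` the modes are shifted to `-m, …, 0`. Exactly one of them, `k = m`, is
  -- constant, and it produces the value `-1`.
  · obtain ⟨m, rfl⟩ : ∃ m : ℕ, n = -((m + 1 : ℕ) : ℤ) :=
      ⟨(-n - 1).toNat, by omega⟩
    have : ∫ u in (-1 / 2 : ℝ)..(1 / 2), circKernel u * (circ u ^ (-((m + 1 : ℕ) : ℤ)) - 1) =
        ∫ u in (-1 / 2 : ℝ)..(1 / 2), -∑ k ∈ Finset.range (m + 1), circ u ^ ((k : ℤ) - m) := by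
      refine intervalIntegral.integral_congr_ae ?_
      filter_upwards [h0] with u hu hu'
      have h1 := geo u (m + 1) (hu hu')
      have hne := circ_ne_zero u
      have h2 : circ u ^ (-((m + 1 : ℕ) : ℤ)) - 1 =
          -(circ u ^ (-((m + 1 : ℕ) : ℤ)) * (circ u ^ (m + 1) - 1)) := by
        rw [mul_sub, zpow_neg, zpow_natCast, inv_mul_cancel₀ (pow_ne_zero _ hne)]; ring
      rw [h2, circKernel, mul_neg, mul_left_comm, h1, Finset.mul_sum]
      congr 1
      refine Finset.sum_congr rfl fun k _ => ?_
      rw [← zpow_natCast, ← zpow_add₀ hne]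
      congr 1
      push_cast; ring
    rw [this, intervalIntegral.integral_neg,
      intervalIntegral.integral_finsetSum fun k _ => ii _, Finset.sum_range_succ,
      Finset.sum_eq_zero]
    · norm_num
    · intro k hk
      rw [integral_circ_zpow, if_neg]
      have := Finset.mem_range.1 hk
      omega

end CircleParametrization

section Periodic

variable {E : Type*} [NormedAddCommGroup E] [NormedSpace ℝ E]

lemma IsPerHolder.of_contDiff {f : ℝ → E} (hf : ContDiff ℝ 1 f) (hp : Function.Periodic f 1) :
    IsPerHolder f := by
  have hd : Continuous (deriv f) := hf.continuous_deriv le_rfl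
  have hdp : Function.Periodic (deriv f) 1 := fun t => by
    have : f = fun s => f (s + 1) := funext fun s => (hp s).symm
    conv_rhs => rw [this, deriv_comp_add_const]
  obtain ⟨A, hA⟩ := (hdp.isBounded_of_continuous one_ne_zero hd).exists_norm_le
  refine ⟨A, 1, one_pos, le_rfl, hp, fun t h _ => ?_⟩
  have := Convex.norm_image_sub_le_of_norm_deriv_le (f := f) (s := Set.univ) (C := A)
    (x := t) (y := t + h) (fun x _ => (hf.differentiable one_ne_zero) x)
    (fun x _ => hA _ ⟨x, rfl⟩) convex_univ trivial trivial
  simpa using this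

lemma isPerHolder_circ_zpow (n : ℤ) : IsPerHolder fun t => circ t ^ n := by
  refine IsPerHolder.of_contDiff ?_ fun t => by simp only [circ_periodic t]
  have h1 : ∀ t : ℝ, circ t ^ n = Complex.exp (2 * Real.pi * Complex.I * n * t) := by
    intro u
    rw [circ, ← Complex.exp_int_mul]; congr 1; ring
  simp only [h1]
  exact (contDiff_const.mul Complex.ofRealCLM.contDiff).cexp

end Periodic

/-! ### `L²` bound and the identity `A² = -A` on the circle -/

section Parseval

lemma hasSum_sq_circ {f : ℝ → ℂ} (hf : Continuous f) :
    HasSum (fun n : ℤ => ‖∫ t in (0 : ℝ)..1, circ t ^ (-n) * f t‖ ^ 2)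
      (∫ t in (0 : ℝ)..1, ‖f t‖ ^ 2) := by
  have hm : MemLp f 2 (volume.restrict (Set.Ioc 0 1)) := by
    obtain ⟨C, hC⟩ := (isCompact_Icc (a := (0 : ℝ)) (b := 1)).exists_bound_of_continuousOn
      hf.continuousOn
    refine MemLp.of_bound hf.aestronglyMeasurable C ?_
    exact (ae_restrict_mem measurableSet_Ioc).mono fun t ht => hC t (Set.Ioc_subset_Icc_self ht)
  have := hasSum_sq_fourierCoeffOn (a := 0) (b := 1) zero_lt_one hm
  simp only [sub_zero, inv_one, one_smul] at this
  convert this using 3 with n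
  rw [fourierCoeffOn_eq_integral]
  simp only [sub_zero, div_one, one_smul, smul_eq_mul]
  refine congrArg _ (intervalIntegral.integral_congr fun t _ => ?_)
  simp only [fourier_coe_apply]
  rw [circ, ← Complex.exp_int_mul]
  congr 2
  push_cast
  ring

/-- The transpose formula moves the operator onto the character `circ ^ (-n)`, which is an
eigenfunction of the reflected convolution. After `u ↦ -u` the eigenvalue is the integral in
`integral_circKernel`. -/
lemma integral_circ_mul_singConv {f : ℝ → ℂ} (hf : IsPerHolder f) (n : ℤ) :
    ∫ t in (0 : ℝ)..1, circ t ^ (-n) * singConv circKernel f t =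
      (if 0 ≤ n then 0 else -1) * ∫ t in (0 : ℝ)..1, circ t ^ (-n) * f t := by
  rw [integral_mul_singConv isCauchyType_circKernel hf (isPerHolder_circ_zpow (-n)),
    ← intervalIntegral.integral_const_mul]
  refine intervalIntegral.integral_congr fun t _ => ?_
  have : singConv (fun u => circKernel (-u)) (fun t => circ t ^ (-n)) t =
      circ t ^ (-n) * (if 0 ≤ n then 0 else -1) := by
    have h1 := intervalIntegral.integral_comp_neg (a := -1 / 2) (b := 1 / 2)
      (fun u => circKernel u * (circ u ^ n - 1))
    rw [singConv, ← integral_circKernel]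
    norm_num at h1 ⊢
    rw [← h1, ← intervalIntegral.integral_const_mul]
    refine intervalIntegral.integral_congr fun u _ => ?_
    simp only [circ_add, mul_zpow, circ_neg, inv_zpow]
    ring
  simp only [this]
  ring

/-- The singular convolution with the Cauchy kernel of the circle is a contraction of `L²`. -/
lemma integral_norm_sq_singConv_le {f : ℝ → ℂ} (hf : IsPerHolder f) :
    ∫ t in (0 : ℝ)..1, ‖singConv circKernel f t‖ ^ 2 ≤ ∫ t in (0 : ℝ)..1, ‖f t‖ ^ 2 := by
  refine hasSum_le (fun n => ?_)
    (hasSum_sq_circ (hf.singConv isCauchyType_circKernel).continuous)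
    (hasSum_sq_circ hf.continuous)
  rw [integral_circ_mul_singConv hf, norm_mul]
  gcongr
  split_ifs <;> simp

/-- The symbol takes only the values `0` and `-1`, so it satisfies `m² = -m`. The sum of the two
sides thus has vanishing Fourier coefficients. Parseval makes it zero in `L²`, and continuity makes
it zero everywhere. -/
lemma singConv_singConv {f : ℝ → ℂ} (hf : IsPerHolder f) (t : ℝ) :
    singConv circKernel (singConv circKernel f) t = -singConv circKernel f t := by
  have hS := hf.singConv isCauchyType_circKernel
  have hSS := hS.singConv isCauchyType_circKernel
  have hsum := hSS.add hS
  set h : ℝ → ℂ := fun t => singConv circKernel (singConv circKernel f) t + singConv circKernel f t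
    with hdef
  have hcoef : ∀ n : ℤ, ∫ t in (0 : ℝ)..1, circ t ^ (-n) * h t = 0 := by
    intro n
    have ii : ∀ {g : ℝ → ℂ}, Continuous g →
        IntervalIntegrable (fun t => circ t ^ (-n) * g t) volume 0 1 :=
      fun hg => ((continuous_circ_zpow _).mul hg).intervalIntegrable _ _
    simp only [hdef, mul_add]
    rw [intervalIntegral.integral_add (ii hSS.continuous) (ii hS.continuous),
      integral_circ_mul_singConv hS, integral_circ_mul_singConv hf]
    split_ifs <;> ring
  have hzero : ∫ t in (0 : ℝ)..1, ‖h t‖ ^ 2 = 0 := by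
    have := hasSum_sq_circ hsum.continuous
    simp only [hcoef, norm_zero, ne_eq, OfNat.ofNat_ne_zero, not_false_eq_true, zero_pow] at this
    exact this.unique hasSum_zero
  have hall : ∀ x ∈ Set.Icc (0 : ℝ) 1, h x = 0 := by
    intro x hx
    by_contra hne
    have := intervalIntegral.integral_pos (f := fun t => ‖h t‖ ^ 2) zero_lt_one
      ((hsum.continuous.norm.pow 2).continuousOn) (fun _ _ => by positivity)
      ⟨x, hx, by positivity⟩
    linarith
  have hfr := hall (Int.fract t) ⟨Int.fract_nonneg t, (Int.fract_lt_one t).le⟩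
  have : h (Int.fract t) = h t := by
    have := hsum.periodic.sub_int_mul_eq (x := t) ⌊t⌋
    rwa [mul_one] at this
  rw [this] at hfr
  exact eq_neg_of_add_eq_zero_left hfr

end Parseval

/-! ### Passage to matrix values, entry by entry -/

section MatrixValued

/-- The entries of a matrix, as continuous linear maps. -/
noncomputable def Mat2.entry (i j : Fin 2) : Mat2 →L[ℂ] ℂ :=
  ⟨Matrix.entryLinearMap ℂ ℂ i j, continuous_id.matrix_elem i j⟩

lemma Mat2.norm_sq (M : Mat2) : ‖M‖ ^ 2 = ∑ i, ∑ j, ‖M i j‖ ^ 2 := by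
  rw [Matrix.frobenius_norm_def, ← Real.rpow_natCast, ← Real.rpow_mul (by positivity)]
  norm_num

lemma IsPerHolder.entry {f : ℝ → Mat2} (hf : IsPerHolder f) (i j : Fin 2) :
    IsPerHolder fun t => f t i j := by
  obtain ⟨A, r, hr, hr1, h⟩ := hf
  refine ⟨A, r, hr, hr1, fun t => by rw [h.periodic], fun t u hu => le_trans ?_ (h.bound t u hu)⟩
  have h1 := Mat2.norm_sq (f (t + u) - f t)
  have h2 : ‖(f (t + u) - f t) i j‖ ^ 2 ≤ ‖f (t + u) - f t‖ ^ 2 := by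
    rw [h1]
    refine le_trans ?_ (Finset.single_le_sum (f := fun i => ∑ j, ‖(f (t + u) - f t) i j‖ ^ 2)
      (fun i _ => by positivity) (Finset.mem_univ i))
    exact Finset.single_le_sum (f := fun j => ‖(f (t + u) - f t) i j‖ ^ 2)
      (fun j _ => by positivity) (Finset.mem_univ j)
  exact (pow_le_pow_iff_left₀ (norm_nonneg _) (norm_nonneg _) two_ne_zero).1 h2

lemma singConv_entry {f : ℝ → Mat2} {κ : ℝ → ℂ} (hκ : IsCauchyType κ) (hf : IsPerHolder f)
    (i j : Fin 2) (t : ℝ) : singConv κ f t i j = singConv κ (fun t => f t i j) t :=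
  (singConv_clm (Mat2.entry i j) hκ hf t).symm

lemma Mat2.integral_norm_sq {f : ℝ → Mat2} (hf : Continuous f) :
    ∫ t in (0 : ℝ)..1, ‖f t‖ ^ 2 = ∑ i, ∑ j, ∫ t in (0 : ℝ)..1, ‖f t i j‖ ^ 2 := by
  simp only [Mat2.norm_sq]
  have hc : ∀ i j, Continuous fun t => ‖f t i j‖ ^ 2 := fun i j =>
    (hf.matrix_elem i j).norm.pow 2
  rw [intervalIntegral.integral_finsetSum fun i _ =>
    (continuous_finsetSum _ fun j _ => hc i j).intervalIntegrable _ _]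
  refine Finset.sum_congr rfl fun i _ => ?_
  rw [intervalIntegral.integral_finsetSum fun j _ => (hc i j).intervalIntegrable _ _]

/-- The square of the Frobenius norm is the sum over the entries, so the scalar contraction carries
over without a constant. -/
lemma Mat2.integral_norm_sq_singConv_le {f : ℝ → Mat2} (hf : IsPerHolder f) :
    ∫ t in (0 : ℝ)..1, ‖singConv circKernel f t‖ ^ 2 ≤ ∫ t in (0 : ℝ)..1, ‖f t‖ ^ 2 := by
  rw [Mat2.integral_norm_sq (hf.singConv isCauchyType_circKernel).continuous,
    Mat2.integral_norm_sq hf.continuous]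
  gcongr with i _ j _
  simp only [singConv_entry isCauchyType_circKernel hf]
  exact _root_.integral_norm_sq_singConv_le (hf.entry i j)

lemma Mat2.singConv_singConv {f : ℝ → Mat2} (hf : IsPerHolder f) (t : ℝ) :
    singConv circKernel (singConv circKernel f) t = -singConv circKernel f t := by
  ext i j
  rw [singConv_entry isCauchyType_circKernel (hf.singConv isCauchyType_circKernel)]
  simp only [singConv_entry isCauchyType_circKernel hf, Matrix.neg_apply]
  exact _root_.singConv_singConv (hf.entry i j) t

end MatrixValued

/-! ### Smooth dependence of integrals on parameters -/

section ParametricIntegral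

universe u

/-- Differentiation under the integral sign, iterated: the derivative is again a parametric
integral, with values in `H →L[ℝ] E`, so the induction runs over all target spaces. Taking `H` in
`Type` keeps these in one universe. -/
lemma contDiff_nat_parametric_integral {H : Type} [NormedAddCommGroup H] [NormedSpace ℝ H]
    [FiniteDimensional ℝ H] (n : ℕ) {E : Type u} [NormedAddCommGroup E] [NormedSpace ℝ E]
    {F : H → ℝ → E} (hF : ContDiff ℝ n (Function.uncurry F)) :
    ContDiff ℝ n fun x => ∫ t in (0 : ℝ)..1, F x t := by
  induction n generalizing E with
  | zero =>
    rw [Nat.cast_zero, contDiff_zero] at *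
    exact intervalIntegral.continuous_parametric_intervalIntegral_of_continuous' hF 0 1
  | succ n ih =>
    set F' : H → ℝ → H →L[ℝ] E := fun x t =>
      (fderiv ℝ (Function.uncurry F) (x, t)).comp (ContinuousLinearMap.inl ℝ H ℝ) with hF'
    have h1 : ContDiff ℝ n (fderiv ℝ (Function.uncurry F)) :=
      hF.fderiv_right (by norm_cast)
    have h2 : ContDiff ℝ n (Function.uncurry F') := by
      have : Function.uncurry F' = fun p =>
        (fderiv ℝ (Function.uncurry F) p).comp (ContinuousLinearMap.inl ℝ H ℝ) := by
        ext ⟨x, t⟩; rfl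
      rw [this]
      exact h1.clm_comp contDiff_const
    have hc : Continuous (Function.uncurry F') := h2.continuous
    have hc0 : Continuous (Function.uncurry F) := hF.continuous
    have hd : ∀ x t, HasFDerivAt (fun x => F x t) (F' x t) x := by
      intro x t
      have h3 : HasFDerivAt (Function.uncurry F) (fderiv ℝ (Function.uncurry F) (x, t)) (x, t) :=
        ((hF.differentiable (by simp)) _).hasFDerivAt
      exact HasFDerivAt.comp (g := Function.uncurry F) (f := fun e => (e, t)) x h3
        (hasFDerivAt_prodMk_left x t)
    have key := contDiff_succ_iff_hasFDerivAt (𝕜 := ℝ) (n := n)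
      (f := fun x => ∫ t in (0 : ℝ)..1, F x t)
    rw [Nat.cast_succ]
    rw [key]
    refine ⟨_, ih h2, fun x => ?_⟩
    -- Finite dimension of `H` makes the ball compact, and a constant then dominates the derivative.
    obtain ⟨C, hC⟩ := ((isCompact_closedBall x (1 : ℝ)).prod
      (isCompact_Icc (a := (0 : ℝ)) (b := 1))).exists_bound_of_continuousOn hc.continuousOn
    have hx : ∀ y, Continuous (F y) := fun y => hc0.comp (Continuous.prodMk_right y)
    refine intervalIntegral.hasFDerivAt_integral_of_dominated_of_fderiv_le (bound := fun _ => C)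
      (Metric.closedBall_mem_nhds x one_pos)
      (Eventually.of_forall fun y => (hx y).aestronglyMeasurable)
      ((hx x).intervalIntegrable _ _)
      (hc.comp (Continuous.prodMk_right x)).aestronglyMeasurable
      (ae_of_all _ fun t ht y hy => ?_) (by simp)
      (ae_of_all _ fun t ht y hy => hd y t)
    rw [Set.uIoc_of_le zero_le_one] at ht
    exact hC (y, t) ⟨hy, Set.Ioc_subset_Icc_self ht⟩

end ParametricIntegral

/-! ### Divided differences and the quotient by the chord of the circle -/

section DividedDifference

variable {E : Type*} [NormedAddCommGroup E] [NormedSpace ℂ E]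

/-- The divided difference `(g s - g t) / (s - t)`, extended smoothly to the diagonal. -/
noncomputable def dividedDiff (g : ℝ → E) (s t : ℝ) : E :=
  ∫ θ in (0 : ℝ)..1, deriv g (t + θ * (s - t))

lemma contDiff_dividedDiff {g : ℝ → E} (hg : ContDiff ℝ ∞ g) :
    ContDiff ℝ ∞ (Function.uncurry (dividedDiff g)) := by
  have hd : ContDiff ℝ ∞ (deriv g) := (contDiff_infty_iff_deriv.1 hg).2
  rw [contDiff_infty]
  intro n
  refine contDiff_nat_parametric_integral (H := ℝ × ℝ) n
    (F := fun p θ => deriv g (p.2 + θ * (p.1 - p.2))) ?_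
  exact (hd.of_le (by exact_mod_cast le_top)).comp (by fun_prop)

lemma smul_dividedDiff [CompleteSpace E] {g : ℝ → E} (hg : ContDiff ℝ ∞ g) (s t : ℝ) :
    ((s - t : ℝ) : ℂ) • dividedDiff g s t = g s - g t := by
  have hd : ContDiff ℝ ∞ (deriv g) := (contDiff_infty_iff_deriv.1 hg).2
  have h1 : ∀ θ : ℝ, HasDerivAt (fun θ : ℝ => g (t + θ * (s - t)))
      ((s - t) • deriv g (t + θ * (s - t))) θ := by
    intro θ
    have h2 : HasDerivAt (fun θ : ℝ => t + θ * (s - t)) (s - t) θ := by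
      simpa using ((hasDerivAt_id θ).mul_const (s - t)).const_add t
    exact ((hg.differentiable (by simp)) _).hasDerivAt.scomp θ h2
  have hc : Continuous fun θ : ℝ => (s - t) • deriv g (t + θ * (s - t)) := by
    have := hd.continuous
    fun_prop
  have h3 := intervalIntegral.integral_eq_sub_of_hasDerivAt (a := 0) (b := 1)
    (fun θ _ => h1 θ) (hc.intervalIntegrable _ _)
  rw [intervalIntegral.integral_smul] at h3
  rw [dividedDiff, Complex.coe_smul, h3]
  simp

lemma dividedDiff_self [CompleteSpace E] (g : ℝ → E) (t : ℝ) : dividedDiff g t t = deriv g t := by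
  simp [dividedDiff]

lemma deriv_periodic {g : ℝ → E} (hp : Function.Periodic g 1) : Function.Periodic (deriv g) 1 := by
  intro t
  have : g = fun s => g (s + 1) := funext fun s => (hp s).symm
  conv_rhs => rw [this, deriv_comp_add_const]

lemma dividedDiff_circ_ne_zero {s t : ℝ} (h : |s - t| < 1) : dividedDiff circ s t ≠ 0 := by
  rcases eq_or_ne s t with rfl | hst
  · rw [dividedDiff_self]; exact deriv_circ_ne_zero _
  · intro h0
    have h1 := smul_dividedDiff (contDiff_circ (n := ∞)) s t
    rw [h0, smul_zero, eq_comm, sub_eq_zero, circ_eq_iff] at h1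
    obtain ⟨n, hn⟩ := h1
    have h2 : s - t = n := by linarith
    rw [h2] at h
    have h3 : n = 0 := by
      have : |n| < 1 := by exact_mod_cast h
      exact Int.abs_lt_one_iff.1 this
    rw [h3] at h2
    exact hst (by simpa [sub_eq_zero] using h2)

open scoped Classical in
/-- The quotient `(g s - g t) / (circ s - circ t)`, extended smoothly to the diagonal. -/
noncomputable def circQuotient (g : ℝ → E) (s t : ℝ) : E :=
  if circ s = circ t then (deriv circ s)⁻¹ • deriv g s else (circ s - circ t)⁻¹ • (g s - g t)

lemma smul_circQuotient {g : ℝ → E} (hp : Function.Periodic g 1) (s t : ℝ) :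
    (circ s - circ t) • circQuotient g s t = g s - g t := by
  rw [circQuotient]
  split_ifs with h
  · obtain ⟨n, hn⟩ := (circ_eq_iff s t).1 h
    have h1 : g s = g t := by
      rw [hn]
      have := (hp.int_mul n) t
      rwa [mul_one] at this
    rw [h, h1, sub_self, sub_self, zero_smul]
  · rw [smul_inv_smul₀ (sub_ne_zero.2 h)]

lemma circQuotient_periodic_left {g : ℝ → E} (hp : Function.Periodic g 1) (s t : ℝ) :
    circQuotient g (s + 1) t = circQuotient g s t := by
  simp only [circQuotient, circ_periodic s, hp s, deriv_periodic hp s,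
    deriv_periodic circ_periodic s]

lemma circQuotient_periodic_right {g : ℝ → E} (hp : Function.Periodic g 1) (s t : ℝ) :
    circQuotient g s (t + 1) = circQuotient g s t := by
  simp only [circQuotient, circ_periodic t, hp t]

/-- Near the lines `s - t = n` the quotient is a ratio of two Hadamard divided differences, whose
denominator does not vanish for `|s - (t + n)| < 1`. This is the form in which smoothness across
these lines is visible. -/
lemma circQuotient_eq [CompleteSpace E] {g : ℝ → E} (hg : ContDiff ℝ ∞ g) (hp : Function.Periodic g 1) {s t : ℝ}
    (n : ℤ) (h : |s - (t + n)| < 1) :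
    circQuotient g s t = (dividedDiff circ s (t + n))⁻¹ • dividedDiff g s (t + n) := by
  have hN := dividedDiff_circ_ne_zero h
  have hgt : g (t + n) = g t := by
    have := (hp.int_mul n) t
    rwa [mul_one] at this
  have hct : circ (t + n) = circ t := by
    have := (circ_periodic.int_mul n) t
    rwa [mul_one] at this
  have e1 := smul_dividedDiff hg s (t + n)
  have e2 := smul_dividedDiff (contDiff_circ (n := ∞)) s (t + n)
  rw [circQuotient]
  split_ifs with hst
  · have hs : s = t + n := by
      have h2 : ((s - (t + n) : ℝ) : ℂ) • dividedDiff circ s (t + n) = 0 := by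
        rw [e2, hct, hst, sub_self]
      have h3 := (smul_eq_zero.1 h2).resolve_right hN
      have h4 : s - (t + n) = 0 := by exact_mod_cast h3
      linarith
    rw [← hs, dividedDiff_self, dividedDiff_self]
  · rw [hgt] at e1
    rw [hct] at e2
    have h5 : ((s - (t + n) : ℝ) : ℂ) ≠ 0 := by
      intro h0
      rw [h0, zero_smul, eq_comm, sub_eq_zero] at e2
      exact hst e2
    rw [← e1, ← e2, smul_smul]
    congr 1
    rw [smul_eq_mul]
    field_simp

lemma contDiff_circQuotient [CompleteSpace E] {g : ℝ → E} (hg : ContDiff ℝ ∞ g) (hp : Function.Periodic g 1) :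
    ContDiff ℝ ∞ (Function.uncurry (circQuotient g)) := by
  rw [contDiff_iff_contDiffAt]
  rintro ⟨s, t⟩
  by_cases hst : circ s = circ t
  · obtain ⟨n, hn⟩ := (circ_eq_iff s t).1 hst
    have hmap : ContDiff ℝ ∞ fun p : ℝ × ℝ => (p.1, p.2 + (n : ℝ)) := by fun_prop
    have h1 : ContDiffAt ℝ ∞ (fun p : ℝ × ℝ => dividedDiff circ p.1 (p.2 + n)) (s, t) :=
      ((contDiff_dividedDiff (contDiff_circ (n := ∞))).comp hmap).contDiffAt
    have h2 : ContDiffAt ℝ ∞ (fun p : ℝ × ℝ => dividedDiff g p.1 (p.2 + n)) (s, t) :=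
      ((contDiff_dividedDiff hg).comp hmap).contDiffAt
    have h3 : dividedDiff circ s (t + n) ≠ 0 := dividedDiff_circ_ne_zero (by simp [hn])
    refine ((h1.inv h3).smul h2).congr_of_eventuallyEq ?_
    have hopen : IsOpen {p : ℝ × ℝ | |p.1 - (p.2 + n)| < 1} :=
      isOpen_lt (by fun_prop) continuous_const
    filter_upwards [hopen.mem_nhds (show |s - (t + n)| < 1 by simp [hn])] with p hp'
    exact circQuotient_eq hg hp n hp'
  · have h1 : ContDiffAt ℝ ∞ (fun p : ℝ × ℝ => circ p.1 - circ p.2) (s, t) :=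
      ((contDiff_circ.comp contDiff_fst).sub (contDiff_circ.comp contDiff_snd)).contDiffAt
    have h2 : ContDiffAt ℝ ∞ (fun p : ℝ × ℝ => g p.1 - g p.2) (s, t) :=
      ((hg.comp contDiff_fst).sub (hg.comp contDiff_snd)).contDiffAt
    refine ((h1.inv (sub_ne_zero.2 hst)).smul h2).congr_of_eventuallyEq ?_
    have : ∀ᶠ p : ℝ × ℝ in 𝓝 (s, t), circ p.1 - circ p.2 ≠ 0 :=
      h1.continuousAt.eventually_ne (sub_ne_zero.2 hst)
    filter_upwards [this] with p hp'
    simp only [Function.uncurry_def, circQuotient, if_neg (sub_ne_zero.1 hp')]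
    rfl

end DividedDifference

/-! ### Smooth doubly periodic kernels are Hölder -/

section SmoothKernels

lemma doublyPeriodic_fract {X : Type*} {k : ℝ → ℝ → X} (h1 : ∀ t s, k (t + 1) s = k t s)
    (h2 : ∀ t s, k t (s + 1) = k t s) (t s : ℝ) : k (Int.fract t) (Int.fract s) = k t s := by
  have e1 : ∀ s, Function.Periodic (fun t => k t s) 1 := fun s t => h1 t s
  have e2 : ∀ t, Function.Periodic (k t) 1 := fun t s => h2 t s
  have a1 := (e1 (Int.fract s)).sub_int_mul_eq (x := t) ⌊t⌋
  have a2 := (e2 t).sub_int_mul_eq (x := s) ⌊s⌋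
  rw [mul_one] at a1 a2
  exact a1.trans a2

lemma exists_forall_norm_le_of_doublyPeriodic {E : Type*} [NormedAddCommGroup E] {k : ℝ → ℝ → E}
    (hc : Continuous (Function.uncurry k)) (h1 : ∀ t s, k (t + 1) s = k t s)
    (h2 : ∀ t s, k t (s + 1) = k t s) : ∃ C, ∀ t s, ‖k t s‖ ≤ C := by
  obtain ⟨C, hC⟩ := ((isCompact_Icc (a := (0 : ℝ)) (b := 1)).prod
    (isCompact_Icc (a := (0 : ℝ)) (b := 1))).exists_bound_of_continuousOn hc.continuousOn
  refine ⟨C, fun t s => ?_⟩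
  rw [← doublyPeriodic_fract h1 h2 t s]
  exact hC (_, _) ⟨⟨Int.fract_nonneg _, (Int.fract_lt_one _).le⟩,
    ⟨Int.fract_nonneg _, (Int.fract_lt_one _).le⟩⟩

variable {E : Type*} [NormedAddCommGroup E] [NormedSpace ℝ E]

lemma IsPerHolder₂.of_contDiff {k : ℝ → ℝ → E} (hk : ContDiff ℝ 1 (Function.uncurry k))
    (h1 : ∀ t s, k (t + 1) s = k t s) (h2 : ∀ t s, k t (s + 1) = k t s) : IsPerHolder₂ k := by
  have hdc : Continuous (Function.uncurry fun t s => fderiv ℝ (Function.uncurry k) (t, s)) :=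
    hk.continuous_fderiv one_ne_zero
  have hp : ∀ v : ℝ × ℝ, (∀ p, Function.uncurry k (p + v) = Function.uncurry k p) →
      ∀ p, fderiv ℝ (Function.uncurry k) (p + v) = fderiv ℝ (Function.uncurry k) p := by
    intro v hv p
    have : Function.uncurry k = fun p => Function.uncurry k (p + v) := funext fun p => (hv p).symm
    conv_rhs => rw [this, fderiv_comp_add_right]
  obtain ⟨C, hC⟩ := exists_forall_norm_le_of_doublyPeriodic hdc
    (fun t s => by simpa using hp (1, 0) (fun p => by simp [Function.uncurry_def, h1]) (t, s))
    (fun t s => by simpa using hp (0, 1) (fun p => by simp [Function.uncurry_def, h2]) (t, s))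
  have hlip : ∀ p q : ℝ × ℝ, ‖Function.uncurry k q - Function.uncurry k p‖ ≤ C * ‖q - p‖ :=
    fun p q => Convex.norm_image_sub_le_of_norm_fderiv_le (s := Set.univ)
      (fun x _ => (hk.differentiable one_ne_zero) x) (fun x _ => hC x.1 x.2) convex_univ
      trivial trivial
  refine ⟨C, 1, one_pos, le_rfl, fun s => ⟨fun t => h1 t s, fun t h _ => ?_⟩,
    fun t => ⟨fun s => h2 t s, fun s h _ => ?_⟩⟩
  · simpa [Prod.norm_def] using hlip (t, s) (t + h, s)
  · simpa [Prod.norm_def] using hlip (t, s) (t, s + h)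

end SmoothKernels

/-- A regular, `C^∞`, `1`-periodic parametrization of a simple closed curve. -/
structure IsClosedCurve (γ : ℝ → ℂ) : Prop where
  smooth : ContDiff ℝ ∞ γ
  periodic : Function.Periodic γ 1
  regular : ∀ t, deriv γ t ≠ 0
  simple : Set.InjOn γ (Set.Ico 0 1)

lemma isClosedCurve_circ : IsClosedCurve circ := by
  refine ⟨contDiff_circ, circ_periodic, deriv_circ_ne_zero, fun s hs t ht h => ?_⟩
  obtain ⟨n, hn⟩ := (circ_eq_iff s t).1 h
  have h1 : (n : ℝ) < 1 := by linarith [hs.2, ht.1]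
  have h2 : (-1 : ℝ) < n := by linarith [hs.1, ht.2]
  have h3 : n = 0 := by
    have : n < 1 := by exact_mod_cast h1
    have : -1 < n := by exact_mod_cast h2
    omega
  simpa [h3] using hn

/-! ### Comparison of a closed curve with the circle -/

namespace IsClosedCurve

variable {γ : ℝ → ℂ}

lemma fract_eq (hγ : IsClosedCurve γ) (t : ℝ) : γ (Int.fract t) = γ t := by
  have := hγ.periodic.sub_int_mul_eq (x := t) ⌊t⌋
  rwa [mul_one] at this

lemma eq_iff (hγ : IsClosedCurve γ) (s t : ℝ) : γ s = γ t ↔ circ s = circ t := by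
  constructor
  · intro h
    rw [← hγ.fract_eq s, ← hγ.fract_eq t] at h
    have := hγ.simple ⟨Int.fract_nonneg _, Int.fract_lt_one _⟩
      ⟨Int.fract_nonneg _, Int.fract_lt_one _⟩ h
    rw [← isClosedCurve_circ.fract_eq s, ← isClosedCurve_circ.fract_eq t, this]
  · intro h
    obtain ⟨n, rfl⟩ := (circ_eq_iff s t).1 h
    have := (hγ.periodic.int_mul n) t
    rwa [mul_one] at this

/-- Off the diagonal this is simplicity of the curve; on the diagonal it is regularity of the
parametrization. -/
lemma circQuotient_ne_zero (hγ : IsClosedCurve γ) (s t : ℝ) : circQuotient γ s t ≠ 0 := by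
  rw [circQuotient]
  split_ifs with h
  · exact smul_ne_zero (inv_ne_zero (deriv_circ_ne_zero s)) (hγ.regular s)
  · exact smul_ne_zero (inv_ne_zero (sub_ne_zero.2 h))
      (sub_ne_zero.2 fun h' => h ((hγ.eq_iff s t).1 h'))

/-- The Cauchy kernel of a smooth closed curve differs from that of the circle by a smooth
kernel. -/
lemma exists_cauchyKernel_eq (hγ : IsClosedCurve γ) : ∃ D : ℝ → ℝ → ℂ, IsPerHolder₂ D ∧
    ∀ t s, circ s ≠ circ t →
      deriv γ s / (γ s - γ t) = deriv circ s / (circ s - circ t) + D t s := by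
  set Q := circQuotient γ
  have hQ : ContDiff ℝ ∞ (Function.uncurry Q) := contDiff_circQuotient hγ.smooth hγ.periodic
  have hQ' : ContDiff ℝ ∞ fun p : ℝ × ℝ => fderiv ℝ (Function.uncurry Q) (p.2, p.1) (1, 0) := by
    have h1 : ContDiff ℝ ∞ (fderiv ℝ (Function.uncurry Q)) := (contDiff_infty_iff_fderiv.1 hQ).2
    exact (h1.comp (by fun_prop : ContDiff ℝ ∞ fun p : ℝ × ℝ => (p.2, p.1))).clm_apply
      contDiff_const
  have hQd : ∀ s t, HasDerivAt (fun s => Q s t) (fderiv ℝ (Function.uncurry Q) (s, t) (1, 0)) s := by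
    intro s t
    have h1 : HasFDerivAt (Function.uncurry Q) (fderiv ℝ (Function.uncurry Q) (s, t)) (s, t) :=
      ((hQ.differentiable (by simp)) _).hasFDerivAt
    have h2 : HasDerivAt (fun s : ℝ => (s, t)) ((1, 0) : ℝ × ℝ) s :=
      (hasDerivAt_id s).prodMk (hasDerivAt_const s t)
    exact h1.comp_hasDerivAt s h2
  have p1 := circQuotient_periodic_left hγ.periodic
  have p2 := circQuotient_periodic_right hγ.periodic
  have hder : ∀ s t, fderiv ℝ (Function.uncurry Q) (s, t) (1, 0) = deriv (fun s => Q s t) s :=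
    fun s t => (hQd s t).deriv.symm
  -- The logarithmic derivative in `s` of `γ s - γ t = (circ s - circ t) Q(s,t)` splits the kernel,
  -- so the error is that of `Q`.
  refine ⟨fun t s => deriv (fun s => Q s t) s / Q s t, ?_, ?_⟩
  · refine IsPerHolder₂.of_contDiff ?_ ?_ ?_
    · simp only [← hder, div_eq_mul_inv]
      have h1 : ContDiff ℝ ∞ fun p : ℝ × ℝ => Q p.2 p.1 :=
        hQ.comp (by fun_prop : ContDiff ℝ ∞ fun p : ℝ × ℝ => (p.2, p.1))
      refine (hQ'.mul (h1.inv fun p => hγ.circQuotient_ne_zero _ _)).of_le ?_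
      exact_mod_cast le_top
    · intro t s
      simp only [Q, p2]
    · intro t s
      have : Function.Periodic (fun s => Q s t) 1 := fun s => p1 s t
      simp only [Q, p1, deriv_periodic this s]
  · intro t s hst
    have hne : γ s - γ t ≠ 0 := sub_ne_zero.2 fun h => hst ((hγ.eq_iff s t).1 h)
    have hne' : circ s - circ t ≠ 0 := sub_ne_zero.2 hst
    have hQne := hγ.circQuotient_ne_zero s t
    have e1 : ∀ s, γ s - γ t = (circ s - circ t) * Q s t := fun s =>
      (smul_circQuotient hγ.periodic s t).symm
    have e2 : deriv γ s = deriv circ s * Q s t + (circ s - circ t) * deriv (fun s => Q s t) s := by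
      have h1 : HasDerivAt (fun s => (circ s - circ t) * Q s t)
          (deriv circ s * Q s t + (circ s - circ t) * deriv (fun s => Q s t) s) s := by
        have h2 : HasDerivAt (fun s => circ s - circ t) (deriv circ s) s :=
          ((contDiff_circ (n := ∞)).differentiable (by simp) s).hasDerivAt.sub_const _
        exact h2.mul ((hQd s t).differentiableAt.hasDerivAt)
      have h3 : HasDerivAt (fun s => γ s - γ t) (deriv γ s) s :=
        (hγ.smooth.differentiable (by simp) s).hasDerivAt.sub_const _
      rw [funext e1] at h3
      exact h3.unique h1
    rw [e1, e2]
    have hQne : Q s t ≠ 0 := hQne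
    field_simp

/-- The chord of `γ` is the chord of the circle times `Q`, and `1/Q` is bounded since it is
continuous and doubly periodic. -/
lemma exists_pos_mul_abs_le (hγ : IsClosedCurve γ) :
    ∃ c, 0 < c ∧ ∀ s t, |s - t| ≤ 1 / 2 → c * |s - t| ≤ ‖γ s - γ t‖ := by
  have hQ : Continuous (Function.uncurry (circQuotient γ)) :=
    (contDiff_circQuotient hγ.smooth hγ.periodic).continuous
  have hc : Continuous (Function.uncurry fun s t => (circQuotient γ s t)⁻¹) :=
    hQ.inv₀ fun p => hγ.circQuotient_ne_zero _ _
  obtain ⟨C, hC⟩ := exists_forall_norm_le_of_doublyPeriodic hc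
    (fun s t => by simp only [circQuotient_periodic_left hγ.periodic])
    (fun s t => by simp only [circQuotient_periodic_right hγ.periodic])
  have hC0 : 0 < C := lt_of_lt_of_le (norm_pos_iff.2 (inv_ne_zero (hγ.circQuotient_ne_zero 0 0)))
    (hC 0 0)
  refine ⟨C⁻¹, inv_pos.2 hC0, fun s t h => ?_⟩
  rw [← smul_circQuotient hγ.periodic, norm_smul]
  have h1 : |s - t| ≤ ‖circ s - circ t‖ := by
    have h2 : circ s - circ t = circ t * (circ (s - t) - 1) := by
      rw [mul_sub, ← circ_add]; simp
    rw [h2, norm_mul, norm_circ, one_mul]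
    linarith [four_mul_abs_le (s - t) h, abs_nonneg (s - t)]
  have h3 : C⁻¹ ≤ ‖circQuotient γ s t‖ := by
    have := hC s t
    rw [norm_inv] at this
    exact inv_le_of_inv_le₀ (norm_pos_iff.2 (hγ.circQuotient_ne_zero s t)) this
  rw [mul_comm]
  exact mul_le_mul h1 h3 (inv_pos.2 hC0).le (norm_nonneg _)

end IsClosedCurve

/-! ### Nontangential limits on a single curve -/

section Plemelj

/-- The open sector of aperture governed by `c`, symmetric about the negative imaginary axis. -/
def lowerSector (c : ℝ) : Set ℂ := {δ | δ.im < -(c * ‖δ‖)}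

/-- In the sector the imaginary part alone gives `c‖δ‖ ≤ ‖u - δ‖`. With `|u| ≤ ‖u - δ‖ + ‖δ‖` this
yields `c(|u| + ‖δ‖) ≤ (c + 2)‖u - δ‖`. -/
lemma mul_le_norm_sub_of_mem_lowerSector {c : ℝ} (hc : 0 < c) {δ : ℂ} (hδ : δ ∈ lowerSector c)
    (u : ℝ) : c / (c + 2) * (|u| + ‖δ‖) ≤ ‖(u : ℂ) - δ‖ := by
  have h1 : c * ‖δ‖ ≤ ‖(u : ℂ) - δ‖ := by
    have h2 := Complex.abs_im_le_norm ((u : ℂ) - δ)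
    have h3 : ((u : ℂ) - δ).im = -δ.im := by simp
    rw [h3, abs_neg] at h2
    have h4 : δ.im < -(c * ‖δ‖) := hδ
    linarith [neg_abs_le δ.im]
  have h2 : |u| ≤ ‖(u : ℂ) - δ‖ + ‖δ‖ := by
    have := norm_add_le ((u : ℂ) - δ) δ
    rwa [sub_add_cancel, Complex.norm_real, Real.norm_eq_abs] at this
  rw [div_mul_eq_mul_div, div_le_iff₀ (by positivity)]
  nlinarith

lemma im_neg_of_mem_lowerSector {c : ℝ} (hc : 0 < c) {δ : ℂ} (hδ : δ ∈ lowerSector c) :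
    δ.im < 0 := by
  have h4 : δ.im < -(c * ‖δ‖) := hδ
  have : 0 ≤ c * ‖δ‖ := by positivity
  linarith

lemma ne_zero_of_mem_lowerSector {c : ℝ} (hc : 0 < c) {δ : ℂ} (hδ : δ ∈ lowerSector c) :
    δ ≠ 0 := by
  rintro rfl
  simpa using im_neg_of_mem_lowerSector hc hδ

namespace IsClosedCurve

variable {γ : ℝ → ℂ}

/-- The second derivative is continuous and periodic, hence bounded, so one constant serves at all
base points. -/
lemma exists_taylor (hγ : IsClosedCurve γ) : ∃ L, 0 ≤ L ∧
    (∀ t u, ‖deriv γ (t + u) - deriv γ t‖ ≤ L * |u|) ∧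
    ∀ t u, ‖γ (t + u) - γ t - u * deriv γ t‖ ≤ L * u ^ 2 := by
  have hd : ContDiff ℝ ∞ (deriv γ) := (contDiff_infty_iff_deriv.1 hγ.smooth).2
  have hdd : Continuous (deriv (deriv γ)) := (contDiff_infty_iff_deriv.1 hd).2.continuous
  have hp := deriv_periodic (deriv_periodic hγ.periodic)
  obtain ⟨L, hL⟩ := (hp.isBounded_of_continuous one_ne_zero hdd).exists_norm_le
  have h1 : ∀ t u, ‖deriv γ (t + u) - deriv γ t‖ ≤ L * |u| := by
    intro t u
    have := Convex.norm_image_sub_le_of_norm_deriv_le (f := deriv γ) (s := Set.univ) (C := L)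
      (x := t) (y := t + u) (fun x _ => (hd.differentiable (by simp)) x)
      (fun x _ => hL _ ⟨x, rfl⟩) convex_univ trivial trivial
    simpa using this
  refine ⟨L, (norm_nonneg _).trans (hL _ ⟨0, rfl⟩), h1, fun t u => ?_⟩
  have hder : ∀ x : ℝ, HasDerivAt (fun x : ℝ => γ (t + x) - x * deriv γ t)
      (deriv γ (t + x) - deriv γ t) x := by
    intro x
    have e1 : HasDerivAt (fun x : ℝ => γ (t + x)) (deriv γ (t + x)) x :=
      ((hγ.smooth.differentiable (by simp)) (t + x)).hasDerivAt.comp_const_add t x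
    have e2 : HasDerivAt (fun x : ℝ => (x : ℂ) * deriv γ t) (1 * deriv γ t) x :=
      (Complex.ofRealCLM.hasDerivAt (x := x)).mul_const (deriv γ t)
    rw [one_mul] at e2
    exact e1.sub e2
  have h2 := (convex_uIcc (0 : ℝ) u).norm_image_sub_le_of_norm_hasDerivWithin_le
    (fun x _ => (hder x).hasDerivWithinAt) (C := L * |u|) (fun x hx => by
      refine (h1 t x).trans ?_
      have hL0 : 0 ≤ L := (norm_nonneg _).trans (hL _ ⟨0, rfl⟩)
      have : |x| ≤ |u| := by
        have := Set.abs_sub_left_of_mem_uIcc hx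
        simpa using this
      gcongr) Set.left_mem_uIcc Set.right_mem_uIcc
  rw [sub_zero, Real.norm_eq_abs, mul_assoc, abs_mul_abs_self] at h2
  calc _ = ‖γ (t + u) - u * deriv γ t - (γ (t + 0) - ((0 : ℝ) : ℂ) * deriv γ t)‖ := by
        congr 1; simp; ring
    _ ≤ _ := h2.trans_eq (by ring)

/-- Nontangential points are comparably far from all points of the curve. -/
lemma eventually_mul_le_norm_sub (hγ : IsClosedCurve γ) (t : ℝ) {c : ℝ} (hc : 0 < c) :
    ∃ c₀, 0 < c₀ ∧ ∀ᶠ δ in 𝓝[lowerSector c] (0 : ℂ), ∀ u : ℝ, |u| ≤ 1 / 2 →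
      c₀ * (|u| + ‖δ‖) ≤ ‖γ (t + u) - (γ t + deriv γ t * δ)‖ := by
  obtain ⟨L, hL0, -, hL⟩ := hγ.exists_taylor
  obtain ⟨c₂, hc₂, hbi⟩ := hγ.exists_pos_mul_abs_le
  set k := c / (c + 2)
  have hk : 0 < k := by positivity
  have hg : 0 < ‖deriv γ t‖ := norm_pos_iff.2 (hγ.regular t)
  set a := ‖deriv γ t‖ * k
  have ha : 0 < a := by positivity
  -- For `|u| ≤ ε` the Taylor error `L u²` costs at most half of the bound `a(|u| + ‖δ‖)` for the
  -- tangent line. For `|u| > ε` the chord is at least `c₂|u|`, and `‖δ‖ < ρ` is too small to use up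
  -- the spare `c₂ε/2`. The `+ 1` covers `L = 0`.
  set ε := a / (2 * (L + 1))
  have hε : 0 < ε := by positivity
  set c₀ := min (a / 2) (c₂ / 2)
  have hc₀ : 0 < c₀ := by positivity
  refine ⟨c₀, hc₀, ?_⟩
  set ρ := (c₂ / 2 * ε) / (‖deriv γ t‖ + c₀)
  have hρ : 0 < ρ := by positivity
  filter_upwards [self_mem_nhdsWithin,
    mem_nhdsWithin_of_mem_nhds (Metric.ball_mem_nhds (0 : ℂ) hρ)] with δ hδ hδρ u hu
  rw [mem_ball_zero_iff] at hδρ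
  have hu0 := abs_nonneg u
  have hδ0 := norm_nonneg δ
  rcases le_or_gt |u| ε with h | h
  · have h1 : ‖deriv γ t * ((u : ℂ) - δ)‖ ≥ a * (|u| + ‖δ‖) := by
      rw [norm_mul]
      have := mul_le_norm_sub_of_mem_lowerSector hc hδ u
      calc a * (|u| + ‖δ‖) = ‖deriv γ t‖ * (k * (|u| + ‖δ‖)) := by ring
        _ ≤ _ := by gcongr
    have h2 := hL t u
    have h3 : ‖deriv γ t * ((u : ℂ) - δ)‖ ≤ ‖γ (t + u) - (γ t + deriv γ t * δ)‖ +
        ‖γ (t + u) - γ t - u * deriv γ t‖ := by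
      have : deriv γ t * ((u : ℂ) - δ) = (γ (t + u) - (γ t + deriv γ t * δ)) -
        (γ (t + u) - γ t - u * deriv γ t) := by ring
      rw [this]
      exact norm_sub_le _ _
    have h4 : L * u ^ 2 ≤ a / 2 * |u| := by
      have h5 : (L + 1) * |u| ≤ a / 2 := by
        have : (L + 1) * ε = a / 2 := by simp only [ε]; field_simp
        rw [← this]; gcongr
      rw [← sq_abs]
      nlinarith
    have h6 : c₀ * (|u| + ‖δ‖) ≤ a / 2 * (|u| + ‖δ‖) := by
      gcongr; exact min_le_left _ _
    nlinarith
  · have h1 := hbi (t + u) t (by simpa using hu)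
    rw [add_sub_cancel_left] at h1
    have h2 : ‖γ (t + u) - γ t‖ ≤ ‖γ (t + u) - (γ t + deriv γ t * δ)‖ + ‖deriv γ t‖ * ‖δ‖ := by
      rw [← norm_mul]
      have : γ (t + u) - γ t = (γ (t + u) - (γ t + deriv γ t * δ)) + deriv γ t * δ := by ring
      rw [this]
      refine (norm_add_le _ _).trans ?_
      simp
    have h3 : (‖deriv γ t‖ + c₀) * ‖δ‖ ≤ c₂ / 2 * ε := by
      rw [lt_div_iff₀ (by positivity)] at hδρ
      linarith
    have h4 : c₀ * |u| ≤ c₂ / 2 * |u| := by gcongr; exact min_le_right _ _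
    nlinarith

/-- All curves share the singularity `1/(u - δ)`. In the difference the numerator is `O((|u| +
‖δ‖)²)` by Taylor, while both denominators are at least of order `|u| + ‖δ‖`. Differences of Cauchy
kernels of two curves are therefore dominated by a constant. -/
lemma eventually_norm_cauchyKernel_sub_le (hγ : IsClosedCurve γ) (t : ℝ) {c : ℝ} (hc : 0 < c) :
    ∃ B, ∀ᶠ δ in 𝓝[lowerSector c] (0 : ℂ), ∀ u : ℝ, |u| ≤ 1 / 2 →
      ‖deriv γ (t + u) / (γ (t + u) - (γ t + deriv γ t * δ)) - 1 / (u - δ)‖ ≤ B := by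
  obtain ⟨L, hL0, hL1, hL⟩ := hγ.exists_taylor
  obtain ⟨c₀, hc₀, hev⟩ := hγ.eventually_mul_le_norm_sub t hc
  set k := c / (c + 2)
  have hk : 0 < k := by positivity
  refine ⟨2 * L / (c₀ * k), ?_⟩
  filter_upwards [self_mem_nhdsWithin, hev] with δ hδ hδ' u hu
  have hδ0 : 0 < ‖δ‖ := norm_pos_iff.2 (ne_zero_of_mem_lowerSector hc hδ)
  have hu0 := abs_nonneg u
  have h1 := mul_le_norm_sub_of_mem_lowerSector hc hδ u
  have h2 := hδ' u hu
  set w := γ (t + u) - (γ t + deriv γ t * δ)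
  have hp1 : 0 < ‖(u : ℂ) - δ‖ := lt_of_lt_of_le (by positivity) h1
  have hp2 : 0 < ‖w‖ := lt_of_lt_of_le (by positivity) h2
  rw [div_sub_div _ _ (norm_pos_iff.1 hp2) (norm_pos_iff.1 hp1), norm_div, norm_mul]
  have hN : ‖deriv γ (t + u) * (u - δ) - w * 1‖ ≤ 2 * L * (|u| + ‖δ‖) ^ 2 := by
    have e : deriv γ (t + u) * (u - δ) - w * 1 = (deriv γ (t + u) - deriv γ t) * (u - δ) -
        (γ (t + u) - γ t - u * deriv γ t) := by simp only [w]; ring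
    rw [e]
    refine (norm_sub_le _ _).trans ?_
    rw [norm_mul]
    have e1 := hL1 t u
    have e2 := hL t u
    have e3 : ‖(u : ℂ) - δ‖ ≤ |u| + ‖δ‖ := by
      refine (norm_sub_le _ _).trans ?_
      simp
    have e4 : ‖deriv γ (t + u) - deriv γ t‖ * ‖(u : ℂ) - δ‖ ≤ L * |u| * (|u| + ‖δ‖) := by
      gcongr
    rw [← sq_abs] at e2
    have e5 : 0 ≤ L * (|u| * ‖δ‖) := by positivity
    have e6 : 0 ≤ L * ‖δ‖ ^ 2 := by positivity
    nlinarith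
  rw [div_le_div_iff₀ (by positivity) (by positivity)]
  have hprod : c₀ * k * (|u| + ‖δ‖) ^ 2 ≤ ‖w‖ * ‖(u : ℂ) - δ‖ := by
    calc c₀ * k * (|u| + ‖δ‖) ^ 2 = (c₀ * (|u| + ‖δ‖)) * (k * (|u| + ‖δ‖)) := by ring
      _ ≤ _ := by gcongr
  calc _ ≤ 2 * L * (|u| + ‖δ‖) ^ 2 * (c₀ * k) := by gcongr
    _ = 2 * L * (c₀ * k * (|u| + ‖δ‖) ^ 2) := by ring
    _ ≤ _ := by gcongr

end IsClosedCurve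

/-- The winding number of the unit circle about an exterior point vanishes. -/
lemma integral_circ_exterior {w : ℂ} (hw : 1 < ‖w‖) (t : ℝ) :
    ∫ u in (-1 / 2 : ℝ)..(1 / 2), deriv circ (t + u) / (circ (t + u) - w) = 0 := by
  have hw0 : w ≠ 0 := norm_pos_iff.1 (zero_lt_one.trans hw)
  -- Since `|circ s / w| < 1`, the principal branch of `log (1 - circ / w)` is a periodic primitive
  -- of the integrand.
  have hslit : ∀ s, 1 - circ s / w ∈ Complex.slitPlane := by
    intro s
    left
    have h1 : ‖circ s / w‖ < 1 := by
      rw [norm_div, norm_circ, div_lt_one (by linarith)]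
      exact hw
    have := (Complex.abs_re_le_norm (circ s / w)).trans_lt h1
    simp only [Complex.sub_re, Complex.one_re]
    linarith [le_abs_self (circ s / w).re]
  have hne : ∀ s, circ s - w ≠ 0 := by
    intro s h
    have := Complex.slitPlane_ne_zero (hslit s)
    rw [sub_eq_zero.1 h, div_self hw0, sub_self] at this
    exact this rfl
  have hd : ∀ u : ℝ, HasDerivAt (fun u : ℝ => Complex.log (1 - circ (t + u) / w))
      (deriv circ (t + u) / (circ (t + u) - w)) u := by
    intro u
    have e1 : HasDerivAt (fun u : ℝ => circ (t + u)) (deriv circ (t + u)) u :=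
      ((contDiff_circ (n := ∞)).differentiable (by simp) _).hasDerivAt.comp_const_add t u
    have e2 := ((e1.div_const w).const_sub 1).clog_real (hslit (t + u))
    convert e2 using 1
    have := hne (t + u)
    have h3 := Complex.slitPlane_ne_zero (hslit (t + u))
    rw [div_eq_div_iff this h3]
    field_simp
    ring
  have hc : Continuous fun u : ℝ => deriv circ (t + u) / (circ (t + u) - w) := by
    have h1 : Continuous circ := (contDiff_circ (n := 0)).continuous
    have h2 : Continuous (deriv circ) := by
      rw [funext deriv_circ]; fun_prop
    exact (by fun_prop : Continuous fun u => deriv circ (t + u)).div₀ (by fun_prop) fun u => hne _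
  rw [intervalIntegral.integral_eq_sub_of_hasDerivAt (fun u _ => hd u) (hc.intervalIntegrable _ _)]
  have : circ (t + 1 / 2) = circ (t + -1 / 2) := by
    have := circ_periodic (t + -1 / 2)
    rw [← this]; congr 1; ring
  rw [this, sub_self]

/-- The point equals `circ t (1 + 2πiδ)`, and `Im δ < 0` makes the real part of the second factor
larger than 1. The right side of the circle is thus its exterior. -/
lemma one_lt_norm_circ_add {t c : ℝ} (hc : 0 < c) {δ : ℂ} (hδ : δ ∈ lowerSector c) :
    1 < ‖circ t + deriv circ t * δ‖ := by
  have him := im_neg_of_mem_lowerSector hc hδ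
  have : circ t + deriv circ t * δ = circ t * (1 + 2 * Real.pi * Complex.I * δ) := by
    rw [deriv_circ]; ring
  rw [this, norm_mul, norm_circ, one_mul]
  have hre : 1 < (1 + 2 * Real.pi * Complex.I * δ).re := by
    have : (2 * Real.pi * Complex.I * δ).re = -(2 * Real.pi * δ.im) := by simp
    rw [Complex.add_re, this, Complex.one_re]
    nlinarith [Real.pi_pos]
  exact hre.trans_le (Complex.re_le_norm _)

lemma integral_shift_period {E : Type*} [NormedAddCommGroup E] [NormedSpace ℝ E] {φ : ℝ → E}
    (hφ : Function.Periodic φ 1) (t : ℝ) :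
    ∫ u in (-1 / 2 : ℝ)..(1 / 2), φ (t + u) = ∫ s in (0 : ℝ)..1, φ s := by
  rw [intervalIntegral.integral_comp_add_left]
  have := hφ.intervalIntegral_add_eq (t + -1 / 2) 0
  rw [zero_add] at this
  rw [← this]
  congr 1
  ring

namespace IsClosedCurve

variable {γ : ℝ → ℂ} {D : ℝ → ℝ → ℂ}

lemma continuous_deriv (hγ : IsClosedCurve γ) : Continuous (deriv γ) :=
  (contDiff_infty_iff_deriv.1 hγ.smooth).2.continuous

lemma continuous (hγ : IsClosedCurve γ) : Continuous γ := hγ.smooth.continuous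

lemma circ_add_ne {t u : ℝ} (hu : |u| ≤ 1 / 2) (h0 : u ≠ 0) : circ (t + u) ≠ circ t := by
  rw [circ_add]
  intro h
  have h1 : circ u = 1 := mul_left_cancel₀ (circ_ne_zero t) (h.trans (mul_one _).symm)
  have := four_mul_abs_le u hu
  rw [h1, sub_self, norm_zero] at this
  linarith [abs_pos.2 h0]

lemma tendsto_cauchyKernel (hγ : IsClosedCurve γ) (t c : ℝ) {u : ℝ} (hu : |u| ≤ 1 / 2)
    (h0 : u ≠ 0) :
    Tendsto (fun δ => deriv γ (t + u) / (γ (t + u) - (γ t + deriv γ t * δ)))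
      (𝓝[lowerSector c] (0 : ℂ)) (𝓝 (deriv γ (t + u) / (γ (t + u) - γ t))) := by
  have hne : γ (t + u) - γ t ≠ 0 := sub_ne_zero.2 fun h => circ_add_ne hu h0 ((hγ.eq_iff _ _).1 h)
  have h1 : ContinuousAt (fun δ => deriv γ (t + u) / (γ (t + u) - (γ t + deriv γ t * δ))) 0 := by
    refine ContinuousAt.div₀ (by fun_prop) (by fun_prop) ?_
    simpa using hne
  have := h1.tendsto.mono_left (nhdsWithin_le_nhds (s := lowerSector c))
  simpa using this

lemma ae_ne_zero_of_mem : ∀ᵐ u : ℝ, u ≠ 0 := by simp [ae_iff]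

/-- The kernel of the circle, at the point with the same `δ`, integrates to zero because that point
is exterior, so it may be subtracted for free. The difference is bounded uniformly in `δ` and
converges to `D` pointwise. -/
lemma tendsto_integral_cauchyKernel (hγ : IsClosedCurve γ)
    (hD : ∀ t s, circ s ≠ circ t →
      deriv γ s / (γ s - γ t) = deriv circ s / (circ s - circ t) + D t s)
    (t : ℝ) {c : ℝ} (hc : 0 < c) :
    Tendsto (fun δ => ∫ u in (-1 / 2 : ℝ)..(1 / 2),
        deriv γ (t + u) / (γ (t + u) - (γ t + deriv γ t * δ)))
      (𝓝[lowerSector c] (0 : ℂ)) (𝓝 (∫ u in (-1 / 2 : ℝ)..(1 / 2), D t (t + u))) := by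
  have hcirc := isClosedCurve_circ
  obtain ⟨B, hB⟩ := hγ.eventually_norm_cauchyKernel_sub_le t hc
  obtain ⟨B', hB'⟩ := hcirc.eventually_norm_cauchyKernel_sub_le t hc
  have hmeas : ∀ {γ : ℝ → ℂ}, IsClosedCurve γ → ∀ δ : ℂ, Measurable fun u : ℝ =>
      deriv γ (t + u) / (γ (t + u) - (γ t + deriv γ t * δ)) := by
    intro γ hγ δ
    have h1 := hγ.continuous
    have h2 := hγ.continuous_deriv
    exact (by fun_prop : Continuous fun u => deriv γ (t + u)).measurable.div
      (by fun_prop : Continuous fun u => γ (t + u) - (γ t + deriv γ t * δ)).measurable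
  have key : Tendsto (fun δ => ∫ u in (-1 / 2 : ℝ)..(1 / 2),
        (deriv γ (t + u) / (γ (t + u) - (γ t + deriv γ t * δ)) -
          deriv circ (t + u) / (circ (t + u) - (circ t + deriv circ t * δ))))
      (𝓝[lowerSector c] (0 : ℂ)) (𝓝 (∫ u in (-1 / 2 : ℝ)..(1 / 2), D t (t + u))) := by
    refine intervalIntegral.tendsto_integral_filter_of_dominated_convergence (fun _ => B + B')
      (Eventually.of_forall fun δ => ((hmeas hγ δ).sub (hmeas hcirc δ)).aestronglyMeasurable) ?_
      (by simp) ?_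
    · filter_upwards [hB, hB'] with δ h h'
      refine ae_of_all _ fun u hu => ?_
      have := (norm_sub_le _ _).trans (add_le_add (h u (mem_half hu)) (h' u (mem_half hu)))
      rwa [sub_sub_sub_cancel_right] at this
    · filter_upwards [ae_ne_zero_of_mem] with u h0 hu
      have e := hD t (t + u) (circ_add_ne (mem_half hu) h0)
      rw [← sub_eq_iff_eq_add'.2 e]
      exact (hγ.tendsto_cauchyKernel t c (mem_half hu) h0).sub
        (hcirc.tendsto_cauchyKernel t c (mem_half hu) h0)
  refine key.congr' ?_
  obtain ⟨c₀, hc₀, hev⟩ := hγ.eventually_mul_le_norm_sub t hc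
  obtain ⟨c₁, hc₁, hev'⟩ := hcirc.eventually_mul_le_norm_sub t hc
  have hint : ∀ {γ : ℝ → ℂ}, IsClosedCurve γ → ∀ {δ : ℂ}, δ ≠ 0 → ∀ {c₀ : ℝ}, 0 < c₀ →
      (∀ u : ℝ, |u| ≤ 1 / 2 → c₀ * (|u| + ‖δ‖) ≤ ‖γ (t + u) - (γ t + deriv γ t * δ)‖) →
      IntervalIntegrable (fun u : ℝ => deriv γ (t + u) / (γ (t + u) - (γ t + deriv γ t * δ)))
        volume (-1 / 2) (1 / 2) := by
    intro γ hγ δ hδ c₀ hc₀ h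
    have h1 := hγ.continuous
    have h2 := hγ.continuous_deriv
    refine ContinuousOn.intervalIntegrable (ContinuousOn.div₀ (by fun_prop) (by fun_prop) ?_)
    intro u hu
    rw [Set.uIcc_of_le (by norm_num)] at hu
    have h3 : |u| ≤ 1 / 2 := abs_le.2 ⟨by linarith [hu.1], hu.2⟩
    have h4 := norm_pos_iff.2 hδ
    have h5 := abs_nonneg u
    exact norm_pos_iff.1 (lt_of_lt_of_le (by positivity) (h u h3))
  filter_upwards [self_mem_nhdsWithin, hev, hev'] with δ hδ h h'
  have hδ0 := ne_zero_of_mem_lowerSector hc hδ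
  rw [intervalIntegral.integral_sub (hint hγ hδ0 hc₀ h) (hint hcirc hδ0 hc₁ h'),
    integral_circ_exterior (one_lt_norm_circ_add hc hδ), sub_zero]

variable {E : Type*} [NormedAddCommGroup E] [NormedSpace ℂ E] [CompleteSpace E]

lemma deriv_circ_div (t u : ℝ) :
    deriv circ (t + u) / (circ (t + u) - circ t) = 2 * Real.pi * Complex.I * circKernel u := by
  rw [deriv_circ, circ_add, circKernel]
  have : circ t * circ u - circ t = circ t * (circ u - 1) := by ring
  rw [this, ← mul_div_assoc]
  rw [show 2 * (Real.pi : ℂ) * Complex.I * (circ t * circ u) =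
    circ t * (2 * Real.pi * Complex.I * circ u) by ring, mul_div_mul_left _ _ (circ_ne_zero t)]

/-- The Plemelj formula on a single curve. -/
lemma tendsto_integral_cauchy (hγ : IsClosedCurve γ) (hDc : IsPerHolder₂ D)
    (hD : ∀ t s, circ s ≠ circ t →
      deriv γ s / (γ s - γ t) = deriv circ s / (circ s - circ t) + D t s)
    {f : ℝ → E} (hf : IsPerHolder f) (t : ℝ) {c : ℝ} (hc : 0 < c) :
    Tendsto (fun δ => ∫ s in (0 : ℝ)..1, (deriv γ s / (γ s - (γ t + deriv γ t * δ))) • f s)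
      (𝓝[lowerSector c] (0 : ℂ))
      (𝓝 ((2 * Real.pi * Complex.I) • singConv circKernel f t +
        ∫ s in (0 : ℝ)..1, D t s • f s)) := by
  have hγc := hγ.continuous
  have hγd := hγ.continuous_deriv
  have hfc := hf.continuous
  have hDt : Continuous (D t) := (hDc.right t).continuous
  obtain ⟨c₀, hc₀, hev⟩ := hγ.eventually_mul_le_norm_sub t hc
  obtain ⟨M, hM⟩ := ((deriv_periodic hγ.periodic).isBounded_of_continuous one_ne_zero
    hγd).exists_norm_le
  have hM' : ∀ s, ‖deriv γ s‖ ≤ M := fun s => hM _ ⟨s, rfl⟩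
  have hM0 : 0 ≤ M := (norm_nonneg _).trans (hM' 0)
  -- Subtracting `f t` leaves a factor `|u|^r`, so the integrand is dominated by a multiple of
  -- `|u|^(r - 1)` uniformly in `δ`. The constant `f t` is handled separately by
  -- `tendsto_integral_cauchyKernel`.
  have hmain : Tendsto (fun δ => ∫ u in (-1 / 2 : ℝ)..(1 / 2),
        (deriv γ (t + u) / (γ (t + u) - (γ t + deriv γ t * δ))) • (f (t + u) - f t))
      (𝓝[lowerSector c] (0 : ℂ)) (𝓝 (∫ u in (-1 / 2 : ℝ)..(1 / 2),
        (deriv γ (t + u) / (γ (t + u) - γ t)) • (f (t + u) - f t))) := by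
    obtain ⟨A, r, hr, hr1, h⟩ := hf
    refine intervalIntegral.tendsto_integral_filter_of_dominated_convergence
      (fun u => M / c₀ * A * |u| ^ (r - 1)) (Eventually.of_forall fun δ => ?_) ?_
      ((intervalIntegrable_abs_rpow (by linarith) _ _).const_mul _) ?_
    · refine AEStronglyMeasurable.smul ?_ (by fun_prop)
      exact ((by fun_prop : Continuous fun u => deriv γ (t + u)).measurable.div
        (by fun_prop : Continuous fun u =>
          γ (t + u) - (γ t + deriv γ t * δ)).measurable).aestronglyMeasurable
    · filter_upwards [hev] with δ hδ
      filter_upwards [ae_ne_zero_of_mem] with u h0 hu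
      have hpos := abs_pos.2 h0
      have h1 := hδ u (mem_half hu)
      have h2 : c₀ * |u| ≤ ‖γ (t + u) - (γ t + deriv γ t * δ)‖ := by
        refine le_trans ?_ h1
        gcongr
        linarith [norm_nonneg δ]
      rw [norm_smul, norm_div]
      calc _ ≤ M / (c₀ * |u|) * (A * |u| ^ r) := by
            gcongr
            · exact hM' _
            · exact h.bound t u ((mem_half hu).trans (by norm_num))
        _ = _ := by rw [Real.rpow_sub_one hpos.ne']; field_simp
    · filter_upwards [ae_ne_zero_of_mem] with u h0 hu
      exact (hγ.tendsto_cauchyKernel t c (mem_half hu) h0).smul_const _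
  have hsum := hmain.add ((hγ.tendsto_integral_cauchyKernel hD t hc).smul_const (f t))
  have hDint : IntervalIntegrable (fun u => D t (t + u)) volume (-1 / 2) (1 / 2) :=
    Continuous.intervalIntegrable (by fun_prop) _ _
  -- The circle part of the limit is `2πi` times the singular convolution. The terms of `D` with `f
  -- (t + u) - f t` and with `f t` recombine to the integral of `D f`.
  have hlim : (∫ u in (-1 / 2 : ℝ)..(1 / 2),
        (deriv γ (t + u) / (γ (t + u) - γ t)) • (f (t + u) - f t)) +
      (∫ u in (-1 / 2 : ℝ)..(1 / 2), D t (t + u)) • f t =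
      (2 * Real.pi * Complex.I) • singConv circKernel f t + ∫ s in (0 : ℝ)..1, D t s • f s := by
    have hper : Function.Periodic (fun s => D t s • f s) 1 := fun s => by
      simp only [(hDc.right t).periodic s, hf.periodic s]
    rw [← integral_shift_period hper t, singConv, ← intervalIntegral.integral_smul,
      ← intervalIntegral.integral_smul_const]
    have e1 : ∫ u in (-1 / 2 : ℝ)..(1 / 2),
        (deriv γ (t + u) / (γ (t + u) - γ t)) • (f (t + u) - f t) =
        ∫ u in (-1 / 2 : ℝ)..(1 / 2), ((2 * Real.pi * Complex.I : ℂ) •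
          circKernel u • (f (t + u) - f t) + D t (t + u) • (f (t + u) - f t)) := by
      refine intervalIntegral.integral_congr_ae ?_
      filter_upwards [ae_ne_zero_of_mem] with u h0 hu
      rw [hD t (t + u) (circ_add_ne (mem_half hu) h0), deriv_circ_div, add_smul, mul_smul]
    have i1 : IntervalIntegrable (fun u => (2 * Real.pi * Complex.I : ℂ) •
        circKernel u • (f (t + u) - f t)) volume (-1 / 2) (1 / 2) :=
      (hf.intervalIntegrable_singConv isCauchyType_circKernel t).smul
        (2 * Real.pi * Complex.I : ℂ)
    have i2 : IntervalIntegrable (fun u => D t (t + u) • (f (t + u) - f t)) volume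
        (-1 / 2) (1 / 2) := Continuous.intervalIntegrable (by fun_prop) _ _
    have i3 : IntervalIntegrable (fun u => D t (t + u) • f t) volume
        (-1 / 2) (1 / 2) := Continuous.intervalIntegrable (by fun_prop) _ _
    rw [e1, intervalIntegral.integral_add i1 i2, add_assoc, ← intervalIntegral.integral_add i2 i3]
    simp only [← smul_add, sub_add_cancel]
  rw [hlim] at hsum
  refine hsum.congr' ?_
  filter_upwards [self_mem_nhdsWithin, hev] with δ hδ h
  have hδ0 := norm_pos_iff.2 (ne_zero_of_mem_lowerSector hc hδ)
  have hker : ContinuousOn (fun u : ℝ => deriv γ (t + u) / (γ (t + u) - (γ t + deriv γ t * δ)))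
      (Set.uIcc (-1 / 2) (1 / 2)) := by
    refine ContinuousOn.div₀ (by fun_prop) (by fun_prop) ?_
    intro u hu
    rw [Set.uIcc_of_le (by norm_num)] at hu
    have h3 : |u| ≤ 1 / 2 := abs_le.2 ⟨by linarith [hu.1], hu.2⟩
    have h5 := abs_nonneg u
    exact norm_pos_iff.1 (lt_of_lt_of_le (by positivity) (h u h3))
  have hper : Function.Periodic (fun s => (deriv γ s / (γ s - (γ t + deriv γ t * δ))) • f s) 1 :=
    fun s => by simp only [deriv_periodic hγ.periodic s, hγ.periodic s, hf.periodic s]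
  have i1 : IntervalIntegrable (fun u => (deriv γ (t + u) /
      (γ (t + u) - (γ t + deriv γ t * δ))) • (f (t + u) - f t)) volume (-1 / 2) (1 / 2) :=
    (hker.smul (by fun_prop : Continuous fun u => f (t + u) - f t).continuousOn).intervalIntegrable
  have i2 : IntervalIntegrable (fun u => (deriv γ (t + u) /
      (γ (t + u) - (γ t + deriv γ t * δ))) • f t) volume (-1 / 2) (1 / 2) :=
    (hker.smul continuousOn_const).intervalIntegrable
  rw [← integral_shift_period hper t, ← intervalIntegral.integral_smul_const,
    ← intervalIntegral.integral_add i1 i2]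
  simp only [← smul_add, sub_add_cancel]

end IsClosedCurve

end Plemelj

/-! ### Common constants for finite families -/

section Families

variable {ι : Type*} [Finite ι]

lemma exists_pos_forall_le (c : ι → ℝ) (hc : ∀ i, 0 < c i) : ∃ d, 0 < d ∧ ∀ i, d ≤ c i := by
  obtain ⟨M, hM⟩ := Finite.exists_le fun i => (c i)⁻¹
  have hM1 : 0 < max M 1 := lt_max_of_lt_right one_pos
  exact ⟨(max M 1)⁻¹, inv_pos.2 hM1, fun i =>
    inv_le_of_inv_le₀ (hc i) ((hM i).trans (le_max_left _ _))⟩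

variable {E : Type*} [NormedAddCommGroup E]

lemma exists_forall_perHolder {F : ι → ℝ → E} (hF : ∀ i, IsPerHolder (F i)) :
    ∃ A r, 0 ≤ A ∧ 0 < r ∧ r ≤ 1 ∧ ∀ i, PerHolder A r (F i) := by
  choose A r hr hr1 h using hF
  obtain ⟨M, hM⟩ := Finite.exists_le A
  obtain ⟨d, hd, hd'⟩ := exists_pos_forall_le r hr
  have hp : 0 < min d 1 := lt_min hd one_pos
  exact ⟨max M 0, min d 1, le_max_right _ _, hp, min_le_right _ _, fun i =>
    (h i).mono ((hM i).trans (le_max_left _ _)) hp ((min_le_left _ _).trans (hd' i))⟩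

lemma exists_forall_perHolder₂ {F : ι → ℝ → ℝ → E} (hF : ∀ i, IsPerHolder₂ (F i)) :
    ∃ A r, 0 ≤ A ∧ 0 < r ∧ r ≤ 1 ∧ ∀ i, PerHolder₂ A r (F i) := by
  choose A r hr hr1 h using hF
  obtain ⟨M, hM⟩ := Finite.exists_le A
  obtain ⟨d, hd, hd'⟩ := exists_pos_forall_le r hr
  have hp : 0 < min d 1 := lt_min hd one_pos
  exact ⟨max M 0, min d 1, le_max_right _ _, hp, min_le_right _ _, fun i =>
    (h i).mono ((hM i).trans (le_max_left _ _)) hp ((min_le_left _ _).trans (hd' i))⟩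

lemma exists_forall_norm_le {F : ι → ℝ → E} (hF : ∀ i, IsPerHolder (F i)) :
    ∃ B, 0 ≤ B ∧ ∀ i t, ‖F i t‖ ≤ B := by
  choose B _ h using fun i => (hF i).exists_bound
  obtain ⟨M, hM⟩ := Finite.exists_le B
  exact ⟨max M 0, le_max_right _ _, fun i t => (h i t).trans ((hM i).trans (le_max_left _ _))⟩

lemma exists_forall_norm_le₂ {F : ι → ℝ → ℝ → E} (hF : ∀ i, IsPerHolder₂ (F i)) :
    ∃ B, 0 ≤ B ∧ ∀ i t s, ‖F i t s‖ ≤ B := by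
  choose B _ h using fun i => (hF i).exists_bound
  obtain ⟨M, hM⟩ := Finite.exists_le B
  exact ⟨max M 0, le_max_right _ _, fun i t s =>
    (h i t s).trans ((hM i).trans (le_max_left _ _))⟩

end Families

lemma ae_iff_ae_restrict_of_periodic {q : ℝ → Prop} (hq : Function.Periodic q 1) :
    (∀ᵐ t : ℝ, q t) ↔ ∀ᵐ t ∂volume.restrict (Set.Ico (0 : ℝ) 1), q t := by
  refine ⟨fun h => ae_restrict_of_ae h, fun h => ?_⟩
  rw [ae_restrict_iff' measurableSet_Ico] at h
  have h1 : ∀ n : ℤ, ∀ᵐ t : ℝ, t - n ∈ Set.Ico (0 : ℝ) 1 → q (t - n) := fun n =>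
    (measurePreserving_sub_right volume (n : ℝ)).quasiMeasurePreserving.ae h
  filter_upwards [ae_all_iff.2 h1] with t ht
  have h2 := ht ⌊t⌋ ⟨Int.fract_nonneg t, Int.fract_lt_one t⟩
  have h3 := hq.sub_int_mul_eq (x := t) ⌊t⌋
  rw [mul_one] at h3
  rwa [h3] at h2

/-! ### From functions of the parameters to Hölder functions on the contour -/

namespace ContourSystem

variable (Γ : ContourSystem)

lemma curve (j : Fin Γ.n) : IsClosedCurve (Γ.γ j) :=
  ⟨Γ.smooth j, Γ.periodic j, Γ.regular j, Γ.simple j⟩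

lemma eq_iff {i j : Fin Γ.n} {s t : ℝ} :
    Γ.γ i s = Γ.γ j t ↔ i = j ∧ ∃ n : ℤ, s = t + n := by
  constructor
  · intro h
    have hij : i = j := by
      by_contra hne
      exact Set.disjoint_left.1 (Γ.disjoint hne) ⟨s, rfl⟩ ⟨t, h.symm⟩
    subst hij
    exact ⟨rfl, (circ_eq_iff s t).1 (((Γ.curve i).eq_iff s t).1 h)⟩
  · rintro ⟨rfl, h⟩
    exact ((Γ.curve i).eq_iff s t).2 ((circ_eq_iff s t).2 h)

lemma mem_carrier (j : Fin Γ.n) (t : ℝ) : Γ.γ j t ∈ Γ.carrier := Set.mem_iUnion.2 ⟨j, t, rfl⟩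

lemma isCompact_range (j : Fin Γ.n) : IsCompact (Set.range (Γ.γ j)) := by
  have : Set.range (Γ.γ j) = Γ.γ j '' Set.Icc 0 1 := by
    refine Set.Subset.antisymm ?_ (Set.image_subset_range _ _)
    rintro _ ⟨t, rfl⟩
    exact ⟨Int.fract t, ⟨Int.fract_nonneg t, (Int.fract_lt_one t).le⟩, (Γ.curve j).fract_eq t⟩
  rw [this]
  exact isCompact_Icc.image (Γ.curve j).continuous

lemma isCompact_carrier : IsCompact Γ.carrier := isCompact_iUnion Γ.isCompact_range

/-- Quantitative injectivity of the parametrization. -/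
lemma exists_separation : ∃ c, 0 < c ∧
    (∀ i j, i ≠ j → ∀ s t, c ≤ ‖Γ.γ i s - Γ.γ j t‖) ∧
    ∀ i (s t : ℝ), ∃ n : ℤ, |s + n - t| ≤ 1 / 2 ∧ c * |s + n - t| ≤ ‖Γ.γ i s - Γ.γ i t‖ := by
  choose a ha hab using fun i => (Γ.curve i).exists_pos_mul_abs_le
  have hb : ∀ p : {p : Fin Γ.n × Fin Γ.n // p.1 ≠ p.2}, ∃ d : ℝ, 0 < d ∧
      ∀ s t, d ≤ ‖Γ.γ p.1.1 s - Γ.γ p.1.2 t‖ := by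
    intro p
    obtain ⟨d, hd, h⟩ := (Γ.isCompact_range p.1.1).exists_cthickening_subset_open
      (Γ.isCompact_range p.1.2).isClosed.isOpen_compl
      (Set.disjoint_left.1 (Γ.disjoint p.2))
    refine ⟨d, hd, fun s t => ?_⟩
    by_contra! hlt
    refine h (Metric.mem_cthickening_of_dist_le (Γ.γ p.1.2 t) (Γ.γ p.1.1 s) d _ ⟨s, rfl⟩ ?_)
      ⟨t, rfl⟩
    rw [dist_comm, dist_eq_norm]
    exact hlt.le
  choose b hb hbb using hb
  obtain ⟨a₀, ha₀, ha₀'⟩ := exists_pos_forall_le a ha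
  obtain ⟨b₀, hb₀, hb₀'⟩ := exists_pos_forall_le b hb
  refine ⟨min a₀ b₀, lt_min ha₀ hb₀, fun i j hij s t =>
    ((min_le_right _ _).trans (hb₀' ⟨(i, j), hij⟩)).trans (hbb ⟨(i, j), hij⟩ s t),
    fun i s t => ⟨-round (s - t), ?_, ?_⟩⟩
  · have := abs_sub_round (s - t)
    push_cast
    rwa [show s + -(round (s - t) : ℝ) - t = s - t - round (s - t) by ring]
  · have h1 := abs_sub_round (s - t)
    have e : s + ((-round (s - t) : ℤ) : ℝ) - t = s - t - round (s - t) := by push_cast; ring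
    have h2 := hab i (s + ((-round (s - t) : ℤ) : ℝ)) t (by rwa [e])
    have h3 : Γ.γ i (s + ((-round (s - t) : ℤ) : ℝ)) = Γ.γ i s := Γ.eq_iff.2 ⟨rfl, _, rfl⟩
    rw [h3] at h2
    refine le_trans ?_ h2
    gcongr
    exact (min_le_left _ _).trans (ha₀' i)

open scoped Classical in
/-- The function on `Γ` that is given by the periodic functions `F j` of the parameters. -/
noncomputable def lift {X : Type*} [Zero X] (F : Fin Γ.n → ℝ → X) (ζ : ℂ) : X :=
  if h : ∃ p : Fin Γ.n × ℝ, Γ.γ p.1 p.2 = ζ then F h.choose.1 h.choose.2 else 0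

variable {Γ}

/-- Simplicity and disjointness determine the curve and the parameter modulo 1, so periodicity makes
the chosen preimage immaterial. -/
lemma lift_apply {X : Type*} [Zero X] {F : Fin Γ.n → ℝ → X}
    (hF : ∀ j, Function.Periodic (F j) 1) (j : Fin Γ.n) (t : ℝ) :
    Γ.lift F (Γ.γ j t) = F j t := by
  have h : ∃ p : Fin Γ.n × ℝ, Γ.γ p.1 p.2 = Γ.γ j t := ⟨(j, t), rfl⟩
  rw [lift, dif_pos h]
  obtain ⟨h1, n, h2⟩ := Γ.eq_iff.1 h.choose_spec
  rw [h1, h2]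
  have := (hF j).int_mul n t
  rwa [mul_one] at this

lemma holderOnWith_of_norm_sub_le {X E : Type*} [PseudoMetricSpace X] [NormedAddCommGroup E]
    {f : X → E} {s : Set X} {A r : ℝ≥0}
    (h : ∀ x ∈ s, ∀ y ∈ s, ‖f x - f y‖ ≤ A * dist x y ^ (r : ℝ)) : HolderOnWith A r f s := by
  intro x hx y hy
  rw [edist_dist, edist_dist, ENNReal.ofReal_rpow_of_nonneg dist_nonneg r.coe_nonneg,
    ← ENNReal.ofReal_coe_nnreal, ← ENNReal.ofReal_mul A.coe_nonneg, dist_eq_norm]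
  exact ENNReal.ofReal_le_ofReal (h x hx y hy)

variable (Γ) in
/-- A Hölder bound for lifted functions, uniform in the function. -/
lemma exists_norm_lift_sub_le {E : Type*} [NormedAddCommGroup E] {r : ℝ} (hr : 0 < r) :
    ∃ c, 0 ≤ c ∧ ∀ (A B : ℝ) (F : Fin Γ.n → ℝ → E), 0 ≤ A → 0 ≤ B →
      (∀ j, PerHolder A r (F j)) → (∀ j t, ‖F j t‖ ≤ B) →
      ∀ ζ ∈ Γ.carrier, ∀ η ∈ Γ.carrier,
        ‖Γ.lift F ζ - Γ.lift F η‖ ≤ (A + 2 * B) * c * dist ζ η ^ r := by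
  obtain ⟨c, hc, hsep, hbi⟩ := Γ.exists_separation
  refine ⟨c⁻¹ ^ r, by positivity, fun A B F hA hB hF hFB ζ hζ η hη => ?_⟩
  obtain ⟨i, s, rfl⟩ := Set.mem_iUnion.1 hζ
  obtain ⟨j, t, rfl⟩ := Set.mem_iUnion.1 hη
  rw [lift_apply fun j => (hF j).periodic, lift_apply fun j => (hF j).periodic, dist_eq_norm,
    mul_assoc, ← Real.mul_rpow (by positivity) (norm_nonneg _)]
  -- On one curve the chord–arc bound converts distance in the plane to distance of parameters. On
  -- different curves the distance is at least `c`, and the sup bound `2B` suffices.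
  by_cases hij : i = j
  · subst hij
    obtain ⟨n, h1, h2⟩ := hbi i s t
    have h3 := (hF i).bound t (s + n - t) (h1.trans (by norm_num))
    rw [show t + (s + n - t) = s + (n : ℝ) * 1 by ring, (hF i).periodic.int_mul n s] at h3
    have h4 : |s + n - t| ≤ c⁻¹ * ‖Γ.γ i s - Γ.γ i t‖ := by
      rw [inv_mul_eq_div, le_div_iff₀ hc, mul_comm]
      exact h2
    calc _ ≤ A * |s + n - t| ^ r := h3
      _ ≤ A * (c⁻¹ * ‖Γ.γ i s - Γ.γ i t‖) ^ r := by gcongr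
      _ ≤ _ := by gcongr; linarith
  · have h1 : 1 ≤ c⁻¹ * ‖Γ.γ i s - Γ.γ j t‖ := by
      rw [inv_mul_eq_div, le_div_iff₀ hc, one_mul]
      exact hsep i j hij s t
    have h2 := Real.one_le_rpow h1 hr.le
    calc ‖F i s - F j t‖ ≤ B + B := (norm_sub_le _ _).trans (add_le_add (hFB _ _) (hFB _ _))
      _ ≤ (A + 2 * B) * 1 := by linarith
      _ ≤ _ := by gcongr

lemma isHolderOn_lift {F : Fin Γ.n → ℝ → Mat2} (hF : ∀ j, IsPerHolder (F j)) :
    IsHolderOn (Γ.lift F) Γ.carrier := by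
  obtain ⟨A, r, hA, hr, hr1, h⟩ := exists_forall_perHolder hF
  obtain ⟨B, hB, hFB⟩ := exists_forall_norm_le hF
  obtain ⟨c, hc, hh⟩ := Γ.exists_norm_lift_sub_le (E := Mat2) hr
  refine ⟨⟨(A + 2 * B) * c, by positivity⟩, ⟨r, hr.le⟩, hr, hr1, holderOnWith_of_norm_sub_le ?_⟩
  exact hh A B F hA hB h hFB

/-- The one-variable bound has a constant independent of the lifted function. It can be used in each
variable with the other one frozen, passing through the point `(ζ', η)`. -/
lemma isHolderOn_lift₂ {k : Fin Γ.n → ℝ → Fin Γ.n → ℝ → Mat2}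
    (hk : ∀ i j, IsPerHolder₂ fun t s => k i t j s) :
    IsHolderOn (fun p : ℂ × ℂ => Γ.lift (fun i t => Γ.lift (k i t) p.2) p.1)
      (Γ.carrier ×ˢ Γ.carrier) := by
  obtain ⟨A, r, hA, hr, hr1, h⟩ := exists_forall_perHolder₂
    (F := fun (p : Fin Γ.n × Fin Γ.n) t s => k p.1 t p.2 s) fun p => hk p.1 p.2
  obtain ⟨B, hB, hFB⟩ := exists_forall_norm_le₂
    (F := fun (p : Fin Γ.n × Fin Γ.n) t s => k p.1 t p.2 s) fun p => hk p.1 p.2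
  obtain ⟨c, hc, hh⟩ := Γ.exists_norm_lift_sub_le (E := Mat2) hr
  have hin : ∀ j s i t, Γ.lift (k i t) (Γ.γ j s) = k i t j s := fun j s i t =>
    lift_apply (fun j => ((h (i, j)).right t).periodic) j s
  have hleft : ∀ η ∈ Γ.carrier, ∀ i, PerHolder A r fun t => Γ.lift (k i t) η := by
    intro η hη i
    obtain ⟨j, s, rfl⟩ := Set.mem_iUnion.1 hη
    simp only [hin]
    exact (h (i, j)).left s
  have hbd : ∀ η ∈ Γ.carrier, ∀ i t, ‖Γ.lift (k i t) η‖ ≤ B := by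
    intro η hη i t
    obtain ⟨j, s, rfl⟩ := Set.mem_iUnion.1 hη
    rw [hin]
    exact hFB (i, j) t s
  refine ⟨⟨2 * ((A + 2 * B) * c), by positivity⟩, ⟨r, hr.le⟩, hr, hr1,
    holderOnWith_of_norm_sub_le ?_⟩
  rintro ⟨ζ, η⟩ ⟨hζ, hη⟩ ⟨ζ', η'⟩ ⟨hζ', hη'⟩
  have h1 := hh A B _ hA hB (hleft η hη) (hbd η hη) ζ hζ ζ' hζ'
  have h2 : ‖Γ.lift (fun i t => Γ.lift (k i t) η) ζ' - Γ.lift (fun i t => Γ.lift (k i t) η') ζ'‖ ≤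
      (A + 2 * B) * c * dist η η' ^ r := by
    obtain ⟨i, t, rfl⟩ := Set.mem_iUnion.1 hζ'
    rw [lift_apply (fun i => (hleft η hη i).periodic), lift_apply fun i => (hleft η' hη' i).periodic]
    exact hh A B (k i t) hA hB (fun j => (h (i, j)).right t) (fun j s => hFB (i, j) t s) η hη η' hη'
  have d1 : dist ζ ζ' ≤ dist (ζ, η) (ζ', η') := le_max_left _ _
  have d2 : dist η η' ≤ dist (ζ, η) (ζ', η') := le_max_right _ _
  have e1 := Real.rpow_le_rpow dist_nonneg d1 hr.le
  have e2 := Real.rpow_le_rpow dist_nonneg d2 hr.le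
  have hcst : 0 ≤ (A + 2 * B) * c := by positivity
  calc _ ≤ (A + 2 * B) * c * dist ζ ζ' ^ r + (A + 2 * B) * c * dist η η' ^ r :=
        (norm_sub_le_norm_sub_add_norm_sub _ _ _).trans (add_le_add h1 h2)
    _ ≤ (A + 2 * B) * c * dist (ζ, η) (ζ', η') ^ r +
        (A + 2 * B) * c * dist (ζ, η) (ζ', η') ^ r := by gcongr
    _ = 2 * ((A + 2 * B) * c) * dist (ζ, η) (ζ', η') ^ r := by ring

lemma isPerHolder_comp {f : ℂ → Mat2} (hf : IsHolderOn f Γ.carrier) (j : Fin Γ.n) :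
    IsPerHolder fun t => f (Γ.γ j t) := by
  obtain ⟨A, r, hr, hr1, h⟩ := hf
  obtain ⟨L, r', -, -, hL⟩ := IsPerHolder.of_contDiff (f := Γ.γ j)
    ((Γ.smooth j).of_le (by exact_mod_cast le_top)) (Γ.periodic j)
  have hd : Continuous (deriv (Γ.γ j)) := (Γ.curve j).continuous_deriv
  obtain ⟨M, hM⟩ := ((deriv_periodic (Γ.periodic j)).isBounded_of_continuous one_ne_zero
    hd).exists_norm_le
  have hM0 : 0 ≤ M := (norm_nonneg _).trans (hM _ ⟨0, rfl⟩)
  refine ⟨A * M ^ (r : ℝ), r, hr, hr1, fun t => by rw [Γ.periodic], fun t u _ => ?_⟩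
  have h1 := h _ (Γ.mem_carrier j (t + u)) _ (Γ.mem_carrier j t)
  rw [edist_dist, edist_dist, ENNReal.ofReal_rpow_of_nonneg dist_nonneg r.coe_nonneg,
    ← ENNReal.ofReal_coe_nnreal, ← ENNReal.ofReal_mul A.coe_nonneg,
    ENNReal.ofReal_le_ofReal_iff (by positivity), dist_eq_norm, dist_eq_norm] at h1
  have h2 : ‖Γ.γ j (t + u) - Γ.γ j t‖ ≤ M * |u| := by
    have := Convex.norm_image_sub_le_of_norm_deriv_le (f := Γ.γ j) (s := Set.univ) (C := M)
      (x := t) (y := t + u) (fun x _ => ((Γ.smooth j).differentiable (by simp)) x)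
      (fun x _ => hM _ ⟨x, rfl⟩) convex_univ trivial trivial
    simpa using this
  calc _ ≤ _ := h1
    _ ≤ A * (M * |u|) ^ (r : ℝ) := by gcongr
    _ = _ := by rw [Real.mul_rpow hM0 (abs_nonneg u), mul_assoc]

/-! ### Arc length in terms of the parameters -/

section Measure

/-- The speed has no zeros, so the density does not change null sets. As `p` need not be measurable,
the exceptional set is enclosed in a measurable null set `N`; the image of `N ∩ [0,1)` under the
injective continuous `γ` is Borel, and removing it from the curve gives a measurable set of full
measure. -/
lemma ae_map_param_iff (j : Fin Γ.n) {p : ℂ → Prop} :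
    (∀ᵐ ζ ∂Measure.map (Γ.γ j)
      ((volume.restrict (Set.Ico (0 : ℝ) 1)).withDensity fun t => ‖deriv (Γ.γ j) t‖ₑ), p ζ) ↔
      ∀ᵐ t : ℝ, p (Γ.γ j t) := by
  have hγ := Γ.curve j
  have hm : Measurable fun t => ‖deriv (Γ.γ j) t‖ₑ := hγ.continuous_deriv.measurable.enorm
  rw [ae_iff_ae_restrict_of_periodic fun t => by rw [Γ.periodic j]]
  have hac : ∀ q : ℝ → Prop, (∀ᵐ t ∂(volume.restrict (Set.Ico (0 : ℝ) 1)).withDensity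
      fun t => ‖deriv (Γ.γ j) t‖ₑ, q t) ↔ ∀ᵐ t ∂volume.restrict (Set.Ico (0 : ℝ) 1), q t := by
    intro q
    rw [ae_withDensity_iff hm]
    refine eventually_congr (ae_of_all _ fun t => ?_)
    simp [Γ.regular j t]
  rw [← hac]
  refine ⟨fun h => ae_of_ae_map hγ.continuous.aemeasurable h, fun h => ?_⟩
  rw [hac] at h
  obtain ⟨N, hN, hNm, hN0⟩ := exists_measurable_superset_of_null
    (show volume.restrict (Set.Ico (0 : ℝ) 1) {t | ¬ p (Γ.γ j t)} = 0 from h)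
  have hA : MeasurableSet (Γ.γ j '' (N ∩ Set.Ico 0 1)) :=
    (hNm.inter measurableSet_Ico).image_of_continuousOn_injOn hγ.continuous.continuousOn
      (hγ.simple.mono Set.inter_subset_right)
  have hB : MeasurableSet (Γ.γ j '' Set.Ico 0 1) :=
    measurableSet_Ico.image_of_continuousOn_injOn hγ.continuous.continuousOn hγ.simple
  have key : ∀ᵐ ζ ∂Measure.map (Γ.γ j) ((volume.restrict (Set.Ico (0 : ℝ) 1)).withDensity
      fun t => ‖deriv (Γ.γ j) t‖ₑ), ζ ∈ Γ.γ j '' Set.Ico 0 1 \ Γ.γ j '' (N ∩ Set.Ico 0 1) := by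
    refine (ae_map_iff hγ.continuous.aemeasurable (hB.diff hA)).2 ((hac _).2 ?_)
    filter_upwards [ae_restrict_mem measurableSet_Ico, (show ∀ᵐ t ∂volume.restrict
      (Set.Ico (0 : ℝ) 1), t ∉ N by rw [ae_iff]; simpa using hN0)] with t ht htN
    refine ⟨⟨t, ht, rfl⟩, ?_⟩
    rintro ⟨s, ⟨hsN, hs⟩, hst⟩
    exact htN (hγ.simple hs ht hst ▸ hsN)
  filter_upwards [key]
  rintro _ ⟨⟨t, ht, rfl⟩, htN⟩
  by_contra hp
  exact htN ⟨t, ⟨hN hp, ht⟩, rfl⟩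

/-- Null sets of the arc length are those of the parameters. -/
lemma ae_arcLength_iff {p : ℂ → Prop} :
    (∀ᵐ ζ ∂Γ.arcLength, p ζ) ↔ ∀ j, ∀ᵐ t : ℝ, p (Γ.γ j t) := by
  rw [arcLength, ← Measure.sum_fintype, Measure.ae_sum_iff]
  exact forall_congr' fun j => ae_map_param_iff j

lemma lintegral_arcLength {φ : ℂ → ℝ≥0∞} (hφ : Measurable φ) :
    ∫⁻ ζ, φ ζ ∂Γ.arcLength =
      ∑ j, ∫⁻ t in Set.Ico (0 : ℝ) 1, ‖deriv (Γ.γ j) t‖ₑ * φ (Γ.γ j t) := by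
  rw [arcLength, lintegral_finsetSum_measure]
  refine Finset.sum_congr rfl fun j _ => ?_
  have hγ := (Γ.curve j).continuous.measurable
  rw [lintegral_map hφ hγ]
  exact lintegral_withDensity_eq_lintegral_mul _
    (Γ.curve j).continuous_deriv.measurable.enorm (hφ.comp hγ)

variable (Γ) in
lemma exists_speed_bounds : ∃ m M : ℝ, 0 < m ∧ 0 ≤ M ∧
    ∀ j t, m ≤ ‖deriv (Γ.γ j) t‖ ∧ ‖deriv (Γ.γ j) t‖ ≤ M := by
  have hd : ∀ j, IsPerHolder (deriv (Γ.γ j)) := fun j =>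
    IsPerHolder.of_contDiff ((contDiff_infty_iff_deriv.1 (Γ.smooth j)).2.of_le
      (by exact_mod_cast le_top)) (deriv_periodic (Γ.periodic j))
  have hi : ∀ j, IsPerHolder fun t => (deriv (Γ.γ j) t)⁻¹ := fun j =>
    IsPerHolder.of_contDiff (((contDiff_infty_iff_deriv.1 (Γ.smooth j)).2.inv
      (Γ.regular j)).of_le (by exact_mod_cast le_top))
      fun t => by rw [deriv_periodic (Γ.periodic j)]
  obtain ⟨M, hM, hM'⟩ := exists_forall_norm_le hd
  obtain ⟨m, hm, hm'⟩ := exists_forall_norm_le hi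
  refine ⟨(m + 1)⁻¹, M, by positivity, hM, fun j t => ⟨?_, hM' j t⟩⟩
  have := hm' j t
  rw [norm_inv] at this
  exact inv_le_of_inv_le₀ (norm_pos_iff.2 (Γ.regular j t)) (by linarith)

instance : IsFiniteMeasure Γ.arcLength := by
  obtain ⟨m, M, -, hM, h⟩ := Γ.exists_speed_bounds
  refine ⟨?_⟩
  rw [← lintegral_one, lintegral_arcLength measurable_const]
  refine ENNReal.sum_lt_top.2 fun j _ => ?_
  calc ∫⁻ t in Set.Ico (0 : ℝ) 1, ‖deriv (Γ.γ j) t‖ₑ * 1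
      ≤ ∫⁻ t in Set.Ico (0 : ℝ) 1, ENNReal.ofReal M := by
        refine lintegral_mono fun t => ?_
        rw [mul_one, ← ofReal_norm]
        exact ENNReal.ofReal_le_ofReal (h j t).2
    _ < ⊤ := by simp

end Measure

end ContourSystem

/-! ### Integral operators with Hölder kernels on a period -/

section KernelIntegrals

variable {R : Type*} [NormedRing R]

lemma IsPerHolder.const_smul {E : Type*} [NormedAddCommGroup E] [NormedSpace ℂ E] {f : ℝ → E}
    (hf : IsPerHolder f) (c : ℂ) : IsPerHolder fun t => c • f t := by
  obtain ⟨A, r, hr, hr1, h⟩ := hf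
  refine ⟨‖c‖ * A, r, hr, hr1, fun t => by simp only [h.periodic t], fun t u hu => ?_⟩
  rw [← smul_sub, norm_smul, mul_assoc]
  exact mul_le_mul_of_nonneg_left (h.bound t u hu) (norm_nonneg c)

lemma IsPerHolder₂.intervalIntegrable_mul {k : ℝ → ℝ → R} (hk : IsPerHolder₂ k) {v : ℝ → R}
    (hv : IntervalIntegrable v volume 0 1) (t : ℝ) :
    IntervalIntegrable (fun s => k t s * v s) volume 0 1 :=
  hv.continuousOn_mul (hk.right t).continuous.continuousOn

variable [NormedAlgebra ℂ R]

/-- The integral operator on functions on a period, with kernel `k`. -/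
noncomputable def kernelIntegral (k : ℝ → ℝ → R) (v : ℝ → R) (t : ℝ) : R :=
  ∫ s in (0 : ℝ)..1, k t s * v s

lemma norm_kernelIntegral_le {k : ℝ → ℝ → R} {v : ℝ → R} (hv : IntervalIntegrable v volume 0 1)
    {t B : ℝ} (hB : ∀ s, ‖k t s‖ ≤ B) :
    ‖kernelIntegral k v t‖ ≤ B * ∫ s in (0 : ℝ)..1, ‖v s‖ := by
  rw [← intervalIntegral.integral_const_mul]
  refine intervalIntegral.norm_integral_le_of_norm_le zero_le_one (ae_of_all _ fun s _ => ?_)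
    (hv.norm.const_mul B)
  exact (norm_mul_le _ _).trans (mul_le_mul_of_nonneg_right (hB s) (norm_nonneg _))

lemma kernelIntegral_sub {k : ℝ → ℝ → R} (hk : IsPerHolder₂ k) {v : ℝ → R}
    (hv : IntervalIntegrable v volume 0 1) (t t' : ℝ) :
    kernelIntegral k v t - kernelIntegral k v t' =
      kernelIntegral (fun _ s => k t s - k t' s) v t := by
  rw [kernelIntegral, kernelIntegral, ← intervalIntegral.integral_sub
    (hk.intervalIntegrable_mul hv t) (hk.intervalIntegrable_mul hv t')]
  simp only [kernelIntegral, sub_mul]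

/-- The regularity comes from the kernel alone, uniformly in `s`; the density need only be
integrable. -/
lemma IsPerHolder₂.kernelIntegral {k : ℝ → ℝ → R} (hk : IsPerHolder₂ k) {v : ℝ → R}
    (hv : IntervalIntegrable v volume 0 1) : IsPerHolder (kernelIntegral k v) := by
  obtain ⟨A, r, hr, hr1, h⟩ := id hk
  refine ⟨A * ∫ s in (0 : ℝ)..1, ‖v s‖, r, hr, hr1, fun t => ?_, fun t u hu => ?_⟩
  · simp only [_root_.kernelIntegral, (h.left _).periodic t]
  · rw [kernelIntegral_sub hk hv]
    refine (norm_kernelIntegral_le hv fun s => (h.left s).bound t u hu).trans_eq (by ring)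

lemma kernelIntegral_congr {k : ℝ → ℝ → R} {v w : ℝ → R} (h : ∀ᵐ s : ℝ, v s = w s) (t : ℝ) :
    kernelIntegral k v t = kernelIntegral k w t :=
  intervalIntegral.integral_congr_ae (h.mono fun s hs _ => by rw [hs])

/-- The kernel of the composition of two integral operators. -/
noncomputable def kernelComp (k l : ℝ → ℝ → R) (t s : ℝ) : R := ∫ x in (0 : ℝ)..1, k t x * l x s

lemma IsPerHolder₂.comp {k l : ℝ → ℝ → R} (hk : IsPerHolder₂ k) (hl : IsPerHolder₂ l) :
    IsPerHolder₂ (kernelComp k l) := by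
  obtain ⟨B, hB, hkB⟩ := hk.exists_bound
  obtain ⟨B', hB', hlB⟩ := hl.exists_bound
  obtain ⟨A, r, hr, hr1, h, h'⟩ := hk.exists_common hl
  have hA := h.nonneg
  have ic : ∀ t s, IntervalIntegrable (fun x => k t x * l x s) volume 0 1 := fun t s =>
    ((hk.right t).continuous.mul (hl.left s).continuous).intervalIntegrable _ _
  have hcomp : ∀ t s t' s' : ℝ, kernelComp k l t s - kernelComp k l t' s' =
      ∫ x in (0 : ℝ)..1, (k t x * l x s - k t' x * l x s') := fun t s t' s' =>
    (intervalIntegral.integral_sub (ic t s) (ic t' s')).symm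
  have bd : ∀ (t s t' s' C : ℝ), (∀ x, ‖k t x * l x s - k t' x * l x s'‖ ≤ C) →
      ‖kernelComp k l t s - kernelComp k l t' s'‖ ≤ C := by
    intro t s t' s' C hC
    rw [hcomp]
    have := intervalIntegral.norm_integral_le_of_norm_le_const (a := 0) (b := 1)
      (fun x _ => hC x)
    simpa using this
  refine ⟨A * B' + B * A, r, hr, hr1, fun s => ⟨fun t => ?_, fun t u hu => bd _ _ _ _ _ fun x => ?_⟩,
    fun t => ⟨fun s => ?_, fun s u hu => bd _ _ _ _ _ fun x => ?_⟩⟩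
  · simp only [kernelComp, (h.left _).periodic t]
  · have h1 := (h.left x).bound t u hu
    have hp := Real.rpow_nonneg (abs_nonneg u) r
    rw [← sub_mul]
    calc _ ≤ ‖k (t + u) x - k t x‖ * ‖l x s‖ := norm_mul_le _ _
      _ ≤ A * |u| ^ r * B' := mul_le_mul h1 (hlB _ _) (norm_nonneg _) (by positivity)
      _ ≤ _ := by nlinarith [mul_nonneg (mul_nonneg hB hA) hp]
  · simp only [kernelComp, (h'.right _).periodic s]
  · have h1 := (h'.right x).bound s u hu
    have hp := Real.rpow_nonneg (abs_nonneg u) r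
    rw [← mul_sub]
    calc _ ≤ ‖k t x‖ * ‖l x (s + u) - l x s‖ := norm_mul_le _ _
      _ ≤ B * (A * |u| ^ r) := mul_le_mul (hkB _ _) h1 (norm_nonneg _) hB
      _ ≤ _ := by nlinarith [mul_nonneg (mul_nonneg hB' hA) hp]

variable [CompleteSpace R]

lemma kernelIntegral_kernelIntegral {k l : ℝ → ℝ → R} (hk : IsPerHolder₂ k) (hl : IsPerHolder₂ l)
    {v : ℝ → R} (hv : IntervalIntegrable v volume 0 1) (t : ℝ) :
    kernelIntegral k (kernelIntegral l v) t = kernelIntegral (kernelComp k l) v t := by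
  obtain ⟨B, hB, hkB⟩ := hk.exists_bound
  obtain ⟨B', hB', hlB⟩ := hl.exists_bound
  have e1 : kernelIntegral k (kernelIntegral l v) t =
      ∫ x in (0 : ℝ)..1, ∫ s in (0 : ℝ)..1, k t x * l x s * v s := by
    refine intervalIntegral.integral_congr fun x _ => ?_
    simp only [kernelIntegral, mul_assoc]
    rw [intervalIntegral_const_mul' _ (hl.intervalIntegrable_mul hv x)]
  have e2 : kernelIntegral (kernelComp k l) v t =
      ∫ s in (0 : ℝ)..1, ∫ x in (0 : ℝ)..1, k t x * l x s * v s := by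
    refine intervalIntegral.integral_congr fun s _ => ?_
    simp only [kernelComp]
    rw [intervalIntegral_mul_const']
    exact ((hk.right t).continuous.mul (hl.left s).continuous).intervalIntegrable _ _
  rw [e1, e2]
  refine intervalIntegral_swap zero_le_one zero_le_one ?_
  have hv' := (intervalIntegrable_iff_integrableOn_Ioc_of_le zero_le_one).1 hv
  have h1 : Integrable (fun p : ℝ × ℝ => v p.2)
      ((volume.restrict (Set.Ioc (0 : ℝ) 1)).prod (volume.restrict (Set.Ioc (0 : ℝ) 1))) :=
    hv'.integrable.comp_snd _
  refine (h1.norm.const_mul (B * B')).mono' ?_ (ae_of_all _ ?_)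
  · refine AEStronglyMeasurable.mul (Continuous.aestronglyMeasurable ?_) h1.1
    exact ((hk.right t).continuous.comp continuous_fst).mul hl.continuous
  · rintro ⟨x, s⟩
    refine (norm_mul_le _ _).trans ?_
    refine mul_le_mul_of_nonneg_right ?_ (norm_nonneg _)
    exact (norm_mul_le _ _).trans (mul_le_mul (hkB _ _) (hlB _ _) (norm_nonneg _) hB)

/-- Fubini, justified by the Hölder bound of `k` in `t`: the double integrand is at most a multiple
of `|u|^(r - 1) ‖v s‖`. The singular operator thus acts on the kernel only. -/
lemma singConv_kernelIntegral {κ : ℝ → ℂ} (hκ : IsCauchyType κ) {k : ℝ → ℝ → R}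
    (hk : IsPerHolder₂ k) {v : ℝ → R} (hv : IntervalIntegrable v volume 0 1) (t : ℝ) :
    singConv κ (kernelIntegral k v) t =
      kernelIntegral (fun t s => singConv κ (fun t => k t s) t) v t := by
  obtain ⟨A, r, hr, hr1, h⟩ := id hk
  have hv' := (intervalIntegrable_iff_integrableOn_Ioc_of_le zero_le_one).1 hv
  have e1 : singConv κ (kernelIntegral k v) t = ∫ u in (-1 / 2 : ℝ)..(1 / 2),
      ∫ s in (0 : ℝ)..1, κ u • ((k (t + u) s - k t s) * v s) := by
    refine intervalIntegral.integral_congr fun u _ => ?_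
    rw [kernelIntegral_sub hk hv, kernelIntegral, ← intervalIntegral.integral_smul]
  have e2 : kernelIntegral (fun t s => singConv κ (fun t => k t s) t) v t =
      ∫ s in (0 : ℝ)..1, ∫ u in (-1 / 2 : ℝ)..(1 / 2), κ u • ((k (t + u) s - k t s) * v s) := by
    refine intervalIntegral.integral_congr fun s _ => ?_
    simp only [singConv]
    rw [← intervalIntegral_mul_const' _ ((hk.left s).intervalIntegrable_singConv hκ t)]
    simp only [smul_mul_assoc]
  rw [e1, e2]
  refine (intervalIntegral_swap zero_le_one (by norm_num) ?_).symm
  refine integrable_prod_singular hκ h.nonneg hr (b := fun s => ‖v s‖) hv'.norm ?_ ?_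
    fun s => norm_nonneg _
  · have h1 : Integrable (fun p : ℝ × ℝ => v p.1)
      ((volume.restrict (Set.Ioc (0 : ℝ) 1)).prod (volume.restrict (Set.Ioc (-1 / 2 : ℝ) (1 / 2)))) :=
      hv'.integrable.comp_fst _
    refine AEStronglyMeasurable.mul (Continuous.aestronglyMeasurable ?_) h1.1
    have hc := hk.continuous
    exact (hc.comp (by fun_prop : Continuous fun p : ℝ × ℝ => (t + p.2, p.1))).sub
      (hc.comp (by fun_prop : Continuous fun p : ℝ × ℝ => (t, p.1)))
  · intro s u hu
    calc _ ≤ ‖k (t + u) s - k t s‖ * ‖v s‖ := norm_mul_le _ _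
      _ ≤ A * |u| ^ r * ‖v s‖ := mul_le_mul_of_nonneg_right
          ((h.left s).bound t u (by linarith)) (norm_nonneg _)
      _ = _ := by ring

/-- Composition in the other order acts on the second variable of the kernel, through the transpose.
Order of multiplication is unaffected since `κ` is scalar. -/
lemma kernelIntegral_singConv {κ : ℝ → ℂ} (hκ : IsCauchyType κ) {k : ℝ → ℝ → R}
    (hk : IsPerHolder₂ k) {f : ℝ → R} (hf : IsPerHolder f) (t : ℝ) :
    kernelIntegral k (singConv κ f) t =
      kernelIntegral (fun t s => singConv (fun u => κ (-u)) (k t) s) f t :=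
  integral_mul_singConv hκ hf (hk.right t)

/-- The commutator of the singular convolution with a smooth function has a smooth kernel. -/
lemma singConv_mul_sub {g f : ℝ → R} (hg : ContDiff ℝ ∞ g) (hp : Function.Periodic g 1)
    (hf : IsPerHolder f) (t : ℝ) :
    singConv circKernel (fun t => g t * f t) t - g t * singConv circKernel f t =
      kernelIntegral (fun t s => circ s • circQuotient g s t) f t := by
  have hg' : IsPerHolder g := IsPerHolder.of_contDiff (hg.of_le (by exact_mod_cast le_top)) hp
  have hκ := isCauchyType_circKernel
  have hper : Function.Periodic (fun s => circ s • circQuotient g s t * f s) 1 := fun s => by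
    simp only [circ_periodic s, circQuotient_periodic_left hp, hf.periodic s]
  rw [kernelIntegral, ← integral_shift_period hper t, singConv, singConv,
    ← intervalIntegral_const_mul' _ (hf.intervalIntegrable_singConv hκ t),
    ← intervalIntegral.integral_sub ((hg'.mul hf).intervalIntegrable_singConv hκ t)
      ((hf.intervalIntegrable_singConv hκ t).continuousOn_mul continuousOn_const)]
  refine intervalIntegral.integral_congr_ae ?_
  filter_upwards [IsClosedCurve.ae_ne_zero_of_mem] with u h0 hu
  have h1 := IsClosedCurve.circ_add_ne (t := t) (mem_half hu) h0
  have h2 := smul_circQuotient hp (t + u) t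
  have h3 : circ u - 1 ≠ 0 := by
    intro h3
    rw [circ_add, sub_eq_zero.1 h3, mul_one] at h1
    exact h1 rfl
  -- In the commutator the terms with `f t` cancel, leaving `κ(u) (g(t + u) - g t) f(t + u)`. The
  -- zero of the difference of `g` absorbs the pole of `κ`.
  have h4 : circ (t + u) • circQuotient g (t + u) t = circKernel u • (g (t + u) - g t) := by
    rw [← h2, smul_smul, circKernel, circ_add]
    congr 1
    field_simp
  rw [h4, mul_smul_comm, ← smul_sub, smul_mul_assoc]
  congr 1
  noncomm_ring

lemma isPerHolder₂_commutator {g : ℝ → R} (hg : ContDiff ℝ ∞ g) (hp : Function.Periodic g 1) :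
    IsPerHolder₂ (fun t s => circ s • circQuotient g s t) := by
  refine IsPerHolder₂.of_contDiff ?_ (fun t s => by rw [circQuotient_periodic_right hp])
    fun t s => by rw [circQuotient_periodic_left hp, circ_periodic]
  have h1 : ContDiff ℝ ∞ fun p : ℝ × ℝ => circQuotient g p.2 p.1 :=
    (contDiff_circQuotient hg hp).comp (by fun_prop : ContDiff ℝ ∞ fun p : ℝ × ℝ => (p.2, p.1))
  exact ((contDiff_circ.comp contDiff_snd).smul h1).of_le (by exact_mod_cast le_top)

end KernelIntegrals

section FrobeniusNorm

attribute [local instance] Matrix.frobeniusNormedRing Matrix.frobeniusNormedAlgebra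

/-- The topology of the Frobenius norm. -/
noncomputable abbrev Mat2.normTopology : TopologicalSpace Mat2 :=
  (Matrix.frobeniusNormedAddCommGroup :
    NormedAddCommGroup Mat2).toMetricSpace.toPseudoMetricSpace.toUniformSpace.toTopologicalSpace

attribute [local instance] Mat2.normTopology

namespace ContourSystem

variable {Γ : ContourSystem}

/-! ### The space `L²(Γ)` and its dense subspace of Hölder families -/

section L2Space

lemma ae_mem_carrier : ∀ᵐ ζ ∂Γ.arcLength, ζ ∈ Γ.carrier :=
  ae_arcLength_iff.2 fun j => ae_of_all _ fun t => Γ.mem_carrier j t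

lemma L2.ext {u v : Γ.L2} (h : ∀ j, ∀ᵐ t : ℝ, u (Γ.γ j t) = v (Γ.γ j t)) : u = v :=
  Lp.ext (ae_arcLength_iff.2 h)

lemma aestronglyMeasurable_lift {F : Fin Γ.n → ℝ → Mat2} (hF : ∀ j, IsPerHolder (F j)) :
    AEStronglyMeasurable (Γ.lift F) Γ.arcLength := by
  obtain ⟨A, r, hr, -, h⟩ := Γ.isHolderOn_lift hF
  have hc : ContinuousOn (Γ.lift F) Γ.carrier := (h.uniformContinuousOn hr).continuousOn
  have h1 := hc.aestronglyMeasurable (μ := Γ.arcLength) Γ.isCompact_carrier.measurableSet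
  rwa [Measure.restrict_eq_self_of_ae_mem ae_mem_carrier] at h1

lemma ae_norm_lift_le {F : Fin Γ.n → ℝ → Mat2} (hF : ∀ j, IsPerHolder (F j)) {B : ℝ}
    (hB : ∀ j t, ‖F j t‖ ≤ B) : ∀ᵐ ζ ∂Γ.arcLength, ‖Γ.lift F ζ‖ ≤ B :=
  ae_arcLength_iff.2 fun j => ae_of_all _ fun t => by
    rw [lift_apply fun j => (hF j).periodic]
    exact hB j t

lemma memLp_lift {F : Fin Γ.n → ℝ → Mat2} (hF : ∀ j, IsPerHolder (F j)) :
    MemLp (Γ.lift F) 2 Γ.arcLength := by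
  obtain ⟨B, -, hB⟩ := exists_forall_norm_le hF
  exact MemLp.of_bound (aestronglyMeasurable_lift hF) B (ae_norm_lift_le hF hB)

variable (Γ) in
/-- Families of periodic Hölder functions of the parameters. -/
noncomputable def holderFamily : Submodule ℂ (Fin Γ.n → ℝ → Mat2) where
  carrier := {F | ∀ j, IsPerHolder (F j)}
  add_mem' hF hG j := (hF j).add (hG j)
  zero_mem' _ := IsPerHolder.const 0
  smul_mem' c _ hF j := (hF j).const_smul c

/-- The class in `L²(Γ)` of a family of Hölder functions. -/
noncomputable def ofFamily : Γ.holderFamily →ₗ[ℂ] Γ.L2 where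
  toFun F := (memLp_lift F.2).toLp _
  map_add' F G := by
    rw [← MemLp.toLp_add]
    refine MemLp.toLp_congr _ _ (ae_arcLength_iff.2 fun j => ae_of_all _ fun t => ?_)
    rw [Pi.add_apply, lift_apply fun j => ((F + G).2 j).periodic,
      lift_apply fun j => (F.2 j).periodic, lift_apply fun j => (G.2 j).periodic]
    rfl
  map_smul' c F := by
    rw [RingHom.id_apply, ← MemLp.toLp_const_smul]
    refine MemLp.toLp_congr _ _ (ae_arcLength_iff.2 fun j => ae_of_all _ fun t => ?_)
    rw [Pi.smul_apply, lift_apply fun j => ((c • F).2 j).periodic,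
      lift_apply fun j => (F.2 j).periodic]
    rfl

lemma ofFamily_ae (F : Γ.holderFamily) (j : Fin Γ.n) :
    ∀ᵐ t : ℝ, ofFamily F (Γ.γ j t) = F.1 j t := by
  have := ae_arcLength_iff.1 (memLp_lift F.2).coeFn_toLp j
  filter_upwards [this] with t ht
  exact ht.trans (lift_apply (fun j => (F.2 j).periodic) j t)

lemma ofFamily_eq {F : Γ.holderFamily} {u : Γ.L2}
    (h : ∀ j, ∀ᵐ t : ℝ, u (Γ.γ j t) = F.1 j t) : ofFamily F = u := by
  refine L2.ext fun j => ?_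
  filter_upwards [ofFamily_ae F j, h j] with t h1 h2
  rw [h1, h2]

variable (Γ) in
-- Compactly supported smooth functions on the plane are dense in `L²` of the arc length, and
-- composed with the parametrizations they are smooth and periodic.
lemma denseRange_ofFamily : DenseRange (ofFamily (Γ := Γ)) := by
  refine (Lp.dense_hasCompactSupport_contDiff (μ := Γ.arcLength) (F := Mat2) (p := 2)
    (by simp)).mono ?_
  rintro u ⟨g, hug, -, hg⟩
  refine ⟨⟨fun j t => g (Γ.γ j t), fun j => ?_⟩, ofFamily_eq (ae_arcLength_iff.1 hug)⟩
  refine IsPerHolder.of_contDiff ((hg.comp (Γ.smooth j)).of_le (by exact_mod_cast le_top)) ?_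
  intro t
  beta_reduce
  rw [Γ.periodic]

lemma enorm_sq_eq (u : Γ.L2) : ‖u‖ₑ ^ 2 =
    ∑ j, ∫⁻ t in Set.Ico (0 : ℝ) 1, ‖deriv (Γ.γ j) t‖ₑ * ‖u (Γ.γ j t)‖ₑ ^ 2 := by
  have h1 := eLpNorm_nnreal_pow_eq_lintegral (p := 2) (f := u) (μ := Γ.arcLength) two_ne_zero
  rw [Lp.enorm_def]
  norm_num at h1
  rw [h1, lintegral_arcLength ((Lp.stronglyMeasurable u).enorm.pow_const 2)]

lemma measurable_comp_param (u : Γ.L2) (j : Fin Γ.n) :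
    StronglyMeasurable fun t => u (Γ.γ j t) :=
  (Lp.stronglyMeasurable u).comp_measurable (Γ.curve j).continuous.measurable

variable (Γ) in
-- The speed lies between two positive constants, so arc length and parameter give equivalent `L²`
-- norms. This transfers Fourier analysis in the parameter to the contour.
lemma exists_enorm_sq_bounds : ∃ a b : ℝ, 0 ≤ a ∧ 0 ≤ b ∧ ∀ u : Γ.L2,
    (∑ j, ∫⁻ t in Set.Ico (0 : ℝ) 1, ‖u (Γ.γ j t)‖ₑ ^ 2) ≤ ENNReal.ofReal a * ‖u‖ₑ ^ 2 ∧
    ‖u‖ₑ ^ 2 ≤ ENNReal.ofReal b * ∑ j, ∫⁻ t in Set.Ico (0 : ℝ) 1, ‖u (Γ.γ j t)‖ₑ ^ 2 := by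
  obtain ⟨m, M, hm, hM, h⟩ := Γ.exists_speed_bounds
  refine ⟨m⁻¹, M, by positivity, hM, fun u => ⟨?_, ?_⟩⟩
  · rw [enorm_sq_eq, Finset.mul_sum]
    refine Finset.sum_le_sum fun j _ => ?_
    rw [← lintegral_const_mul' _ _ ENNReal.ofReal_ne_top]
    refine lintegral_mono fun t => ?_
    rw [← mul_assoc]
    refine le_mul_of_one_le_left zero_le ?_
    rw [← ofReal_norm (deriv (Γ.γ j) t), ← ENNReal.ofReal_mul (by positivity),
      ENNReal.one_le_ofReal, inv_mul_eq_div, one_le_div hm]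
    exact (h j t).1
  · rw [enorm_sq_eq, Finset.mul_sum]
    refine Finset.sum_le_sum fun j _ => ?_
    rw [← lintegral_const_mul' _ _ ENNReal.ofReal_ne_top]
    refine lintegral_mono fun t => ?_
    rw [← ofReal_norm (deriv (Γ.γ j) t)]
    gcongr
    exact (h j t).2

variable (Γ) in
/-- Restriction to the curves maps `L²(Γ)` boundedly to `L¹` of the parameter interval. -/
lemma exists_integral_norm_le : ∃ C, 0 ≤ C ∧ ∀ (u : Γ.L2) j,
    IntervalIntegrable (fun t => u (Γ.γ j t)) volume 0 1 ∧
      ∫ t in (0 : ℝ)..1, ‖u (Γ.γ j t)‖ ≤ C * ‖u‖ := by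
  obtain ⟨a, b, ha, -, h⟩ := Γ.exists_enorm_sq_bounds
  refine ⟨√a, Real.sqrt_nonneg a, fun u j => ?_⟩
  set ν := volume.restrict (Set.Ico (0 : ℝ) 1)
  have hprob : IsProbabilityMeasure ν := ⟨by simp [ν]⟩
  have hm := (measurable_comp_param u j).aestronglyMeasurable (μ := ν)
  have h2 : eLpNorm (fun t => u (Γ.γ j t)) 2 ν ≤ ENNReal.ofReal (√a * ‖u‖) := by
    have h1 := eLpNorm_nnreal_pow_eq_lintegral (p := 2) (f := fun t => u (Γ.γ j t)) (μ := ν)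
      two_ne_zero
    norm_num at h1
    have h3 : eLpNorm (fun t => u (Γ.γ j t)) 2 ν ^ 2 ≤ ENNReal.ofReal (√a * ‖u‖) ^ 2 := by
      rw [h1, ← ENNReal.ofReal_pow (by positivity), mul_pow, Real.sq_sqrt ha,
        ENNReal.ofReal_mul ha, ENNReal.ofReal_pow (norm_nonneg _), ofReal_norm]
      refine le_trans ?_ (h u).1
      exact Finset.single_le_sum (f := fun j => ∫⁻ t in Set.Ico (0 : ℝ) 1, ‖u (Γ.γ j t)‖ₑ ^ 2)
        (fun _ _ => zero_le) (Finset.mem_univ j)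
    exact (ENNReal.pow_le_pow_left_iff two_ne_zero).1 h3
  have h1 : eLpNorm (fun t => u (Γ.γ j t)) 1 ν ≤ ENNReal.ofReal (√a * ‖u‖) :=
    (eLpNorm_le_eLpNorm_of_exponent_le (by norm_num) hm).trans h2
  have hint : Integrable (fun t => u (Γ.γ j t)) ν :=
    memLp_one_iff_integrable.1 ⟨hm, h1.trans_lt ENNReal.ofReal_lt_top⟩
  refine ⟨(intervalIntegrable_iff_integrableOn_Ico_of_le zero_le_one).2 hint, ?_⟩
  rw [intervalIntegral.integral_of_le zero_le_one, ← integral_Ico_eq_integral_Ioc,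
    integral_norm_eq_lintegral_enorm hm, ← eLpNorm_one_eq_lintegral_enorm]
  exact ENNReal.toReal_le_of_le_ofReal (by positivity) h1

lemma intervalIntegrable_comp_param (u : Γ.L2) (j : Fin Γ.n) :
    IntervalIntegrable (fun t => u (Γ.γ j t)) volume 0 1 := by
  obtain ⟨C, -, h⟩ := Γ.exists_integral_norm_le
  exact (h u j).1

variable (Γ) in
lemma exists_norm_le_of_ae_bound : ∃ C, 0 ≤ C ∧ ∀ (u : Γ.L2) (B : ℝ), 0 ≤ B →
    (∀ j, ∀ᵐ t : ℝ, ‖u (Γ.γ j t)‖ ≤ B) → ‖u‖ ≤ C * B :=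
  ⟨_, by positivity, fun _ _ hB h => Lp.norm_le_of_ae_bound hB (ae_arcLength_iff.2 h)⟩

end L2Space

/-! ### The singular part of `C_-` as a bounded operator -/

section CircleOperator

/-- The circle projection, applied on each curve. -/
noncomputable def singFamily : Γ.holderFamily →ₗ[ℂ] Γ.holderFamily where
  toFun F := ⟨fun j => singConv circKernel (F.1 j),
    fun j => (F.2 j).singConv isCauchyType_circKernel⟩
  map_add' F G := by
    ext1
    funext j t
    exact singConv_add isCauchyType_circKernel (F.2 j) (G.2 j) t
  map_smul' c F := by
    ext1
    funext j t
    exact singConv_clm (c • ContinuousLinearMap.id ℂ Mat2) isCauchyType_circKernel (F.2 j) t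

lemma lintegral_ofFamily (F : Γ.holderFamily) (j : Fin Γ.n) :
    ∫⁻ t in Set.Ico (0 : ℝ) 1, ‖ofFamily F (Γ.γ j t)‖ₑ ^ 2 =
      ENNReal.ofReal (∫ t in (0 : ℝ)..1, ‖F.1 j t‖ ^ 2) := by
  have hc := (F.2 j).continuous
  rw [intervalIntegral.integral_of_le zero_le_one, ← integral_Ico_eq_integral_Ioc,
    ofReal_integral_eq_lintegral_ofReal]
  · refine lintegral_congr_ae (ae_restrict_of_ae ?_)
    filter_upwards [ofFamily_ae F j] with t ht
    rw [ht, ENNReal.ofReal_pow (norm_nonneg _), ofReal_norm]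
  · exact ((hc.norm.pow 2).integrableOn_Icc (a := 0) (b := 1)).mono_set Set.Ico_subset_Icc_self
  · exact ae_of_all _ fun t => by positivity

variable (Γ) in
lemma exists_norm_singFamily_le :
    ∃ C, ∀ F : Γ.holderFamily, ‖ofFamily (singFamily F)‖ ≤ C * ‖ofFamily F‖ := by
  obtain ⟨a, b, ha, hb, h⟩ := Γ.exists_enorm_sq_bounds
  refine ⟨√(b * a), fun F => ?_⟩
  have h1 : ‖ofFamily (singFamily F)‖ₑ ^ 2 ≤ ENNReal.ofReal b * (ENNReal.ofReal a *
      ‖ofFamily F‖ₑ ^ 2) := by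
    refine (h _).2.trans ?_
    gcongr
    refine le_trans ?_ (h (ofFamily F)).1
    refine Finset.sum_le_sum fun j _ => ?_
    rw [lintegral_ofFamily, lintegral_ofFamily]
    exact ENNReal.ofReal_le_ofReal (Mat2.integral_norm_sq_singConv_le (F.2 j))
  rw [← ofReal_norm, ← ofReal_norm, ← ENNReal.ofReal_pow (norm_nonneg _),
    ← ENNReal.ofReal_pow (norm_nonneg _), ← ENNReal.ofReal_mul ha, ← ENNReal.ofReal_mul hb,
    ENNReal.ofReal_le_ofReal_iff (by positivity)] at h1
  refine abs_le_of_sq_le_sq' ?_ (by positivity) |>.2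
  rw [mul_pow, Real.sq_sqrt (by positivity), mul_assoc]
  exact h1

variable (Γ) in
/-- The bounded operator on `L²(Γ)` that acts on each curve as minus the projection to the negative
Fourier modes of the parameter. -/
noncomputable def circleOp : Γ.L2 →L[ℂ] Γ.L2 :=
  (ofFamily ∘ₗ singFamily).extendOfNorm (ofFamily (Γ := Γ))

lemma circleOp_ofFamily (F : Γ.holderFamily) :
    Γ.circleOp (ofFamily F) = ofFamily (singFamily F) :=
  LinearMap.extendOfNorm_eq Γ.denseRange_ofFamily Γ.exists_norm_singFamily_le F

/-- Bounded operators that agree on Hölder densities are equal. -/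
lemma clm_ext {S T : Γ.L2 →L[ℂ] Γ.L2} (h : ∀ F : Γ.holderFamily, S (ofFamily F) = T (ofFamily F)) :
    S = T :=
  DFunLike.coe_injective <| Γ.denseRange_ofFamily.equalizer S.continuous T.continuous (funext h)

lemma circleOp_circleOp : Γ.circleOp ∘L Γ.circleOp = -Γ.circleOp := by
  refine clm_ext fun F => ?_
  rw [ContinuousLinearMap.comp_apply, neg_apply, circleOp_ofFamily,
    circleOp_ofFamily, ← map_neg]
  congr 1
  ext1
  funext j t
  exact Mat2.singConv_singConv (F.2 j) t

end CircleOperator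

/-! ### Multiplication operators -/

section Multiplication

lemma memLp_mul {g : Fin Γ.n → ℝ → Mat2} (hg : ∀ j, IsPerHolder (g j)) (u : Γ.L2) :
    MemLp (fun ζ => Γ.lift g ζ * u ζ) 2 Γ.arcLength := by
  obtain ⟨B, -, hB⟩ := exists_forall_norm_le hg
  refine (Lp.memLp u).of_le_mul (c := B)
    ((aestronglyMeasurable_lift hg).mul (Lp.aestronglyMeasurable u)) ?_
  filter_upwards [ae_norm_lift_le hg hB] with ζ hζ
  exact (Matrix.frobenius_norm_mul _ _).trans (mul_le_mul_of_nonneg_right hζ (norm_nonneg _))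

lemma memLp_mul_ae {g : Fin Γ.n → ℝ → Mat2} (hg : ∀ j, IsPerHolder (g j)) (u : Γ.L2)
    (j : Fin Γ.n) :
    ∀ᵐ t : ℝ, (memLp_mul hg u).toLp _ (Γ.γ j t) = g j t * u (Γ.γ j t) := by
  filter_upwards [ae_arcLength_iff.1 (memLp_mul hg u).coeFn_toLp j] with t ht
  rw [ht, lift_apply fun j => (hg j).periodic]

lemma L2.coeFn_add_param (u v : Γ.L2) (j : Fin Γ.n) :
    ∀ᵐ t : ℝ, (u + v) (Γ.γ j t) = u (Γ.γ j t) + v (Γ.γ j t) :=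
  ae_arcLength_iff.1 (Lp.coeFn_add u v) j

lemma L2.coeFn_smul_param (c : ℂ) (u : Γ.L2) (j : Fin Γ.n) :
    ∀ᵐ t : ℝ, (c • u) (Γ.γ j t) = c • u (Γ.γ j t) :=
  ae_arcLength_iff.1 (Lp.coeFn_smul c u) j

/-- Pointwise multiplication from the left, as a linear map. -/
noncomputable def mulLinear {g : Fin Γ.n → ℝ → Mat2} (hg : ∀ j, IsPerHolder (g j)) :
    Γ.L2 →ₗ[ℂ] Γ.L2 where
  toFun u := (memLp_mul hg u).toLp _
  map_add' u v := by
    refine L2.ext fun j => ?_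
    filter_upwards [memLp_mul_ae hg (u + v) j, memLp_mul_ae hg u j, memLp_mul_ae hg v j,
      L2.coeFn_add_param u v j,
      L2.coeFn_add_param ((memLp_mul hg u).toLp _) ((memLp_mul hg v).toLp _) j]
      with t h1 h2 h3 h4 h5
    rw [h1, h4, h5, h2, h3, mul_add]
  map_smul' c u := by
    refine L2.ext fun j => ?_
    filter_upwards [memLp_mul_ae hg (c • u) j, memLp_mul_ae hg u j, L2.coeFn_smul_param c u j,
      L2.coeFn_smul_param c ((memLp_mul hg u).toLp _) j] with t h1 h2 h3 h4
    rw [h1, h3, RingHom.id_apply, h4, h2, mul_smul_comm]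

lemma exists_norm_mulLinear_le {g : Fin Γ.n → ℝ → Mat2} (hg : ∀ j, IsPerHolder (g j)) :
    ∃ C, ∀ u : Γ.L2, ‖mulLinear hg u‖ ≤ C * ‖u‖ := by
  obtain ⟨B, hB0, hB⟩ := exists_forall_norm_le hg
  refine ⟨B, fun u => Lp.norm_le_mul_norm_of_ae_le_mul (ae_arcLength_iff.2 fun j => ?_)⟩
  filter_upwards [memLp_mul_ae hg u j] with t ht
  change ‖(memLp_mul hg u).toLp _ (Γ.γ j t)‖ ≤ _
  rw [ht]
  exact (Matrix.frobenius_norm_mul _ _).trans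
    (mul_le_mul_of_nonneg_right (hB j t) (norm_nonneg _))

/-- Pointwise multiplication from the left by a Hölder function, as a bounded operator. -/
noncomputable def mulOp {g : Fin Γ.n → ℝ → Mat2} (hg : ∀ j, IsPerHolder (g j)) :
    Γ.L2 →L[ℂ] Γ.L2 :=
  LinearMap.mkContinuousOfExistsBound (mulLinear hg) (exists_norm_mulLinear_le hg)

lemma mulOp_ae {g : Fin Γ.n → ℝ → Mat2} (hg : ∀ j, IsPerHolder (g j)) (u : Γ.L2) (j : Fin Γ.n) :
    ∀ᵐ t : ℝ, mulOp hg u (Γ.γ j t) = g j t * u (Γ.γ j t) :=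
  memLp_mul_ae hg u j

end Multiplication

end ContourSystem

lemma IsPerHolder.smul_const {E : Type*} [NormedAddCommGroup E] [NormedSpace ℂ E] {c : ℝ → ℂ}
    (hc : IsPerHolder c) (x : E) : IsPerHolder fun t => c t • x := by
  obtain ⟨A, r, hr, hr1, h⟩ := hc
  refine ⟨A * ‖x‖, r, hr, hr1, fun t => by simp only [h.periodic t], fun t u hu => ?_⟩
  rw [← sub_smul, norm_smul, mul_right_comm]
  exact mul_le_mul_of_nonneg_right (h.bound t u hu) (norm_nonneg x)

lemma IsPerHolder₂.smul_const {E : Type*} [NormedAddCommGroup E] [NormedSpace ℂ E]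
    {k : ℝ → ℝ → ℂ} (hk : IsPerHolder₂ k) (x : E) : IsPerHolder₂ fun t s => k t s • x := by
  obtain ⟨A, r, hr, hr1, h⟩ := hk
  have key : ∀ {c : ℝ → ℂ}, PerHolder A r c → PerHolder (A * ‖x‖) r fun t => c t • x := by
    intro c h
    refine ⟨fun t => by simp only [h.periodic t], fun t u hu => ?_⟩
    rw [← sub_smul, norm_smul, mul_right_comm]
    exact mul_le_mul_of_nonneg_right (h.bound t u hu) (norm_nonneg x)
  exact ⟨_, r, hr, hr1, fun s => key (h.left s), fun t => key (h.right t)⟩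

namespace ContourSystem

variable {Γ : ContourSystem}

/-! ### Hölder-kernel operators on `L²(Γ)` -/

section KernelOperators

variable {k l : Fin Γ.n → Fin Γ.n → ℝ → ℝ → Mat2}

lemma isPerHolder_kernelSum (hk : ∀ i j, IsPerHolder₂ (k i j)) {v : Fin Γ.n → ℝ → Mat2}
    (hv : ∀ j, IntervalIntegrable (v j) volume 0 1) (i : Fin Γ.n) :
    IsPerHolder fun t => ∑ j, kernelIntegral (k i j) (v j) t := by
  have := IsPerHolder₂.sum Finset.univ (k := fun j t _ => kernelIntegral (k i j) (v j) t)
    fun j _ => ((hk i j).kernelIntegral (hv j)).of_left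
  exact this.left 0

/-- The image of `u` under an integral operator with Hölder kernel, as a Hölder family. -/
noncomputable def kernelFamily (hk : ∀ i j, IsPerHolder₂ (k i j)) (u : Γ.L2) : Γ.holderFamily :=
  ⟨fun i t => ∑ j, kernelIntegral (k i j) (fun s => u (Γ.γ j s)) t,
    isPerHolder_kernelSum hk (intervalIntegrable_comp_param u)⟩

lemma kernelFamily_congr (hk : ∀ i j, IsPerHolder₂ (k i j)) {u : Γ.L2} {v : Fin Γ.n → ℝ → Mat2}
    (h : ∀ j, ∀ᵐ s : ℝ, u (Γ.γ j s) = v j s) (i : Fin Γ.n) (t : ℝ) :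
    (kernelFamily hk u).1 i t = ∑ j, kernelIntegral (k i j) (v j) t := by
  change ∑ j, kernelIntegral (k i j) (fun s => u (Γ.γ j s)) t = _
  exact Finset.sum_congr rfl fun j _ => kernelIntegral_congr (h j) t

/-- The integral operator with a Hölder kernel, as a linear map on `L²(Γ)`. -/
noncomputable def kernelLinear (hk : ∀ i j, IsPerHolder₂ (k i j)) : Γ.L2 →ₗ[ℂ] Γ.L2 where
  toFun u := ofFamily (kernelFamily hk u)
  map_add' u v := by
    rw [← map_add]
    congr 1
    ext1
    funext i t
    rw [kernelFamily_congr hk fun j => L2.coeFn_add_param u v j]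
    refine Eq.trans ?_ Finset.sum_add_distrib
    refine Finset.sum_congr rfl fun j _ => ?_
    rw [kernelIntegral, kernelIntegral, kernelIntegral, ← intervalIntegral.integral_add
      ((hk i j).intervalIntegrable_mul (intervalIntegrable_comp_param u j) t)
      ((hk i j).intervalIntegrable_mul (intervalIntegrable_comp_param v j) t)]
    simp only [mul_add]
  map_smul' c u := by
    rw [RingHom.id_apply, ← map_smul]
    congr 1
    ext1
    funext i t
    rw [kernelFamily_congr hk fun j => L2.coeFn_smul_param c u j]
    change _ = c • ∑ j, kernelIntegral (k i j) (fun s => u (Γ.γ j s)) t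
    rw [Finset.smul_sum]
    refine Finset.sum_congr rfl fun j _ => ?_
    rw [kernelIntegral, kernelIntegral, ← intervalIntegral.integral_smul]
    simp only [mul_smul_comm]

/-- Uniform bounds for the image of the unit ball under an integral operator. -/
lemma exists_kernelFamily_bounds (hk : ∀ i j, IsPerHolder₂ (k i j)) :
    ∃ A B r : ℝ, 0 ≤ A ∧ 0 ≤ B ∧ 0 < r ∧ ∀ u : Γ.L2,
      (∀ i, PerHolder (A * ‖u‖) r ((kernelFamily hk u).1 i)) ∧
      ∀ i t, ‖(kernelFamily hk u).1 i t‖ ≤ B * ‖u‖ := by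
  obtain ⟨C, hC, hu⟩ := Γ.exists_integral_norm_le
  obtain ⟨A, r, hA, hr, hr1, h⟩ := exists_forall_perHolder₂
    (F := fun (p : Fin Γ.n × Fin Γ.n) => k p.1 p.2) fun p => hk p.1 p.2
  obtain ⟨B, hB, hkB⟩ := exists_forall_norm_le₂
    (F := fun (p : Fin Γ.n × Fin Γ.n) => k p.1 p.2) fun p => hk p.1 p.2
  have key : ∀ (u : Γ.L2) (K : Fin Γ.n → ℝ → ℝ → Mat2) (t D : ℝ), 0 ≤ D →
      (∀ j s, ‖K j t s‖ ≤ D) →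
      ‖∑ j, kernelIntegral (K j) (fun s => u (Γ.γ j s)) t‖ ≤ Γ.n * (D * (C * ‖u‖)) := by
    intro u K t D hD hK
    refine (norm_sum_le_of_le _ fun j _ => (norm_kernelIntegral_le (hu u j).1 (hK j)).trans
      (mul_le_mul_of_nonneg_left (hu u j).2 hD)).trans_eq ?_
    simp
  refine ⟨Γ.n * A * C, Γ.n * B * C, r, by positivity, by positivity, hr, fun u =>
    ⟨fun i => ⟨((kernelFamily hk u).2 i).periodic, fun t x hx => ?_⟩, fun i t => ?_⟩⟩
  · have e : (kernelFamily hk u).1 i (t + x) - (kernelFamily hk u).1 i t =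
        ∑ j, kernelIntegral (fun _ s => k i j (t + x) s - k i j t s)
          (fun s => u (Γ.γ j s)) t := by
      refine (Finset.sum_sub_distrib _ _).symm.trans (Finset.sum_congr rfl fun j _ => ?_)
      exact kernelIntegral_sub (hk i j) (hu u j).1 _ _
    rw [e]
    refine (key u (fun j _ s => k i j (t + x) s - k i j t s) t (A * |x| ^ r) (by positivity)
      fun j s => ((h (i, j)).left s).bound t x hx).trans_eq (by ring)
  · refine (key u (k i) t B hB fun j s => hkB (i, j) t s).trans_eq (by ring)

lemma ofFamily_norm_le {C : ℝ} (hC : ∀ (u : Γ.L2) (B : ℝ), 0 ≤ B →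
    (∀ j, ∀ᵐ t : ℝ, ‖u (Γ.γ j t)‖ ≤ B) → ‖u‖ ≤ C * B) (F : Γ.holderFamily) {B : ℝ} (hB : 0 ≤ B)
    (h : ∀ j t, ‖F.1 j t‖ ≤ B) : ‖ofFamily F‖ ≤ C * B := by
  refine hC _ B hB fun j => ?_
  filter_upwards [ofFamily_ae F j] with t ht
  rw [ht]
  exact h j t

lemma dist_ofFamily_le {C : ℝ} (hC : ∀ (u : Γ.L2) (B : ℝ), 0 ≤ B →
    (∀ j, ∀ᵐ t : ℝ, ‖u (Γ.γ j t)‖ ≤ B) → ‖u‖ ≤ C * B) {F G : Γ.holderFamily} {B : ℝ} (hB : 0 ≤ B)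
    (h : ∀ j t, ‖F.1 j t - G.1 j t‖ ≤ B) : dist (ofFamily F) (ofFamily G) ≤ C * B := by
  have h1 : dist (ofFamily F) (ofFamily G) = ‖ofFamily (F - G)‖ := by
    rw [dist_eq_norm, map_sub]
  rw [h1]
  exact ofFamily_norm_le hC _ hB h

lemma exists_norm_kernelLinear_le (hk : ∀ i j, IsPerHolder₂ (k i j)) :
    ∃ C, ∀ u : Γ.L2, ‖kernelLinear hk u‖ ≤ C * ‖u‖ := by
  obtain ⟨A, B, r, -, hB, -, h⟩ := exists_kernelFamily_bounds hk
  obtain ⟨C, hC0, hC⟩ := Γ.exists_norm_le_of_ae_bound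
  refine ⟨C * B, fun u => ?_⟩
  rw [mul_assoc]
  exact ofFamily_norm_le hC _ (by positivity) (h u).2

/-- The bounded operator on `L²(Γ)` with kernel `k`, with respect to the parameters. -/
noncomputable def kernelOp (hk : ∀ i j, IsPerHolder₂ (k i j)) : Γ.L2 →L[ℂ] Γ.L2 :=
  LinearMap.mkContinuousOfExistsBound (kernelLinear hk) (exists_norm_kernelLinear_le hk)

lemma kernelOp_apply (hk : ∀ i j, IsPerHolder₂ (k i j)) (u : Γ.L2) :
    kernelOp hk u = ofFamily (kernelFamily hk u) := rfl

lemma kernelOp_ae (hk : ∀ i j, IsPerHolder₂ (k i j)) (u : Γ.L2) (i : Fin Γ.n) :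
    ∀ᵐ t : ℝ, kernelOp hk u (Γ.γ i t) =
      ∑ j, kernelIntegral (k i j) (fun s => u (Γ.γ j s)) t :=
  ofFamily_ae _ i

/-- Bounded operators on `L²(Γ)` that are given by a Hölder kernel. -/
def IsKernelOp (K : Γ.L2 →L[ℂ] Γ.L2) : Prop :=
  ∃ (k : Fin Γ.n → Fin Γ.n → ℝ → ℝ → Mat2) (hk : ∀ i j, IsPerHolder₂ (k i j)), K = kernelOp hk

/-! ### Compactness by the Arzelà–Ascoli argument -/

variable (Γ) in
/-- A bounded and equicontinuous set of families of periodic functions. -/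
def equiSet (A B r : ℝ) : Set (Fin Γ.n → ℝ → Mat2) :=
  {F | (∀ j, Function.Periodic (F j) 1) ∧
    (∀ j t h, |h| ≤ 1 → ‖F j (t + h) - F j t‖ ≤ A * |h| ^ r) ∧ ∀ j t, ‖F j t‖ ≤ B}

lemma continuous_eval_family (j : Fin Γ.n) (t : ℝ) :
    Continuous fun F : Fin Γ.n → ℝ → Mat2 => F j t :=
  (continuous_apply t).comp (continuous_apply j)

/-- In the topology of pointwise convergence all the conditions are closed, and the set lies in a
product of closed balls of `Mat2`, compact by Tychonoff. -/
lemma isCompact_equiSet (A B r : ℝ) : IsCompact (Γ.equiSet A B r) := by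
  have hev := continuous_eval_family (Γ := Γ)
  have hclosed : IsClosed (Γ.equiSet A B r) := by
    have : Γ.equiSet A B r = (⋂ j, ⋂ t, {F | F j (t + 1) = F j t}) ∩
        ((⋂ j, ⋂ t, ⋂ h, ⋂ (_ : |h| ≤ 1), {F | ‖F j (t + h) - F j t‖ ≤ A * |h| ^ r}) ∩
          ⋂ j, ⋂ t, {F | ‖F j t‖ ≤ B}) := by
      ext F
      simp [equiSet, Function.Periodic]
    rw [this]
    refine (isClosed_iInter fun j => isClosed_iInter fun t => isClosed_eq (hev _ _) (hev _ _)).inter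
      ((isClosed_iInter fun j => isClosed_iInter fun t => isClosed_iInter fun h =>
        isClosed_iInter fun _ => isClosed_le ((hev _ _).sub (hev _ _)).norm continuous_const).inter
      (isClosed_iInter fun j => isClosed_iInter fun t =>
        isClosed_le (hev _ _).norm continuous_const))
  refine IsCompact.of_isClosed_subset (isCompact_univ_pi fun _ : Fin Γ.n =>
    isCompact_univ_pi fun _ : ℝ => isCompact_closedBall (0 : Mat2) B) hclosed ?_
  intro F hF j _ t _
  rw [mem_closedBall_zero_iff]
  exact hF.2.2 j t

lemma equiSet_subset_holderFamily {A B r : ℝ} (hr : 0 < r) {F : Fin Γ.n → ℝ → Mat2}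
    (hF : F ∈ Γ.equiSet A B r) : F ∈ Γ.holderFamily := fun j =>
  ⟨A, min r 1, lt_min hr one_pos, min_le_right _ _,
    (PerHolder.mk (hF.1 j) (hF.2.1 j)).mono le_rfl (lt_min hr one_pos) (min_le_left _ _)⟩

/-- On an equicontinuous set, pointwise convergence is uniform. -/
lemma eventually_norm_sub_le {A B r : ℝ} (hA : 0 ≤ A) (hr : 0 < r) (F₀ : Γ.equiSet A B r) {δ : ℝ}
    (hδ : 0 < δ) : ∀ᶠ F : Γ.equiSet A B r in 𝓝 F₀, ∀ j t, ‖F.1 j t - F₀.1 j t‖ ≤ 3 * δ := by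
  -- At scale `η` every member of the set oscillates by at most `δ`. On a finite `η`-net of `[0,1]`
  -- pointwise closeness gives another `δ`, and moving both functions to the net gives `3δ` in all.
  obtain ⟨η, hη, hη1, hηA⟩ : ∃ η, 0 < η ∧ η ≤ 1 ∧ A * η ^ r ≤ δ := by
    have hc : Tendsto (fun x : ℝ => A * x ^ r) (𝓝[>] 0) (𝓝 0) := by
      have h1 : Continuous fun x : ℝ => A * x ^ r :=
        continuous_const.mul (Real.continuous_rpow_const hr.le)
      have h2 := h1.tendsto 0
      rw [Real.zero_rpow hr.ne', mul_zero] at h2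
      exact h2.mono_left nhdsWithin_le_nhds
    have e1 := hc.eventually (Iic_mem_nhds hδ)
    have e2 : ∀ᶠ x : ℝ in 𝓝[>] 0, x ≤ 1 :=
      mem_nhdsWithin_of_mem_nhds (Iic_mem_nhds one_pos)
    obtain ⟨x, h1, h2, h3⟩ := (e1.and (e2.and self_mem_nhdsWithin)).exists
    exact ⟨x, h3, h2, h1⟩
  obtain ⟨P, -, hPf, hP⟩ := (isCompact_Icc (a := (0 : ℝ)) (b := 1)).finite_cover_balls hη
  have hnear : ∀ᶠ F : Γ.equiSet A B r in 𝓝 F₀, ∀ j, ∀ x ∈ P, ‖F.1 j x - F₀.1 j x‖ ≤ δ := by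
    rw [eventually_all]
    intro j
    rw [eventually_all_finite hPf]
    intro x _
    have hc : Continuous fun F : Γ.equiSet A B r => ‖F.1 j x - F₀.1 j x‖ :=
      (((continuous_eval_family j x).comp continuous_subtype_val).sub continuous_const).norm
    have h1 := hc.tendsto F₀
    rw [sub_self, norm_zero] at h1
    exact h1.eventually (Iic_mem_nhds hδ)
  filter_upwards [hnear] with F hF j t
  have hfr : ∀ F ∈ Γ.equiSet A B r, F j (Int.fract t) = F j t := by
    intro F hF
    have := (hF.1 j).sub_int_mul_eq (x := t) ⌊t⌋
    rwa [mul_one] at this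
  rw [← hfr _ F.2, ← hfr _ F₀.2]
  obtain ⟨x, hx, hxt⟩ := Set.mem_iUnion₂.1 (hP ⟨Int.fract_nonneg t, (Int.fract_lt_one t).le⟩)
  rw [Metric.mem_ball, Real.dist_eq] at hxt
  have hstep : ∀ F ∈ Γ.equiSet A B r, ‖F j (Int.fract t) - F j x‖ ≤ δ := by
    intro F hF
    have h1 := hF.2.1 j x (Int.fract t - x) (hxt.le.trans hη1)
    rw [add_sub_cancel] at h1
    refine h1.trans (le_trans ?_ hηA)
    gcongr
  have e : F.1 j (Int.fract t) - F₀.1 j (Int.fract t) =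
      (F.1 j (Int.fract t) - F.1 j x) + (F.1 j x - F₀.1 j x) -
        (F₀.1 j (Int.fract t) - F₀.1 j x) := by abel
  rw [e]
  refine (norm_sub_le _ _).trans ((add_le_add (norm_add_le _ _) le_rfl).trans ?_)
  linarith [hstep _ F.2, hstep _ F₀.2, hF j x hx]

/-- The inclusion of a bounded equicontinuous set into the Hölder families. -/
def equiFamily {A B r : ℝ} (hr : 0 < r) (F : Γ.equiSet A B r) : Γ.holderFamily :=
  ⟨F.1, equiSet_subset_holderFamily hr F.2⟩

/-- On this set pointwise convergence is uniform, hence convergence in `L²`. The image in `L²` of a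
compact set of families is therefore compact. -/
lemma continuous_ofFamily_equiSet {A : ℝ} (B : ℝ) {r : ℝ} (hA : 0 ≤ A) (hr : 0 < r) :
    Continuous fun F : Γ.equiSet A B r => ofFamily (equiFamily hr F) := by
  obtain ⟨C, hC0, hC⟩ := Γ.exists_norm_le_of_ae_bound
  refine continuous_iff_continuousAt.2 fun F₀ => Metric.tendsto_nhds.2 fun ε hε => ?_
  have hδ : 0 < ε / (3 * (C + 1)) := by positivity
  have h3 : C * (3 * (ε / (3 * (C + 1)))) < ε := by
    have : C * (3 * (ε / (3 * (C + 1)))) = ε * (C / (C + 1)) := by field_simp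
    rw [this]
    exact mul_lt_of_lt_one_right hε ((div_lt_one (by positivity)).2 (lt_add_one C))
  refine (eventually_norm_sub_le hA hr F₀ hδ).mono fun F hF => ?_
  exact (dist_ofFamily_le (F := equiFamily hr F) (G := equiFamily hr F₀) hC
    (mul_pos three_pos hδ).le hF).trans_lt h3

/-- An integral operator with Hölder kernel is compact, by the Arzelà–Ascoli argument. -/
lemma IsKernelOp.isCompactOperator {K : Γ.L2 →L[ℂ] Γ.L2} (hK : IsKernelOp K) :
    IsCompactOperator K := by
  obtain ⟨k, hk, rfl⟩ := hK
  obtain ⟨A, B, r, hA, hB, hr, hAB⟩ := exists_kernelFamily_bounds hk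
  have : CompactSpace (Γ.equiSet A B r) := isCompact_iff_compactSpace.1 (isCompact_equiSet A B r)
  -- The uniform bounds for the image of the unit ball place it in the compact image of `equiSet A B
  -- r`.
  refine ⟨_, _root_.isCompact_range (continuous_ofFamily_equiSet B hA hr),
    mem_of_superset (Metric.closedBall_mem_nhds 0 one_pos) fun u hu => ?_⟩
  have hu1 : ‖u‖ ≤ 1 := mem_closedBall_zero_iff.1 hu
  refine ⟨⟨(kernelFamily hk u).1, fun j => ((hAB u).1 j).periodic, fun j t h hh => ?_,
    fun j t => ((hAB u).2 j t).trans (mul_le_of_le_one_right hB hu1)⟩, rfl⟩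
  exact (((hAB u).1 j).bound t h hh).trans (mul_le_mul_of_nonneg_right
    (mul_le_of_le_one_right hA hu1) (Real.rpow_nonneg (abs_nonneg h) r))

/-- Since `dη = γ'(s) ds`, the kernel on the contour is the parameter kernel divided by `γ'(s)`,
which stays Hölder because `γ'` has no zeros. -/
lemma IsKernelOp.isRegularIntegralOperator {K : Γ.L2 →L[ℂ] Γ.L2} (hK : IsKernelOp K) :
    Γ.IsRegularIntegralOperator K := by
  obtain ⟨k, hk, rfl⟩ := hK
  have hinv : ∀ j, IsPerHolder fun t => (deriv (Γ.γ j) t)⁻¹ := fun j =>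
    IsPerHolder.of_contDiff (((contDiff_infty_iff_deriv.1 (Γ.smooth j)).2.inv
      (Γ.regular j)).of_le (by exact_mod_cast le_top))
      fun t => by rw [deriv_periodic (Γ.periodic j)]
  have hk' : ∀ i j, IsPerHolder₂ fun t s => (deriv (Γ.γ j) s)⁻¹ • k i j t s := by
    intro i j
    have := ((hinv j).smul_const (1 : Mat2)).of_right.mul (hk i j)
    simpa only [smul_mul_assoc, one_mul] using this
  refine ⟨fun ζ η => Γ.lift (fun i t => Γ.lift (fun j s => (deriv (Γ.γ j) s)⁻¹ • k i j t s) η) ζ,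
    isHolderOn_lift₂ hk', fun u => ae_arcLength_iff.2 fun i => ?_⟩
  filter_upwards [kernelOp_ae hk u i] with t ht
  rw [ht]
  have hin : ∀ j s i t, Γ.lift (fun j s => (deriv (Γ.γ j) s)⁻¹ • k i j t s) (Γ.γ j s) =
      (deriv (Γ.γ j) s)⁻¹ • k i j t s := fun j s i t =>
    lift_apply (fun j => ((hk' i j).right t).periodic) j s
  refine Finset.sum_congr rfl fun j _ => ?_
  refine intervalIntegral.integral_congr fun s _ => ?_
  beta_reduce
  simp only [hin]
  rw [lift_apply fun i => ((hk' i j).left s).periodic, smul_mul_assoc,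
    smul_inv_smul₀ (Γ.regular j s)]

/-! ### Stability of the class of Hölder-kernel operators -/

lemma IsKernelOp.add {K L : Γ.L2 →L[ℂ] Γ.L2} (hK : IsKernelOp K) (hL : IsKernelOp L) :
    IsKernelOp (K + L) := by
  obtain ⟨k, hk, rfl⟩ := hK
  obtain ⟨l, hl, rfl⟩ := hL
  refine ⟨fun i j t s => k i j t s + l i j t s, fun i j => (hk i j).add (hl i j), ?_⟩
  ext1 u
  rw [add_apply, kernelOp_apply, kernelOp_apply, kernelOp_apply, ← map_add]
  congr 1
  ext1
  funext i t
  refine (Finset.sum_add_distrib).symm.trans (Finset.sum_congr rfl fun j _ => ?_)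
  rw [kernelIntegral, kernelIntegral, kernelIntegral, ← intervalIntegral.integral_add
    ((hk i j).intervalIntegrable_mul (intervalIntegrable_comp_param u j) t)
    ((hl i j).intervalIntegrable_mul (intervalIntegrable_comp_param u j) t)]
  simp only [add_mul]

lemma IsKernelOp.comp {K L : Γ.L2 →L[ℂ] Γ.L2} (hK : IsKernelOp K) (hL : IsKernelOp L) :
    IsKernelOp (K ∘L L) := by
  obtain ⟨k, hk, rfl⟩ := hK
  obtain ⟨l, hl, rfl⟩ := hL
  have hm : ∀ i j, IsPerHolder₂ fun t s => ∑ m, kernelComp (k i m) (l m j) t s := fun i j =>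
    IsPerHolder₂.sum _ fun m _ => (hk i m).comp (hl m j)
  refine ⟨_, hm, ?_⟩
  ext1 u
  rw [ContinuousLinearMap.comp_apply, kernelOp_apply, kernelOp_apply hm]
  congr 1
  ext1
  funext i t
  rw [kernelFamily_congr hk (kernelOp_ae hl u)]
  have hu := intervalIntegrable_comp_param u
  have h1 : ∀ m, kernelIntegral (k i m)
      (fun s => ∑ j, kernelIntegral (l m j) (fun s => u (Γ.γ j s)) s) t =
      ∑ j, kernelIntegral (kernelComp (k i m) (l m j)) (fun s => u (Γ.γ j s)) t := by
    intro m
    simp only [← kernelIntegral_kernelIntegral (hk i m) (hl m _) (hu _)]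
    rw [kernelIntegral]
    simp only [Finset.mul_sum]
    rw [intervalIntegral.integral_finsetSum fun j _ => (hk i m).intervalIntegrable_mul
      (((hl m j).kernelIntegral (hu j)).continuous.intervalIntegrable _ _) t]
    rfl
  have h2 : ∀ j, kernelIntegral (fun t s => ∑ m, kernelComp (k i m) (l m j) t s)
      (fun s => u (Γ.γ j s)) t =
      ∑ m, kernelIntegral (kernelComp (k i m) (l m j)) (fun s => u (Γ.γ j s)) t := by
    intro j
    rw [kernelIntegral]
    simp only [Finset.sum_mul]
    rw [intervalIntegral.integral_finsetSum fun m _ =>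
      ((hk i m).comp (hl m j)).intervalIntegrable_mul (hu j) t]
    rfl
  simp only [h1]
  rw [Finset.sum_comm]
  exact Finset.sum_congr rfl fun j _ => (h2 j).symm

/-- By the Privalov bound the singular operator, applied in the first variable of the kernel, only
halves the exponent. -/
lemma IsKernelOp.circleOp_comp {K : Γ.L2 →L[ℂ] Γ.L2} (hK : IsKernelOp K) :
    IsKernelOp (Γ.circleOp ∘L K) := by
  obtain ⟨k, hk, rfl⟩ := hK
  have hκ := isCauchyType_circKernel
  have hm := fun i j => (hk i j).singConv_left hκ
  refine ⟨_, hm, ?_⟩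
  ext1 u
  have hu := intervalIntegrable_comp_param u
  rw [ContinuousLinearMap.comp_apply, kernelOp_apply, kernelOp_apply hm, circleOp_ofFamily]
  congr 1
  ext1
  funext i t
  change singConv circKernel (fun t => ∑ j, kernelIntegral (k i j) (fun s => u (Γ.γ j s)) t) t =
    ∑ j, kernelIntegral (fun t s => singConv circKernel (fun t => k i j t s) t)
      (fun s => u (Γ.γ j s)) t
  simp only [← singConv_kernelIntegral hκ (hk i _) (hu _)]
  simp only [singConv]
  rw [← intervalIntegral.integral_finsetSum fun j _ =>
    ((hk i j).kernelIntegral (hu j)).intervalIntegrable_singConv hκ t]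
  simp only [← Finset.smul_sum, Finset.sum_sub_distrib]

/-- The transpose moves the reflected kernel to the second variable. That formula needs Hölder
densities, so the identity is checked there and extended by density. -/
lemma IsKernelOp.comp_circleOp {K : Γ.L2 →L[ℂ] Γ.L2} (hK : IsKernelOp K) :
    IsKernelOp (K ∘L Γ.circleOp) := by
  obtain ⟨k, hk, rfl⟩ := hK
  have hκ := isCauchyType_circKernel
  have hm := fun i j => (hk i j).singConv_right hκ.comp_neg
  refine ⟨_, hm, clm_ext fun F => ?_⟩
  rw [ContinuousLinearMap.comp_apply, circleOp_ofFamily, kernelOp_apply, kernelOp_apply hm]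
  congr 1
  ext1
  funext i t
  rw [kernelFamily_congr hk (ofFamily_ae _), kernelFamily_congr hm (ofFamily_ae _)]
  exact Finset.sum_congr rfl fun j _ => kernelIntegral_singConv hκ (hk i j) (F.2 j) t

variable {g : Fin Γ.n → ℝ → Mat2}

lemma IsKernelOp.mulOp_comp {K : Γ.L2 →L[ℂ] Γ.L2} (hK : IsKernelOp K)
    (hg : ∀ j, IsPerHolder (g j)) : IsKernelOp (mulOp hg ∘L K) := by
  obtain ⟨k, hk, rfl⟩ := hK
  have hm := fun i j => (hg i).of_left.mul (hk i j)
  refine ⟨_, hm, ?_⟩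
  ext1 u
  have hu := intervalIntegrable_comp_param u
  refine L2.ext fun i => ?_
  filter_upwards [mulOp_ae hg (kernelOp hk u) i, kernelOp_ae hk u i, kernelOp_ae hm u i]
    with t h1 h2 h3
  rw [ContinuousLinearMap.comp_apply, h1, h2, h3, Finset.mul_sum]
  refine Finset.sum_congr rfl fun j _ => ?_
  rw [kernelIntegral, kernelIntegral,
    ← intervalIntegral_const_mul' _ ((hk i j).intervalIntegrable_mul (hu j) t)]
  simp only [mul_assoc]

lemma IsKernelOp.comp_mulOp {K : Γ.L2 →L[ℂ] Γ.L2} (hK : IsKernelOp K)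
    (hg : ∀ j, IsPerHolder (g j)) : IsKernelOp (K ∘L mulOp hg) := by
  obtain ⟨k, hk, rfl⟩ := hK
  have hm := fun i j => (hk i j).mul (hg j).of_right
  refine ⟨_, hm, ?_⟩
  ext1 u
  rw [ContinuousLinearMap.comp_apply, kernelOp_apply, kernelOp_apply hm]
  congr 1
  ext1
  funext i t
  rw [kernelFamily_congr hk (mulOp_ae hg u)]
  refine Finset.sum_congr rfl fun j _ => ?_
  simp only [kernelIntegral, mul_assoc]

lemma mulOp_ofFamily (hg : ∀ j, IsPerHolder (g j)) (F : Γ.holderFamily) :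
    mulOp hg (ofFamily F) = ofFamily ⟨fun j t => g j t * F.1 j t, fun j => (hg j).mul (F.2 j)⟩ := by
  refine (ofFamily_eq fun j => ?_).symm
  filter_upwards [mulOp_ae hg (ofFamily F) j, ofFamily_ae F j] with t h1 h2
  rw [h1, h2]

/-- Commutators of the circle projections with smooth functions are regular. -/
lemma isKernelOp_commutator (hg : ∀ j, IsPerHolder (g j)) (hs : ∀ j, ContDiff ℝ ∞ (g j)) :
    IsKernelOp (Γ.circleOp ∘L mulOp hg - mulOp hg ∘L Γ.circleOp) := by
  classical
  have hm : ∀ i j, IsPerHolder₂ (if i = j then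
      fun t s => circ s • circQuotient (g j) s t else fun _ _ => 0) := by
    intro i j
    split_ifs with h
    · exact isPerHolder₂_commutator (hs j) (hg j).periodic
    · exact IsPerHolder₂.zero
  refine ⟨_, hm, clm_ext fun F => ?_⟩
  rw [sub_apply, ContinuousLinearMap.comp_apply,
    ContinuousLinearMap.comp_apply, mulOp_ofFamily, circleOp_ofFamily, circleOp_ofFamily,
    mulOp_ofFamily, ← map_sub, kernelOp_apply]
  congr 1
  ext1
  funext i t
  rw [kernelFamily_congr hm (ofFamily_ae _)]
  refine (singConv_mul_sub (hs i) (hg i).periodic (F.2 i) t).trans ?_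
  rw [Finset.sum_eq_single i]
  · rw [if_pos rfl]
  · intro j _ hj
    rw [if_neg hj.symm]
    simp [kernelIntegral]
  · simp

end KernelOperators

end ContourSystem

namespace ContourSystem

variable {Γ : ContourSystem}

/-! ### The Cauchy kernel of the whole contour near a point -/

section CauchyKernel

lemma sub_ne_zero_of_ne {i j : Fin Γ.n} (h : i ≠ j) (t s : ℝ) : Γ.γ j s - Γ.γ i t ≠ 0 :=
  sub_ne_zero.2 fun e => h (Γ.eq_iff.1 e).1.symm

variable (Γ) in
/-- The Cauchy kernel is that of the circle on each curve, up to regular terms. -/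
lemma exists_regular_part : ∃ D : Fin Γ.n → Fin Γ.n → ℝ → ℝ → ℂ, (∀ i j, IsPerHolder₂ (D i j)) ∧
    (∀ i t s, circ s ≠ circ t → deriv (Γ.γ i) s / (Γ.γ i s - Γ.γ i t) =
      deriv circ s / (circ s - circ t) + D i i t s) ∧
    ∀ i j, i ≠ j → ∀ t s, D i j t s = deriv (Γ.γ j) s / (Γ.γ j s - Γ.γ i t) := by
  have h : ∀ i j, ∃ D : ℝ → ℝ → ℂ, IsPerHolder₂ D ∧ (i = j → ∀ t s, circ s ≠ circ t →
      deriv (Γ.γ i) s / (Γ.γ i s - Γ.γ i t) = deriv circ s / (circ s - circ t) + D t s) ∧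
      (i ≠ j → ∀ t s, D t s = deriv (Γ.γ j) s / (Γ.γ j s - Γ.γ i t)) := by
    intro i j
    by_cases hij : i = j
    · obtain ⟨D, hD, h⟩ := (Γ.curve i).exists_cauchyKernel_eq
      exact ⟨D, hD, fun _ => h, fun hne => absurd hij hne⟩
    -- Distinct curves are disjoint, so the denominator has no zeros and the whole kernel is
    -- regular.
    · refine ⟨fun t s => deriv (Γ.γ j) s / (Γ.γ j s - Γ.γ i t), ?_, fun e => absurd e hij,
        fun _ _ _ => rfl⟩
      refine IsPerHolder₂.of_contDiff ?_ (fun t s => by rw [Γ.periodic])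
        fun t s => by rw [Γ.periodic, deriv_periodic (Γ.periodic j)]
      have h1 : ContDiff ℝ ∞ fun p : ℝ × ℝ => deriv (Γ.γ j) p.2 :=
        (contDiff_infty_iff_deriv.1 (Γ.smooth j)).2.comp contDiff_snd
      have h2 : ContDiff ℝ ∞ fun p : ℝ × ℝ => Γ.γ j p.2 - Γ.γ i p.1 :=
        ((Γ.smooth j).comp contDiff_snd).sub ((Γ.smooth i).comp contDiff_fst)
      simp only [Function.uncurry_def, div_eq_mul_inv]
      refine (h1.mul (h2.inv fun p => sub_ne_zero_of_ne hij p.1 p.2)).of_le ?_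
      exact_mod_cast le_top
  choose D h1 h2 h3 using h
  exact ⟨D, h1, fun i => h2 i i rfl, h3⟩

/-- Dividing by `γ'(t)` turns the tangent into the real axis and the right side into the lower
half-plane. It is multiplication by the conjugate of `γ'(t)` and by `‖γ'(t)‖⁻²`, so the aperture `c`
is preserved. -/
lemma tendsto_chart (i : Fin Γ.n) (t c : ℝ) :
    Tendsto (fun z => (z - Γ.γ i t) / deriv (Γ.γ i) t) (𝓝[Γ.rightSector i t c] (Γ.γ i t))
      (𝓝[lowerSector c] 0) := by
  refine tendsto_nhdsWithin_iff.2 ⟨?_, ?_⟩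
  · have h : Continuous fun z => (z - Γ.γ i t) / deriv (Γ.γ i) t := by fun_prop
    have h1 := h.tendsto (Γ.γ i t)
    rw [sub_self, zero_div] at h1
    exact h1.mono_left nhdsWithin_le_nhds
  · filter_upwards [self_mem_nhdsWithin] with z hz
    have hz' : ((z - Γ.γ i t) * (starRingEnd ℂ) (deriv (Γ.γ i) t)).im
      < -(c * (‖z - Γ.γ i t‖ * ‖deriv (Γ.γ i) t‖)) := hz
    have hd : 0 < ‖deriv (Γ.γ i) t‖ := norm_pos_iff.2 (Γ.regular i t)
    change ((z - Γ.γ i t) / deriv (Γ.γ i) t).im < -(c * ‖(z - Γ.γ i t) / deriv (Γ.γ i) t‖)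
    have e : (z - Γ.γ i t) / deriv (Γ.γ i) t =
        ((z - Γ.γ i t) * (starRingEnd ℂ) (deriv (Γ.γ i) t)) *
          (((‖deriv (Γ.γ i) t‖ ^ 2)⁻¹ : ℝ) : ℂ) := by
      have h1 := Γ.regular i t
      have h2 := Complex.mul_conj' (deriv (Γ.γ i) t)
      have h3 : (starRingEnd ℂ) (deriv (Γ.γ i) t) ≠ 0 := by simpa using h1
      push_cast
      rw [← h2]
      field_simp
    rw [e, Complex.im_mul_ofReal, ← e, norm_div]
    have h4 := mul_lt_mul_of_pos_right hz' (inv_pos.2 (pow_pos hd 2))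
    refine h4.trans_eq ?_
    field_simp

lemma tendsto_integral_off_diagonal {i j : Fin Γ.n} (hij : i ≠ j) {f : ℝ → Mat2}
    (hf : Continuous f) (t : ℝ) :
    Tendsto (fun z => ∫ s in (0 : ℝ)..1, (deriv (Γ.γ j) s / (Γ.γ j s - z)) • f s)
      (𝓝 (Γ.γ i t))
      (𝓝 (∫ s in (0 : ℝ)..1, (deriv (Γ.γ j) s / (Γ.γ j s - Γ.γ i t)) • f s)) := by
  obtain ⟨c, hc, hsep, -⟩ := Γ.exists_separation
  have hγ := (Γ.curve j).continuous
  have hγd := (Γ.curve j).continuous_deriv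
  have hfar : ∀ᶠ z in 𝓝 (Γ.γ i t), ∀ s, c / 2 ≤ ‖Γ.γ j s - z‖ := by
    filter_upwards [Metric.ball_mem_nhds (Γ.γ i t) (half_pos hc)] with z hz s
    rw [mem_ball_iff_norm] at hz
    have h1 := hsep j i hij.symm s t
    have h2 := norm_sub_le_norm_sub_add_norm_sub (Γ.γ j s) z (Γ.γ i t)
    linarith
  refine intervalIntegral.tendsto_integral_filter_of_dominated_convergence
    (fun s => ‖deriv (Γ.γ j) s‖ * (c / 2)⁻¹ * ‖f s‖) ?_ ?_ ?_ ?_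
  · filter_upwards [hfar] with z hz
    have hne : ∀ s, Γ.γ j s - z ≠ 0 := fun s => norm_pos_iff.1 ((half_pos hc).trans_le (hz s))
    exact ((hγd.div (hγ.sub continuous_const) hne).smul hf).aestronglyMeasurable
  · filter_upwards [hfar] with z hz
    refine ae_of_all _ fun s _ => ?_
    rw [norm_smul, norm_div, div_eq_mul_inv]
    gcongr
    exact hz s
  · exact Continuous.intervalIntegrable (by fun_prop) _ _
  · refine ae_of_all _ fun s _ => ?_
    refine Tendsto.smul_const ?_ _
    exact tendsto_const_nhds.div (tendsto_const_nhds.sub tendsto_id) (sub_ne_zero_of_ne hij t s)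

end CauchyKernel

/-! ### Existence and uniqueness of `C_-` -/

section CauchyMinus

/-- The points `γ t - iεγ'(t)` on the right normal lie in the sector. An aperture below 1 is
essential: for `c ≥ 1` the sector is empty and the limit condition says nothing. -/
lemma neBot_rightSector (i : Fin Γ.n) (t : ℝ) :
    (𝓝[Γ.rightSector i t (1 / 2)] (Γ.γ i t)).NeBot := by
  refine mem_closure_iff_nhdsWithin_neBot.1 ?_
  have hc : Continuous fun ε : ℝ => Γ.γ i t - Complex.I * ε * deriv (Γ.γ i) t := by fun_prop
  have h1 := (hc.tendsto 0).mono_left (nhdsWithin_le_nhds (s := Set.Ioi 0))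
  rw [Complex.ofReal_zero, mul_zero, zero_mul, sub_zero] at h1
  refine mem_closure_of_tendsto h1 ?_
  filter_upwards [self_mem_nhdsWithin] with ε hε
  have hε : 0 < ε := hε
  have hd : 0 < ‖deriv (Γ.γ i) t‖ := norm_pos_iff.2 (Γ.regular i t)
  have e : (Γ.γ i t - Complex.I * ε * deriv (Γ.γ i) t - Γ.γ i t) *
      (starRingEnd ℂ) (deriv (Γ.γ i) t) = Complex.I * ((-(ε * ‖deriv (Γ.γ i) t‖ ^ 2) : ℝ) : ℂ) := by
    push_cast
    rw [← Complex.mul_conj' (deriv (Γ.γ i) t)]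
    ring
  change ((Γ.γ i t - Complex.I * ε * deriv (Γ.γ i) t - Γ.γ i t) *
      (starRingEnd ℂ) (deriv (Γ.γ i) t)).im < -(1 / 2 * (‖Γ.γ i t -
        Complex.I * ε * deriv (Γ.γ i) t - Γ.γ i t‖ * ‖deriv (Γ.γ i) t‖))
  rw [e, Complex.I_mul_im, Complex.ofReal_re, sub_sub_cancel_left, norm_neg, norm_mul, norm_mul,
    Complex.norm_I, Complex.norm_real, Real.norm_of_nonneg hε.le]
  have : 0 < ε * ‖deriv (Γ.γ i) t‖ ^ 2 := by positivity
  linarith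

lemma HasRightLimit.unique {F : ℂ → Mat2} {i : Fin Γ.n} {t : ℝ} {L L' : Mat2}
    (h : Γ.HasRightLimit F i t L) (h' : Γ.HasRightLimit F i t L') : L = L' := by
  have := neBot_rightSector i t
  exact tendsto_nhds_unique (h (1 / 2) one_half_pos) (h' (1 / 2) one_half_pos)

/-- Both operators are determined on Hölder densities by the uniqueness of nontangential limits, and
these densities are dense. -/
lemma IsCauchyMinus.unique {C C' : Γ.L2 →L[ℂ] Γ.L2} (h : Γ.IsCauchyMinus C)
    (h' : Γ.IsCauchyMinus C') : C = C' := by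
  refine clm_ext fun F => ?_
  have hF := Γ.isHolderOn_lift F.2
  have hu : ofFamily F =ᵐ[Γ.arcLength] Γ.lift F.1 := (memLp_lift F.2).coeFn_toLp
  refine Lp.ext ?_
  filter_upwards [h _ hF _ hu, h' _ hF _ hu, ae_mem_carrier] with ζ h1 h2 hζ
  obtain ⟨j, t, hjt⟩ := Set.mem_iUnion.1 hζ
  exact (h1 j t hjt).unique (h2 j t hjt)

variable (Γ) in
/-- The regular part of `C_-`, with respect to the parameters. -/
noncomputable def regularKernel (i j : Fin Γ.n) (t s : ℝ) : Mat2 :=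
  ((2 * (Real.pi : ℂ) * Complex.I)⁻¹ * Γ.exists_regular_part.choose i j t s) • (1 : Mat2)

lemma isPerHolder₂_regularKernel (i j : Fin Γ.n) : IsPerHolder₂ (Γ.regularKernel i j) :=
  (((IsPerHolder.const (2 * (Real.pi : ℂ) * Complex.I)⁻¹).of_left.mul
    (Γ.exists_regular_part.choose_spec.1 i j)).smul_const 1)

/-- The Plemelj formula. -/
lemma hasRightLimit_cauchy {f : ℂ → Mat2} (hf : IsHolderOn f Γ.carrier) (i : Fin Γ.n) (t : ℝ) :
    Γ.HasRightLimit (Γ.cauchy f) i t (singConv circKernel (fun s => f (Γ.γ i s)) t +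
      ∑ j, kernelIntegral (Γ.regularKernel i j) (fun s => f (Γ.γ j s)) t) := by
  intro c hc
  have hD := Γ.exists_regular_part.choose_spec
  set D := Γ.exists_regular_part.choose
  obtain ⟨hDc, hDd, hDo⟩ := hD
  have hfγ := isPerHolder_comp hf
  set a : ℂ := 2 * (Real.pi : ℂ) * Complex.I
  have ha : a ≠ 0 := Complex.two_pi_I_ne_zero
  have hj : ∀ j, Tendsto
      (fun z => ∫ s in (0 : ℝ)..1, (deriv (Γ.γ j) s / (Γ.γ j s - z)) • f (Γ.γ j s))
      (𝓝[Γ.rightSector i t c] (Γ.γ i t))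
      (𝓝 ((if j = i then a • singConv circKernel (fun s => f (Γ.γ i s)) t else 0) +
        ∫ s in (0 : ℝ)..1, D i j t s • f (Γ.γ j s))) := by
    intro j
    by_cases hij : i = j
    · subst hij
      rw [if_pos rfl]
      refine (((Γ.curve i).tendsto_integral_cauchy (hDc i i) (hDd i) (hfγ i) t hc).comp
        (tendsto_chart i t c)).congr fun z => ?_
      simp only [Function.comp_apply, mul_div_cancel₀ _ (Γ.regular i t), add_sub_cancel]
    · rw [if_neg (Ne.symm hij), zero_add]
      simp only [hDo i j hij]
      exact (tendsto_integral_off_diagonal hij (hfγ j).continuous t).mono_left nhdsWithin_le_nhds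
  have hsum := (tendsto_finsetSum Finset.univ fun j _ => hj j).const_smul a⁻¹
  have e : a⁻¹ • ∑ j, ((if j = i then a • singConv circKernel (fun s => f (Γ.γ i s)) t else 0) +
        ∫ s in (0 : ℝ)..1, D i j t s • f (Γ.γ j s)) =
      singConv circKernel (fun s => f (Γ.γ i s)) t +
        ∑ j, kernelIntegral (Γ.regularKernel i j) (fun s => f (Γ.γ j s)) t := by
    rw [Finset.sum_add_distrib, Finset.sum_ite_eq' Finset.univ i, if_pos (Finset.mem_univ i),
      smul_add, inv_smul_smul₀ ha, Finset.smul_sum]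
    congr 1
    refine Finset.sum_congr rfl fun j _ => ?_
    rw [kernelIntegral, ← intervalIntegral.integral_smul]
    refine intervalIntegral.integral_congr fun s _ => ?_
    simp only [regularKernel, smul_mul_assoc, one_mul, mul_smul]
    rfl
  rw [e] at hsum
  refine hsum.congr fun z => ?_
  change _ = a⁻¹ • ∑ j, ∫ s in (0 : ℝ)..1, deriv (Γ.γ j) s • ((Γ.γ j s - z)⁻¹ • f (Γ.γ j s))
  simp only [smul_smul, div_eq_mul_inv]

variable (Γ) in
/-- The operator `C_-`. -/
noncomputable def cauchyMinus : Γ.L2 →L[ℂ] Γ.L2 :=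
  Γ.circleOp + kernelOp isPerHolder₂_regularKernel

variable (Γ) in
lemma isCauchyMinus_cauchyMinus : Γ.IsCauchyMinus Γ.cauchyMinus := by
  intro f hf u hu
  have hfγ := isPerHolder_comp hf
  have hu' := ae_arcLength_iff.1 hu
  let F : Γ.holderFamily := ⟨fun j t => f (Γ.γ j t), hfγ⟩
  have hFu : ofFamily F = u := ofFamily_eq hu'
  let W : Γ.holderFamily := singFamily F + kernelFamily isPerHolder₂_regularKernel u
  have hCu : Γ.cauchyMinus u = ofFamily W := by
    rw [cauchyMinus, add_apply, kernelOp_apply, map_add, ← circleOp_ofFamily, hFu]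
  have hW : ∀ j t, Γ.HasRightLimit (Γ.cauchy f) j t (W.1 j t) := by
    intro j t
    have h1 := hasRightLimit_cauchy hf j t
    rw [← kernelFamily_congr isPerHolder₂_regularKernel hu'] at h1
    exact h1
  refine ae_arcLength_iff.2 fun i => ?_
  rw [hCu]
  filter_upwards [ofFamily_ae W i] with s hs j t hjt
  -- The limit is required at every pair `(j, t)` over the same point; such pairs differ from `(i,
  -- s)` by an integer shift.
  have h1 : W.1 j t = W.1 i s := by
    obtain ⟨rfl, n, rfl⟩ := Γ.eq_iff.1 hjt
    have := (W.2 j).periodic.int_mul n s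
    rwa [mul_one] at this
  rw [hs, ← h1]
  exact hW j t

end CauchyMinus

/-! ### The regulator identity -/

section Regulator

variable {G : ℂ → GL (Fin 2) ℂ}

lemma ContinuesAnalytically.contDiff (hG : Γ.ContinuesAnalytically G) (j : Fin Γ.n) :
    ContDiff ℝ ∞ fun t => (G (Γ.γ j t) : Mat2) := by
  obtain ⟨U, F, -, hU, hF, hFG⟩ := hG
  have : (fun t => (G (Γ.γ j t) : Mat2)) = fun t => F (Γ.γ j t) :=
    funext fun t => (hFG _ (Γ.mem_carrier j t)).symm
  rw [this]
  refine contDiff_iff_contDiffAt.2 fun t => ?_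
  exact ((hF _ (hU (Γ.mem_carrier j t))).contDiffAt.restrict_scalars ℝ).comp t
    (Γ.smooth j).contDiffAt

/-- Inversion in the matrix ring is smooth at units, so no analytic continuation of the inverse has
to be constructed. -/
lemma ContinuesAnalytically.contDiff_inv (hG : Γ.ContinuesAnalytically G) (j : Fin Γ.n) :
    ContDiff ℝ ∞ fun t => ((G⁻¹) (Γ.γ j t) : Mat2) := by
  have : (fun t => ((G⁻¹) (Γ.γ j t) : Mat2)) = fun t => Ring.inverse (G (Γ.γ j t) : Mat2) :=
    funext fun t => (Ring.inverse_unit _).symm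
  rw [this]
  refine contDiff_iff_contDiffAt.2 fun t => ?_
  exact (contDiffAt_ringInverse ℝ (G (Γ.γ j t))).comp t (hG.contDiff j).contDiffAt

lemma IsKernelOp.neg {K : Γ.L2 →L[ℂ] Γ.L2} (hK : IsKernelOp K) : IsKernelOp (-K) := by
  have h := hK.mulOp_comp (g := fun _ _ => -1) fun _ => IsPerHolder.const (-1)
  convert h using 1
  ext1 u
  refine L2.ext fun j => ?_
  filter_upwards [mulOp_ae (Γ := Γ) (g := fun _ _ => -1) (fun _ => IsPerHolder.const (-1)) (K u) j,
    ae_arcLength_iff.1 (Lp.coeFn_neg (K u)) j] with t h1 h2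
  rw [ContinuousLinearMap.comp_apply, h1, neg_apply, h2, Pi.neg_apply, neg_one_mul]

/-- Writing `C = A + D`, the sum is `(A² + A) + AD + DA + D² + D`, and the singular part `A² + A`
vanishes. -/
lemma isKernelOp_cauchyMinus_sq_add :
    IsKernelOp (Γ.cauchyMinus * Γ.cauchyMinus + Γ.cauchyMinus) := by
  have hD : IsKernelOp (kernelOp (isPerHolder₂_regularKernel (Γ := Γ))) := ⟨_, _, rfl⟩
  have h := ((hD.circleOp_comp.add hD.comp_circleOp).add (hD.comp hD)).add hD
  convert h using 1
  have hA : Γ.circleOp * Γ.circleOp = -Γ.circleOp := circleOp_circleOp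
  change _ = Γ.circleOp * _ + _ * Γ.circleOp + _ * _ + _
  rw [cauchyMinus, add_mul, mul_add, mul_add, hA]
  abel

/-- The singular part contributes `[A, g]`, regular by smoothness of `g`. Both terms of `[D, g]` are
regular by themselves. -/
lemma isKernelOp_cauchyMinus_commutator {g : Fin Γ.n → ℝ → Mat2} (hg : ∀ j, IsPerHolder (g j))
    (hs : ∀ j, ContDiff ℝ ∞ (g j)) :
    IsKernelOp (Γ.cauchyMinus * mulOp hg - mulOp hg * Γ.cauchyMinus) := by
  have hD : IsKernelOp (kernelOp (isPerHolder₂_regularKernel (Γ := Γ))) := ⟨_, _, rfl⟩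
  have h := ((isKernelOp_commutator hg hs).add (hD.comp_mulOp hg)).add (hD.mulOp_comp hg).neg
  convert h using 1
  change _ = Γ.circleOp * _ - _ * Γ.circleOp + _ * _ + -(_ * _)
  rw [cauchyMinus, add_mul, mul_add]
  abel

lemma IsKernelOp.comp_cauchyMinus {K : Γ.L2 →L[ℂ] Γ.L2} (hK : IsKernelOp K) :
    IsKernelOp (K * Γ.cauchyMinus) := by
  have hD : IsKernelOp (kernelOp (isPerHolder₂_regularKernel (Γ := Γ))) := ⟨_, _, rfl⟩
  convert hK.comp_circleOp.add (hK.comp hD) using 1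
  change _ = K * Γ.circleOp + K * _
  rw [cauchyMinus, mul_add]

lemma isSingularOperator_mulOp {C : Γ.L2 →L[ℂ] Γ.L2}
    (hg : ∀ j, IsPerHolder fun t => (G (Γ.γ j t) : Mat2) - 1) :
    Γ.IsSingularOperator C G (1 - mulOp hg * C) := by
  intro u
  refine ae_arcLength_iff.2 fun j => ?_
  filter_upwards [mulOp_ae hg (C u) j, ae_arcLength_iff.1 (Lp.coeFn_sub u (mulOp hg (C u))) j]
    with t h1 h2
  change (u - mulOp hg (C u)) (Γ.γ j t) = _
  rw [h2, Pi.sub_apply, h1]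

/-- Expanding, `QCPC = Q[C,P]C + QPC²`, and the linear terms `-(P + Q)C` equal `QPC` by hypothesis.
-/
lemma regulator_identity {R : Type*} [Ring R] {C P Q : R} (h : Q * P = -P - Q) :
    (1 - Q * C) * (1 - P * C) =
      1 + (Q * (C * P - P * C) * C + (Q * P) * (C * C + C)) := by
  have : Q * P * (C * C + C) = Q * P * C * C + (-P - Q) * C := by
    rw [mul_add, ← h]
    noncomm_ring
  rw [this]
  noncomm_ring

/-- Pointwise, `(G⁻¹ - 1)(G - 1) = 2 - G - G⁻¹`. -/
lemma mulOp_mul_mulOp (hg : ∀ j, IsPerHolder fun t => (G (Γ.γ j t) : Mat2) - 1)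
    (hg' : ∀ j, IsPerHolder fun t => ((G⁻¹) (Γ.γ j t) : Mat2) - 1) :
    mulOp hg' * mulOp hg = -mulOp hg - mulOp hg' := by
  ext1 u
  refine L2.ext fun j => ?_
  filter_upwards [mulOp_ae hg u j, mulOp_ae hg' u j, mulOp_ae hg' (mulOp hg u) j,
    ae_arcLength_iff.1 (Lp.coeFn_sub (-mulOp hg u) (mulOp hg' u)) j,
    ae_arcLength_iff.1 (Lp.coeFn_neg (mulOp hg u)) j] with t h1 h2 h3 h4 h5
  have hinv : ((G⁻¹) (Γ.γ j t) : Mat2) * (G (Γ.γ j t) : Mat2) = 1 := Units.inv_mul _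
  change mulOp hg' (mulOp hg u) (Γ.γ j t) = (-mulOp hg u - mulOp hg' u) (Γ.γ j t)
  rw [h3, h4, Pi.sub_apply, h5, Pi.neg_apply, h1, h2, ← mul_assoc, sub_mul, mul_sub, hinv]
  noncomm_ring

lemma exists_cauchyMinus_and_regulator (Γ : ContourSystem) :
    (∃! C : Γ.L2 →L[ℂ] Γ.L2, Γ.IsCauchyMinus C) ∧
    ∀ C : Γ.L2 →L[ℂ] Γ.L2, Γ.IsCauchyMinus C →
      ∀ G : ℂ → GL (Fin 2) ℂ, Γ.ContinuesAnalytically G →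
        ∃ T S K : Γ.L2 →L[ℂ] Γ.L2,
          Γ.IsSingularOperator C G T ∧ Γ.IsSingularOperator C G⁻¹ S ∧
          S ∘L T = 1 + K ∧ IsCompactOperator K ∧ Γ.IsRegularIntegralOperator K := by
  refine ⟨⟨Γ.cauchyMinus, Γ.isCauchyMinus_cauchyMinus,
    fun C hC => hC.unique Γ.isCauchyMinus_cauchyMinus⟩, fun C hC G hG => ?_⟩
  obtain rfl := hC.unique Γ.isCauchyMinus_cauchyMinus
  have hs : ∀ j, ContDiff ℝ ∞ fun t => (G (Γ.γ j t) : Mat2) - 1 := fun j =>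
    (hG.contDiff j).sub contDiff_const
  have hg : ∀ j, IsPerHolder fun t => (G (Γ.γ j t) : Mat2) - 1 := fun j =>
    IsPerHolder.of_contDiff ((hs j).of_le (by exact_mod_cast le_top))
      fun t => by rw [Γ.periodic]
  have hg' : ∀ j, IsPerHolder fun t => ((G⁻¹) (Γ.γ j t) : Mat2) - 1 := fun j =>
    IsPerHolder.of_contDiff (((hG.contDiff_inv j).sub contDiff_const).of_le
      (by exact_mod_cast le_top)) fun t => by rw [Γ.periodic]
  -- The two summands are `Q[C,P]C` and `QP(C² + C)`, with `P = G - I` and `Q = G⁻¹ - I`.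
  have hK := ((isKernelOp_cauchyMinus_commutator hg hs).mulOp_comp
    hg').comp_cauchyMinus.add ((isKernelOp_cauchyMinus_sq_add.mulOp_comp
      hg).mulOp_comp hg')
  exact ⟨_, _, _, isSingularOperator_mulOp hg,
    isSingularOperator_mulOp hg',
    regulator_identity (mulOp_mul_mulOp hg hg'),
    hK.isCompactOperator, hK.isRegularIntegralOperator⟩

end Regulator

end ContourSystem

end FrobeniusNorm

theorem theorem1 (Γ : ContourSystem) :
    (∃! C : Γ.L2 →L[ℂ] Γ.L2, Γ.IsCauchyMinus C) ∧
    ∀ C : Γ.L2 →L[ℂ] Γ.L2, Γ.IsCauchyMinus C →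
      ∀ G : ℂ → GL (Fin 2) ℂ, Γ.ContinuesAnalytically G →
        ∃ T S K : Γ.L2 →L[ℂ] Γ.L2,
          Γ.IsSingularOperator C G T ∧ Γ.IsSingularOperator C G⁻¹ S ∧
          S ∘L T = 1 + K ∧ IsCompactOperator K ∧ Γ.IsRegularIntegralOperator K := by
  exact Γ.exists_cauchyMinus_and_regulator
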